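/- Fix $\delta>0$; let $I=(-\delta,\delta)$ and $\Omega_0=\mathbb R\times I$ with coordinates $(s,t)$. For $h>0$ let $\mathscr D_{h,0}$ be the operator on $L^2(\Omega_0,\mathbb C^2)$ acting as $$\mathscr D_{h,0}=\begin{pmatrix}0&-ih\partial_s-h\partial_t+t\\-ih\partial_s+h\partial_t+t&0\end{pmatrix}$$ with domain $\{\psi\in H^1(\Omega_0,\mathbb C^2):\ \psi_1=\mp\psi_2 \text{ on } t=\pm\delta\}$ (infinite mass boundary condition). For $\xi\in\mathbb R$ let $\mathscr D_{h,0,\xi}$ be the operator on $L^2(I,\mathbb C^2)$ acting as $$\mathscr D_{h,0,\xi}=\begin{pmatrix}0&\xi-h\partial_t+t\\ \xi+h\partial_t+t&0\end{pmatrix}$$ with domain $\{\psi\in H^1(I,\mathbb C^2):\ \psi_1(\pm\delta)=\mp\psi_2(\pm\delta)\}$. For all $h>0$ and $\xi\in\mathbb R$ the operator $\mathscr D_{h,0,\xi}$ has a smallest positive eigenvalue, denoted by $\mu_1^+(\xi,h)$. Put $$\nu_1(\xi,h)=\frac{h\left(e^{-(\xi-\delta)^2/h}+e^{-(\xi+\delta)^2/h}\right)}{\int_{-\delta}^{\delta}e^{-(\xi+t)^2/h}\,\mathrm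 dt},\qquad \lambda^+_{\rm ess}(h)=\inf_{\xi\in\mathbb R}\mu_1^+(\xi,h).$$ Then the following holds, with $\delta$ fixed and $o(1)$ meant as $h\to0^+$. (a) For all $h>0$ and $\xi\in\mathbb R$, $\mu_1^+(\xi,h)\le\nu_1(\xi,h)$. (b) For all $h>0$, $\min_{\xi\in\mathbb R}\nu_1(\xi,h)=\nu_1(0,h)$, and $\nu_1(0,h)=2\sqrt{\frac h\pi}\,e^{-\delta^2/h}(1+o(1))$. (c) For all $h>0$ and $|\xi|>\delta$, $\mu_1^+(\xi,h)\ge|\xi|-\delta-\dfrac{h}{|\xi|-\delta}$. (d) There is a function $r$ of $h$ alone with $r(h)\to0$ as $h\to0^+$ such that for all $h>0$ and all $\xi\in\mathbb R$ with $\mu_1^+(\xi,h)\le2\sqrt h\,e^{-\delta^2/h}$ one has $\mu_1^+(\xi,h)\ge\nu_1(\xi,h)(1+r(h))$. Consequently, for all $h>0$, $\mathrm{sp}(\mathscr D_{h,0})\cap[0,\infty)=[\lambda^+_{\rm ess}(h),\infty)$, and $\lambda^+_{\rm ess}(h)=2\sqrt{\frac h\pi}\,e^{-\delta^2/h}(1+o(1))$.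 -/

import Mathlib

open MeasureTheory Set Filter Topology Asymptotics
open scoped ContDiff

noncomputable section

namespace DiracStrip

/-! ### Unbounded operators: spectrum and eigenvalues -/

section Unbounded

variable {H : Type*} [NormedAddCommGroup H] [NormedSpace ℂ H]

/-- The resolvent set of an unbounded operator `T`: the complex numbers `z` for which
`T - z : Dom T → H` is a bijection with bounded inverse `R`. -/
def resolventSet (T : H →ₗ.[ℂ] H) : Set ℂ :=
  {z | ∃ R : H →L[ℂ] H,
    (∀ f : H, ∃ hf : R f ∈ T.domain, T ⟨R f, hf⟩ - z • R f = f) ∧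
    ∀ x : T.domain, R (T x - z • (x : H)) = x}

/-- The spectrum of an unbounded operator. -/
def spectrum (T : H →ₗ.[ℂ] H) : Set ℂ := (resolventSet T)ᶜ

/-- `z` is an eigenvalue of the unbounded operator `T`. -/
def IsEigenvalue (T : H →ₗ.[ℂ] H) (z : ℂ) : Prop :=
  ∃ x : T.domain, (x : H) ≠ 0 ∧ T x = z • (x : H)

end Unbounded

/-- Values of the wave functions; the components `ψ₁, ψ₂` are `ψ 0, ψ 1`. -/
abbrev Spinor : Type := EuclideanSpace ℂ (Fin 2)

/-! ### The fibered one-dimensional Dirac operator on `I = (-δ, δ)` -/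

/-- Lebesgue measure on `I = (-δ, δ)`. -/
abbrev intervalMeasure (δ : ℝ) : Measure ℝ := volume.restrict (Ioo (-δ) δ)

/-- `L²(I, ℂ²)`. -/
abbrev L2Interval (δ : ℝ) : Type := Lp Spinor 2 (intervalMeasure δ)

/-- `u` is (on `[-δ, δ]`) the absolutely continuous representative of an element of `H¹(I, ℂ²)`,
and `v ∈ L²(I, ℂ²)` is its derivative. -/
structure IsH1Interval (δ : ℝ) (u v : ℝ → Spinor) : Prop where
  memLp : MemLp u 2 (intervalMeasure δ)
  memLp_deriv : MemLp v 2 (intervalMeasure δ)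
  eq_integral : ∀ t ∈ Icc (-δ) δ, u t = u (-δ) + ∫ x in (-δ)..t, v x

/-- The boundary condition `ψ₁(±δ) = ∓ψ₂(±δ)`. -/
def FiberBC (δ : ℝ) (u : ℝ → Spinor) : Prop :=
  u δ 0 = -(u δ 1) ∧ u (-δ) 0 = u (-δ) 1

/-- The differential expression
`(ψ₁, ψ₂) ↦ ((ξ + t) ψ₂ - h ψ₂', (ξ + t) ψ₁ + h ψ₁')`, where `v` stands for `ψ'`. -/
def fiberExpr (h ξ : ℝ) (u v : ℝ → Spinor) (t : ℝ) : Spinor :=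
  !₂[((ξ + t : ℝ) : ℂ) * u t 1 - (h : ℂ) * v t 1,
     ((ξ + t : ℝ) : ℂ) * u t 0 + (h : ℂ) * v t 0]

theorem intervalIntegrable_of_memLp {δ : ℝ} {v : ℝ → Spinor}
    (hv : MemLp v 2 (intervalMeasure δ)) {t : ℝ} (ht : t ∈ Icc (-δ) δ) :
    IntervalIntegrable v volume (-δ) t := by
  have h1 : IntegrableOn v (Ioo (-δ) δ) volume := hv.integrable (by norm_num)
  rw [intervalIntegrable_iff_integrableOn_Ioo_of_le ht.1]
  exact h1.mono_set (Ioo_subset_Ioo_right ht.2)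

/-- The graph of the fibered Dirac operator: the pairs `(ψ, f)` where `ψ ∈ H¹(I, ℂ²)` satisfies the
boundary condition and `f` is the differential expression applied to `ψ`. -/
def fiberGraph (δ h ξ : ℝ) : Submodule ℂ (L2Interval δ × L2Interval δ) where
  carrier := {q | ∃ u v : ℝ → Spinor, IsH1Interval δ u v ∧ FiberBC δ u ∧
    q.1 =ᵐ[intervalMeasure δ] u ∧ q.2 =ᵐ[intervalMeasure δ] fiberExpr h ξ u v}
  zero_mem' := by
    refine ⟨0, 0, ⟨MemLp.zero, MemLp.zero, by simp⟩, by simp [FiberBC], Lp.coeFn_zero _ _ _, ?_⟩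
    filter_upwards [Lp.coeFn_zero Spinor 2 (intervalMeasure δ)] with t ht
    simp only [Prod.snd_zero]
    rw [ht]
    ext i
    fin_cases i <;> simp [fiberExpr]
  add_mem' := by
    rintro ⟨ψ, f⟩ ⟨ψ', f'⟩ ⟨u, v, hH, hB, h1, h2⟩ ⟨u', v', hH', hB', h1', h2'⟩
    refine ⟨u + u', v + v', ⟨hH.memLp.add hH'.memLp, hH.memLp_deriv.add hH'.memLp_deriv, ?_⟩,
      ?_, ?_, ?_⟩
    · intro t ht
      have e := intervalIntegral.integral_add
        (intervalIntegrable_of_memLp hH.memLp_deriv ht)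
        (intervalIntegrable_of_memLp hH'.memLp_deriv ht)
      simp only [Pi.add_apply]
      rw [e, hH.eq_integral t ht, hH'.eq_integral t ht]
      abel
    · refine ⟨?_, ?_⟩
      · simp only [Pi.add_apply, PiLp.add_apply, hB.1, hB'.1]; ring
      · simp only [Pi.add_apply, PiLp.add_apply, hB.2, hB'.2]
    · exact (Lp.coeFn_add ψ ψ').trans (h1.add h1')
    · refine (Lp.coeFn_add f f').trans ((h2.add h2').trans (Eventually.of_forall fun t => ?_))
      ext i
      fin_cases i <;> simp [fiberExpr] <;> ring
  smul_mem' := by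
    rintro c ⟨ψ, f⟩ ⟨u, v, hH, hB, h1, h2⟩
    refine ⟨c • u, c • v, ⟨hH.memLp.const_smul c, hH.memLp_deriv.const_smul c, ?_⟩, ?_, ?_, ?_⟩
    · intro t ht
      simp only [Pi.smul_apply]
      rw [intervalIntegral.integral_smul, hH.eq_integral t ht, smul_add]
    · refine ⟨?_, ?_⟩
      · simp only [Pi.smul_apply, PiLp.smul_apply, hB.1, smul_neg]
      · simp only [Pi.smul_apply, PiLp.smul_apply, hB.2]
    · exact (Lp.coeFn_smul c ψ).trans (h1.const_smul c)
    · refine (Lp.coeFn_smul c f).trans ((h2.const_smul c).trans (Eventually.of_forall fun t => ?_))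
      ext i
      fin_cases i <;> simp [fiberExpr] <;> ring

/-- The derivative of an `H¹` function is unique, hence the graph is that of an operator. -/
theorem fiberGraph_functional (δ h ξ : ℝ) :
    ∀ q ∈ fiberGraph δ h ξ, q.1 = 0 → q.2 = 0 := by
  rintro ⟨ψ, f⟩ ⟨u, v, hH, -, h1, h2⟩ h0
  simp only at h0 h1 h2 ⊢
  subst h0
  rcases le_or_gt δ 0 with hδ | hδ
  · apply Lp.ext
    have : Ioo (-δ) δ = ∅ := Ioo_eq_empty (by linarith)
    have hz : intervalMeasure δ = 0 := by
      change volume.restrict (Ioo (-δ) δ) = 0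
      rw [this, Measure.restrict_empty]
    have hz' : ae (intervalMeasure δ) = ⊥ := by rw [hz, ae_zero]
    rw [Filter.EventuallyEq, hz']
    exact Filter.eventually_bot
  have hle : -δ ≤ δ := by linarith
  have hint := intervalIntegrable_of_memLp hH.memLp_deriv (right_mem_Icc.2 hle)
  have hu0 : u =ᵐ[intervalMeasure δ] 0 := h1.symm.trans (Lp.coeFn_zero _ _ _)
  have hcontF : ContinuousOn (fun t => u (-δ) + ∫ x in (-δ)..t, v x) (Ioo (-δ) δ) := by
    refine continuousOn_const.add ?_
    have := intervalIntegral.continuousOn_primitive_interval' hint left_mem_uIcc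
    refine this.mono ?_
    rw [uIcc_of_le hle]
    exact Ioo_subset_Icc_self
  have hF : EqOn (fun t => u (-δ) + ∫ x in (-δ)..t, v x) 0 (Ioo (-δ) δ) := by
    refine Measure.eqOn_open_of_ae_eq (μ := volume) ?_ isOpen_Ioo hcontF continuousOn_const
    filter_upwards [hu0, ae_restrict_mem measurableSet_Ioo] with t ht htI
    rw [← ht, hH.eq_integral t (Ioo_subset_Icc_self htI)]
  have hv0 : v =ᵐ[intervalMeasure δ] 0 := by
    have hd := hint.ae_hasDerivAt_integral
    filter_upwards [ae_restrict_of_ae hd, ae_restrict_mem measurableSet_Ioo] with t ht htI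
    have hd1 := ht (by rw [uIcc_of_le hle]; exact Ioo_subset_Icc_self htI) (-δ) left_mem_uIcc
    have hd2 : HasDerivAt (fun t => u (-δ) + ∫ x in (-δ)..t, v x) (v t) t := hd1.const_add _
    have hd3 : HasDerivAt (fun _ : ℝ => (0 : Spinor)) (v t) t :=
      hd2.congr_of_eventuallyEq
        ((hF.eventuallyEq_of_mem (isOpen_Ioo.mem_nhds htI)).symm)
    exact hd3.unique (hasDerivAt_const t (0 : Spinor))
  apply Lp.ext
  filter_upwards [h2, hu0, hv0, Lp.coeFn_zero Spinor 2 (intervalMeasure δ)] with t e1 e2 e3 e4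
  rw [e1, e4]
  ext i
  fin_cases i <;> simp [fiberExpr, e2, e3]

/-- The fibered Dirac operator on `L²(I, ℂ²)`. -/
def fiberDirac (δ h ξ : ℝ) : L2Interval δ →ₗ.[ℂ] L2Interval δ :=
  (fiberGraph δ h ξ).toLinearPMap

theorem fiberDirac_graph (δ h ξ : ℝ) : (fiberDirac δ h ξ).graph = fiberGraph δ h ξ :=
  Submodule.toLinearPMap_graph_eq _ (fiberGraph_functional δ h ξ)

/-- The positive eigenvalues of the fibered Dirac operator. -/
def positiveEigenvalues (δ ξ h : ℝ) : Set ℝ :=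
  {l | 0 < l ∧ IsEigenvalue (fiberDirac δ h ξ) (l : ℂ)}

/-- The first positive dispersion curve `μ₁⁺(ξ, h)`. -/
def mu1 (δ ξ h : ℝ) : ℝ := sInf (positiveEigenvalues δ ξ h)

/-- The Gaussian ratio `ν₁(ξ, h)`. -/
def nu1 (δ ξ h : ℝ) : ℝ :=
  h * (Real.exp (-(ξ - δ) ^ 2 / h) + Real.exp (-(ξ + δ) ^ 2 / h)) /
    ∫ t in (-δ)..δ, Real.exp (-(ξ + t) ^ 2 / h)

/-- `λ⁺_ess(h) = inf_ξ μ₁⁺(ξ, h)`. -/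
def lambdaEss (δ h : ℝ) : ℝ := ⨅ ξ : ℝ, mu1 δ ξ h

/-! ### The two-dimensional Dirac operator on the straight strip `Ω₀ = ℝ × (-δ, δ)` -/

/-- The straight strip, with coordinates `(s, t)`. -/
def strip (δ : ℝ) : Set (ℝ × ℝ) := univ ×ˢ Ioo (-δ) δ

/-- Lebesgue measure on the strip. -/
abbrev stripMeasure (δ : ℝ) : Measure (ℝ × ℝ) := volume.restrict (strip δ)

/-- `L²(Ω₀, ℂ²)`. -/
abbrev L2Strip (δ : ℝ) : Type := Lp Spinor 2 (stripMeasure δ)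

/-- `v` is the weak derivative of `u` on `Ω₀` in the direction `e`. -/
def HasWeakDeriv (δ : ℝ) (e : ℝ × ℝ) (u v : ℝ × ℝ → Spinor) : Prop :=
  ∀ φ : ℝ × ℝ → ℝ, ContDiff ℝ ∞ φ → HasCompactSupport φ → tsupport φ ⊆ strip δ →
    ∫ p, fderiv ℝ φ p e • u p ∂(stripMeasure δ) = -∫ p, φ p • v p ∂(stripMeasure δ)

/-- `u ∈ H¹(Ω₀, ℂ²)` with weak partial derivatives `us = ∂ₛu` and `ut = ∂ₜu`. -/
structure IsH1Strip (δ : ℝ) (u us ut : ℝ × ℝ → Spinor) : Prop where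
  memLp : MemLp u 2 (stripMeasure δ)
  memLp_s : MemLp us 2 (stripMeasure δ)
  memLp_t : MemLp ut 2 (stripMeasure δ)
  weak_s : HasWeakDeriv δ (1, 0) u us
  weak_t : HasWeakDeriv δ (0, 1) u ut

/-- `gp, gm ∈ L²(ℝ, ℂ²)` are the traces of `u ∈ H¹(Ω₀, ℂ²)` on the boundary lines `t = δ` and
`t = -δ`, characterized by Green's formula, with test functions that do not have to vanish at
the boundary. -/
structure HasTraces (δ : ℝ) (u ut : ℝ × ℝ → Spinor) (gp gm : ℝ → Spinor) : Prop where
  memLp_p : MemLp gp 2 volume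
  memLp_m : MemLp gm 2 volume
  green : ∀ φ : ℝ × ℝ → ℝ, ContDiff ℝ ∞ φ → HasCompactSupport φ →
    ∫ p, fderiv ℝ φ p (0, 1) • u p ∂(stripMeasure δ) =
      (∫ s, φ (s, δ) • gp s) - (∫ s, φ (s, -δ) • gm s) - ∫ p, φ p • ut p ∂(stripMeasure δ)

/-- The infinite mass boundary condition `-iσ₃(σ·N)ψ = ψ`. As `N = (0, ±1)` at `t = ±δ` and
`-iσ₃σ₂ = -σ₁`, it reads `ψ₁ = -ψ₂` at `t = δ` and `ψ₁ = ψ₂` at `t = -δ`. -/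
def StripBC (gp gm : ℝ → Spinor) : Prop :=
  (∀ᵐ s, gp s 0 = -(gp s 1)) ∧ ∀ᵐ s, gm s 0 = gm s 1

/-- The differential expression
`(ψ₁, ψ₂) ↦ (-ih∂ₛψ₂ - h∂ₜψ₂ + tψ₂, -ih∂ₛψ₁ + h∂ₜψ₁ + tψ₁)`,
where `us, ut` stand for `∂ₛψ, ∂ₜψ`. -/
def stripExpr (h : ℝ) (u us ut : ℝ × ℝ → Spinor) (p : ℝ × ℝ) : Spinor :=
  !₂[-Complex.I * h * us p 1 - h * ut p 1 + p.2 * u p 1,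
     -Complex.I * h * us p 0 + h * ut p 0 + p.2 * u p 0]

theorem isOpen_strip (δ : ℝ) : IsOpen (strip δ) := isOpen_univ.prod isOpen_Ioo

theorem integrable_test {X : Type*} [TopologicalSpace X] [MeasurableSpace X]
    [OpensMeasurableSpace X] {μ : Measure X} [IsFiniteMeasureOnCompacts μ]
    {φ : X → ℝ} (hφ : Continuous φ) (hc : HasCompactSupport φ)
    {u : X → Spinor} (hu : MemLp u 2 μ) : Integrable (fun x => φ x • u x) μ :=
  memLp_one_iff_integrable.1 (hu.smul (hφ.memLp_of_hasCompactSupport hc (p := 2)))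

theorem continuous_test_deriv {φ : ℝ × ℝ → ℝ} (hφ : ContDiff ℝ ∞ φ) (e : ℝ × ℝ) :
    Continuous fun p => fderiv ℝ φ p e :=
  (hφ.continuous_fderiv (by simp)).clm_apply continuous_const

theorem compact_test_line {φ : ℝ × ℝ → ℝ} (hc : HasCompactSupport φ) (a : ℝ) :
    HasCompactSupport fun s => φ (s, a) := by
  have : Topology.IsClosedEmbedding fun s : ℝ => (s, a) :=
    Topology.IsClosedEmbedding.of_continuous_injective_isClosedMap
      (by fun_prop) (fun x y hxy => (Prod.mk.inj hxy).1)
      (isClosedMap_prodMk_right a)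
  exact hc.comp_isClosedEmbedding this

theorem HasWeakDeriv.add {δ : ℝ} {e : ℝ × ℝ} {u v u' v' : ℝ × ℝ → Spinor}
    (hu : MemLp u 2 (stripMeasure δ)) (hv : MemLp v 2 (stripMeasure δ))
    (hu' : MemLp u' 2 (stripMeasure δ)) (hv' : MemLp v' 2 (stripMeasure δ))
    (H : HasWeakDeriv δ e u v) (H' : HasWeakDeriv δ e u' v') :
    HasWeakDeriv δ e (u + u') (v + v') := by
  intro φ hφ hc hs
  have c1 := continuous_test_deriv hφ e
  have c2 := hc.fderiv_apply ℝ e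
  simp only [Pi.add_apply, smul_add]
  rw [integral_add (integrable_test c1 c2 hu) (integrable_test c1 c2 hu'),
    integral_add (integrable_test hφ.continuous hc hv) (integrable_test hφ.continuous hc hv'),
    H φ hφ hc hs, H' φ hφ hc hs]
  abel

theorem HasWeakDeriv.const_smul {δ : ℝ} {e : ℝ × ℝ} {u v : ℝ × ℝ → Spinor} (c : ℂ)
    (H : HasWeakDeriv δ e u v) : HasWeakDeriv δ e (c • u) (c • v) := by
  intro φ hφ hc hs
  simp only [Pi.smul_apply, smul_comm _ c]
  rw [integral_smul, integral_smul, H φ hφ hc hs, smul_neg]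

theorem HasWeakDeriv.eq_zero {δ : ℝ} {e : ℝ × ℝ} {u v : ℝ × ℝ → Spinor}
    (hv : MemLp v 2 (stripMeasure δ)) (hu : u =ᵐ[stripMeasure δ] 0)
    (H : HasWeakDeriv δ e u v) : v =ᵐ[stripMeasure δ] 0 := by
  have hloc : LocallyIntegrableOn v (strip δ) volume :=
    locallyIntegrableOn_of_locallyIntegrable_restrict (hv.locallyIntegrable (by norm_num))
  have := (isOpen_strip δ).ae_eq_zero_of_integral_contDiff_smul_eq_zero hloc ?_
  · exact (ae_restrict_iff' (isOpen_strip δ).measurableSet).2 this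
  · intro φ hφ hc hs
    have h1 : ∫ p, φ p • v p ∂(stripMeasure δ) = 0 := by
      rw [← neg_eq_zero, ← H φ hφ hc hs]
      refine integral_eq_zero_of_ae ?_
      filter_upwards [hu] with p hp
      simp [hp]
    rw [← h1]
    refine (setIntegral_eq_integral_of_forall_compl_eq_zero fun p hp => ?_).symm
    rw [image_eq_zero_of_notMem_tsupport fun hp' => hp (hs hp'), zero_smul]

/-- The graph of the Dirac operator on the strip: the pairs `(ψ, f)` where `ψ ∈ H¹(Ω₀, ℂ²)`
satisfies the boundary condition and `f` is the differential expression applied to `ψ`. -/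
def stripGraph (δ h : ℝ) : Submodule ℂ (L2Strip δ × L2Strip δ) where
  carrier := {q | ∃ (u us ut : ℝ × ℝ → Spinor) (gp gm : ℝ → Spinor),
    IsH1Strip δ u us ut ∧ HasTraces δ u ut gp gm ∧ StripBC gp gm ∧
    q.1 =ᵐ[stripMeasure δ] u ∧ q.2 =ᵐ[stripMeasure δ] stripExpr h u us ut}
  zero_mem' := by
    refine ⟨0, 0, 0, 0, 0, ⟨MemLp.zero, MemLp.zero, MemLp.zero, ?_, ?_⟩,
      ⟨MemLp.zero, MemLp.zero, ?_⟩, ?_, Lp.coeFn_zero _ _ _, ?_⟩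
    · intro φ _ _ _; simp
    · intro φ _ _ _; simp
    · intro φ _ _; simp
    · simp [StripBC]
    · filter_upwards [Lp.coeFn_zero Spinor 2 (stripMeasure δ)] with t ht
      simp only [Prod.snd_zero]
      rw [ht]
      ext i
      fin_cases i <;> simp [stripExpr]
  add_mem' := by
    rintro ⟨ψ, f⟩ ⟨ψ', f'⟩ ⟨u, us, ut, gp, gm, hH, hT, hB, h1, h2⟩
      ⟨u', us', ut', gp', gm', hH', hT', hB', h1', h2'⟩
    refine ⟨u + u', us + us', ut + ut', gp + gp', gm + gm',
      ⟨hH.memLp.add hH'.memLp, hH.memLp_s.add hH'.memLp_s, hH.memLp_t.add hH'.memLp_t,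
        hH.weak_s.add hH.memLp hH.memLp_s hH'.memLp hH'.memLp_s hH'.weak_s,
        hH.weak_t.add hH.memLp hH.memLp_t hH'.memLp hH'.memLp_t hH'.weak_t⟩,
      ⟨hT.memLp_p.add hT'.memLp_p, hT.memLp_m.add hT'.memLp_m, ?_⟩, ?_, ?_, ?_⟩
    · intro φ hφ hc
      have c1 := continuous_test_deriv hφ (0, 1)
      have c2 := hc.fderiv_apply ℝ (0, 1)
      have cl : ∀ a : ℝ, Continuous fun s => φ (s, a) := fun a =>
        hφ.continuous.comp (by fun_prop)
      simp only [Pi.add_apply, smul_add]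
      rw [integral_add (integrable_test c1 c2 hH.memLp) (integrable_test c1 c2 hH'.memLp),
        integral_add (integrable_test hφ.continuous hc hH.memLp_t)
          (integrable_test hφ.continuous hc hH'.memLp_t),
        integral_add (integrable_test (cl δ) (compact_test_line hc δ) hT.memLp_p)
          (integrable_test (cl δ) (compact_test_line hc δ) hT'.memLp_p),
        integral_add (integrable_test (cl (-δ)) (compact_test_line hc (-δ)) hT.memLp_m)
          (integrable_test (cl (-δ)) (compact_test_line hc (-δ)) hT'.memLp_m),
        hT.green φ hφ hc, hT'.green φ hφ hc]
      abel
    · refine ⟨?_, ?_⟩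
      · filter_upwards [hB.1, hB'.1] with s e e'
        simp only [Pi.add_apply, PiLp.add_apply, e, e']; ring
      · filter_upwards [hB.2, hB'.2] with s e e'
        simp only [Pi.add_apply, PiLp.add_apply, e, e']
    · exact (Lp.coeFn_add ψ ψ').trans (h1.add h1')
    · refine (Lp.coeFn_add f f').trans ((h2.add h2').trans (Eventually.of_forall fun t => ?_))
      ext i
      fin_cases i <;> simp [stripExpr] <;> ring
  smul_mem' := by
    rintro c ⟨ψ, f⟩ ⟨u, us, ut, gp, gm, hH, hT, hB, h1, h2⟩
    refine ⟨c • u, c • us, c • ut, c • gp, c • gm,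
      ⟨hH.memLp.const_smul c, hH.memLp_s.const_smul c, hH.memLp_t.const_smul c,
        hH.weak_s.const_smul c, hH.weak_t.const_smul c⟩,
      ⟨hT.memLp_p.const_smul c, hT.memLp_m.const_smul c, ?_⟩, ?_, ?_, ?_⟩
    · intro φ hφ hc
      simp only [Pi.smul_apply, smul_comm _ c]
      rw [integral_smul, integral_smul, integral_smul, integral_smul, hT.green φ hφ hc,
        smul_sub, smul_sub]
    · refine ⟨?_, ?_⟩
      · filter_upwards [hB.1] with s e
        simp only [Pi.smul_apply, PiLp.smul_apply, e, smul_neg]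
      · filter_upwards [hB.2] with s e
        simp only [Pi.smul_apply, PiLp.smul_apply, e]
    · exact (Lp.coeFn_smul c ψ).trans (h1.const_smul c)
    · refine (Lp.coeFn_smul c f).trans ((h2.const_smul c).trans (Eventually.of_forall fun t => ?_))
      ext i
      fin_cases i <;> simp [stripExpr] <;> ring

/-- Weak derivatives are unique, hence the graph is that of an operator. -/
theorem stripGraph_functional (δ h : ℝ) :
    ∀ q ∈ stripGraph δ h, q.1 = 0 → q.2 = 0 := by
  rintro ⟨ψ, f⟩ ⟨u, us, ut, gp, gm, hH, -, -, h1, h2⟩ h0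
  simp only at h0 h1 h2 ⊢
  subst h0
  have hu0 : u =ᵐ[stripMeasure δ] 0 := h1.symm.trans (Lp.coeFn_zero _ _ _)
  apply Lp.ext
  filter_upwards [h2, hu0, hH.weak_s.eq_zero hH.memLp_s hu0, hH.weak_t.eq_zero hH.memLp_t hu0,
    Lp.coeFn_zero Spinor 2 (stripMeasure δ)] with p e1 e2 e3 e4 e5
  rw [e1, e5]
  ext i
  fin_cases i <;> simp [stripExpr, e2, e3, e4]

/-- The magnetic Dirac operator on `L²(Ω₀, ℂ²)`. Its domain consists of all `ψ ∈ H¹(Ω₀, ℂ²)` that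
satisfy the infinite mass boundary condition (`t` being bounded on the strip, the differential
expression always lies in `L²`). -/
def stripDirac (δ h : ℝ) : L2Strip δ →ₗ.[ℂ] L2Strip δ :=
  (stripGraph δ h).toLinearPMap

theorem stripDirac_graph (δ h : ℝ) : (stripDirac δ h).graph = stripGraph δ h :=
  Submodule.toLinearPMap_graph_eq _ (stripGraph_functional δ h)

end DiracStrip

end

noncomputable section

namespace DiracStrip

/-! ### Prüfer angles -/

/-! The fibre problem is a planar linear system. For a real solution in polar form, `𝒟_ξ ψ = l ψ`
reduces to the scalar equation `h θ' = (ξ + t) sin 2θ - l`. The boundary conditions become `θ(-δ) =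
π/4` and `θ(δ) = -π/4` modulo `π`. The final angle is nonincreasing in `l`, nonnegative at `l = 0`,
at most `π/2` for `l ≥ 0`, and at most `-π/4` for some large `l`. Hence the first `l` at which it
equals `-π/4` is the smallest positive eigenvalue (`exists_first_crossing`, `mu1_spec`). The
boundary defect of the solution started at `-δ` is positive for `0 ≤ l < μ₁⁺`
(`defect_pos_of_lt_mu1`).

At `l = μ₁⁺` the angle stays in `[-π/4, π/4]`, so `y = tan θ` satisfies `|y| ≤ 1` and runs from `1`
to `-1`. With the Gaussian weight `g = e^{-(ξ+t)²/h}` the Riccati equation for `y` reads `(g y)' =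
-(μ₁⁺/h) g (1 + y²)`. Integrating gives `μ₁⁺ (∫ g + Q) = h (g(-δ) + g(δ))` with `Q = ∫ g y²`
(`exists_mu1_mul_eq`). From `Q ≥ 0` one gets (a). From `Q ≤ ∫ g` one gets `ν₁ ≤ 2 μ₁⁺`. Since `g y`
is decreasing, `Q ≤ 2δ (g(-δ) + g(δ))`, which makes the ratio `ν₁/μ₁⁺` at most `1 + 2δ ν₁/h`. This
gives (d) and the asymptotics of the infimum. Part (b) is a symmetrization (`nu1_zero_le`) and a
Gaussian integral. Part (c) holds even without the correction term, because for `l < ξ - δ` the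
angle can never leave `π/4` downwards (`abs_sub_le_mu1`).

For the strip, every `l ≥ λ⁺_ess` is an eigenvalue of some fibre (`exists_defect_eq_zero`). A plane
wave times a slowly varying profile times the fibre eigenfunction is then an approximate
eigenvector, so `l` is in the spectrum (`mem_spectrum_of_defect_eq_zero`).

Conversely, if `0 ≤ l < λ⁺_ess` then no defect vanishes. The fibre resolvents are given by variation
of constants and are bounded uniformly in the frequency: by compactness for small frequencies, by an
energy identity for large ones (`exists_res_bound`). Fourier synthesis in `s` assembles them on a
dense set. The extension by continuity still maps into the domain, because weak derivatives, Green's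
formula and the boundary conditions survive `L²` limits (`exists_right_inverse`). Injectivity is
proved by duality: an eigenfunction is tested against a cutoff times a plane wave times a fibre
resolvent, and the only surviving term contains the derivative of the cutoff
(`integral_cutoff_wave`, `eq_zero_of_mem_graph`). A bounded right inverse of an injective operator
is the resolvent. -/

/-- The Prüfer vector field: for `ψ = (r cos θ, r sin θ)` with `𝒟_ξ ψ = l ψ`, one has
`θ' = ((ξ + t) sin 2θ - l) / h`. -/
def angleField (h ξ l t x : ℝ) : ℝ := ((ξ + t) * Real.sin (2 * x) - l) / h

/-- `θ` is the Prüfer angle of the solution satisfying the boundary condition at `-δ`. -/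
structure IsAngle (δ h ξ l : ℝ) (θ : ℝ → ℝ) : Prop where
  init : θ (-δ) = Real.pi / 4
  hasDerivAt : ∀ t ∈ Icc (-δ) δ, HasDerivAt θ (angleField h ξ l t (θ t)) t

theorem abs_sin_two_mul_sub_le (x y : ℝ) :
    |Real.sin (2 * x) - Real.sin (2 * y)| ≤ 2 * |x - y| := by
  have h1 : LipschitzWith 1 Real.sin := by
    refine lipschitzWith_of_nnnorm_deriv_le Real.differentiable_sin fun x => ?_
    rw [Real.deriv_sin, ← NNReal.coe_le_coe, coe_nnnorm]
    exact Real.abs_cos_le_one x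
  have := h1.dist_le_mul (2 * x) (2 * y)
  rw [Real.dist_eq, Real.dist_eq, ← mul_sub, abs_mul] at this
  simpa using this

theorem abs_angleField_sub_le {h ξ l t : ℝ} (hh : 0 < h) {B : ℝ} (ht : |ξ + t| ≤ B) (x y : ℝ) :
    |angleField h ξ l t x - angleField h ξ l t y| ≤ 2 * B / h * |x - y| := by
  have e : angleField h ξ l t x - angleField h ξ l t y =
      (ξ + t) * (Real.sin (2 * x) - Real.sin (2 * y)) / h := by
    simp only [angleField]; ring
  rw [e, abs_div, abs_mul, abs_of_pos hh]
  calc |ξ + t| * |Real.sin (2 * x) - Real.sin (2 * y)| / h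
      ≤ B * (2 * |x - y|) / h := by
        gcongr
        · exact (abs_nonneg _).trans ht
        · exact abs_sin_two_mul_sub_le x y
    _ = 2 * B / h * |x - y| := by ring

theorem exists_isAngle {δ h : ℝ} (hδ : 0 < δ) (hh : 0 < h) (ξ l : ℝ) :
    ∃ θ, IsAngle δ h ξ l θ := by
  set B : ℝ := |ξ| + 2 * δ
  have hB : 0 ≤ B := by positivity
  have hBt : ∀ t ∈ Icc (-(2 * δ)) (2 * δ), |ξ + t| ≤ B := fun t ht =>
    (abs_add_le _ _).trans (add_le_add le_rfl (abs_le.2 ⟨ht.1, ht.2⟩))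
  -- The equation is solved on `[-2δ, 2δ]` so that the derivatives at `±δ` are two-sided. The radius
  -- is the bound of the field times `3δ`, the largest distance from the initial time `-δ`.
  have hPL : IsPicardLindelof (angleField h ξ l) (tmin := -(2 * δ)) (tmax := 2 * δ)
      ⟨-δ, by constructor <;> linarith⟩ (Real.pi / 4) ((B + |l|) / h * (3 * δ)).toNNReal 0
      ((B + |l|) / h).toNNReal (2 * B / h).toNNReal := by
    refine ⟨fun t ht => ?_, fun x _ => ?_, fun t ht x _ => ?_, ?_⟩
    · refine LipschitzWith.lipschitzOnWith (LipschitzWith.of_dist_le_mul fun x y => ?_)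
      rw [Real.coe_toNNReal _ (by positivity), Real.dist_eq, Real.dist_eq]
      exact abs_angleField_sub_le hh (hBt t ht) x y
    · unfold angleField; fun_prop
    · rw [Real.coe_toNNReal _ (by positivity), angleField, Real.norm_eq_abs, abs_div,
        abs_of_pos hh]
      gcongr
      refine (abs_sub _ _).trans (add_le_add ?_ le_rfl)
      rw [abs_mul]
      have := mul_le_mul (hBt t ht) (Real.abs_sin_le_one (2 * x)) (abs_nonneg _) hB
      simpa using this
    · rw [Real.coe_toNNReal _ (by positivity), Real.coe_toNNReal _ (by positivity)]
      simp only [NNReal.coe_zero, sub_zero]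
      gcongr
      exact max_le (by linarith) (by linarith)
  obtain ⟨θ, h0, h1⟩ := hPL.exists_eq_forall_mem_Icc_hasDerivWithinAt₀
  refine ⟨θ, h0, fun t ht => (h1 t ?_).hasDerivAt (Icc_mem_nhds ?_ ?_)⟩
  · exact ⟨by linarith [ht.1], by linarith [ht.2]⟩
  · linarith [ht.1]
  · linarith [ht.2]

/-- The Prüfer angle. -/
def angle (δ h ξ l : ℝ) : ℝ → ℝ := Classical.epsilon (IsAngle δ h ξ l)

theorem isAngle_angle {δ h : ℝ} (hδ : 0 < δ) (hh : 0 < h) (ξ l : ℝ) :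
    IsAngle δ h ξ l (angle δ h ξ l) :=
  Classical.epsilon_spec (exists_isAngle hδ hh ξ l)

namespace IsAngle

variable {δ h ξ l : ℝ} {θ : ℝ → ℝ}

theorem continuousOn (H : IsAngle δ h ξ l θ) : ContinuousOn θ (Icc (-δ) δ) := fun t ht =>
  (H.hasDerivAt t ht).continuousAt.continuousWithinAt

/-- Whenever `θ` touches the level `c` its slope is negative, so the level cannot be crossed
upwards. Only the sign of the field on the level itself matters. -/
theorem le_of_field_neg (H : IsAngle δ h ξ l θ) {a b c : ℝ} (ha : -δ ≤ a) (hb : b ≤ δ)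
    (h0 : θ a ≤ c) (hf : ∀ t ∈ Ico a b, angleField h ξ l t c < 0) :
    ∀ t ∈ Icc a b, θ t ≤ c := by
  have hs : Icc a b ⊆ Icc (-δ) δ := Icc_subset_Icc ha hb
  refine image_le_of_deriv_right_lt_deriv_boundary' (H.continuousOn.mono hs)
    (fun t ht => (H.hasDerivAt t (hs (Ico_subset_Icc_self ht))).hasDerivWithinAt) h0
    continuousOn_const (fun t _ => hasDerivWithinAt_const t _ c) fun t ht e => ?_
  rw [e]
  exact hf t ht

theorem ge_of_field_pos (H : IsAngle δ h ξ l θ) {a b c : ℝ} (ha : -δ ≤ a) (hb : b ≤ δ)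
    (h0 : c ≤ θ a) (hf : ∀ t ∈ Ico a b, 0 < angleField h ξ l t c) :
    ∀ t ∈ Icc a b, c ≤ θ t := by
  have hs : Icc a b ⊆ Icc (-δ) δ := Icc_subset_Icc ha hb
  refine image_le_of_deriv_right_lt_deriv_boundary' continuousOn_const
    (fun t _ => hasDerivWithinAt_const t _ c) h0 (H.continuousOn.mono hs)
    (fun t ht => (H.hasDerivAt t (hs (Ico_subset_Icc_self ht))).hasDerivWithinAt)
    fun t ht e => ?_
  rw [← e]
  exact hf t ht

/-- At a contact of the two angles the fields differ by `(l - l') / h`, so the one with the larger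
`l` has the strictly smaller slope and cannot overtake. -/
theorem antitone (hh : 0 < h) {l' : ℝ} {θ' : ℝ → ℝ} (H : IsAngle δ h ξ l θ)
    (H' : IsAngle δ h ξ l' θ') (hl : l < l') : ∀ t ∈ Icc (-δ) δ, θ' t ≤ θ t := by
  refine image_le_of_deriv_right_lt_deriv_boundary' H'.continuousOn
    (fun t ht => (H'.hasDerivAt t (Ico_subset_Icc_self ht)).hasDerivWithinAt)
    (by rw [H.init, H'.init]) H.continuousOn
    (fun t ht => (H.hasDerivAt t (Ico_subset_Icc_self ht)).hasDerivWithinAt)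
    fun t ht e => ?_
  rw [e]
  unfold angleField
  gcongr

/-- Grönwall's inequality: since `|sin| ≤ 1`, changing the parameters perturbs the field by at most
`(|ξ - ξ'| + |l - l'|) / h`. The constant depends on `ξ` but not on `ξ'` or `l'`, which is what
continuity at `(ξ, l)` requires. -/
theorem dist_le (hδ : 0 < δ) (hh : 0 < h) (H : IsAngle δ h ξ l θ) {ξ' l' : ℝ} {θ' : ℝ → ℝ}
    (H' : IsAngle δ h ξ' l' θ') : ∀ t ∈ Icc (-δ) δ,
    |θ t - θ' t| ≤ (|ξ - ξ'| + |l - l'|) * (Real.exp (4 * δ * (|ξ| + δ) / h) / (|ξ| + δ)) := by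
  intro t ht
  set B : ℝ := |ξ| + δ
  have hB : 0 < B := by positivity
  have hBt : ∀ t ∈ Icc (-δ) δ, |ξ + t| ≤ B := fun t ht =>
    (abs_add_le _ _).trans (add_le_add le_rfl (abs_le.2 ⟨ht.1, ht.2⟩))
  have hK : 0 < 2 * B / h := by positivity
  set ε : ℝ := (|ξ - ξ'| + |l - l'|) / h
  have hε : 0 ≤ ε := by positivity
  have key := dist_le_of_approx_trajectories_ODE_of_mem (v := angleField h ξ l)
    (K := (2 * B / h).toNNReal) (s := fun _ => univ) (f := θ) (g := θ') (a := -δ) (b := δ)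
    (εf := 0) (εg := ε) (δ := 0)
    (f' := fun t => angleField h ξ l t (θ t)) (g' := fun t => angleField h ξ' l' t (θ' t))
    (fun t ht => by
      refine LipschitzWith.lipschitzOnWith (LipschitzWith.of_dist_le_mul fun x y => ?_)
      rw [Real.coe_toNNReal _ (by positivity), Real.dist_eq, Real.dist_eq]
      exact abs_angleField_sub_le hh (hBt t (Ico_subset_Icc_self ht)) x y)
    H.continuousOn
    (fun t ht => (H.hasDerivAt t (Ico_subset_Icc_self ht)).hasDerivWithinAt)
    (fun t ht => by simp) (fun _ _ => mem_univ _) H'.continuousOn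
    (fun t ht => (H'.hasDerivAt t (Ico_subset_Icc_self ht)).hasDerivWithinAt)
    (fun t ht => by
      have e : angleField h ξ' l' t (θ' t) - angleField h ξ l t (θ' t) =
          -((ξ - ξ') * Real.sin (2 * θ' t) - (l - l')) / h := by
        simp only [angleField]; ring
      rw [Real.dist_eq, e, abs_div, abs_of_pos hh, abs_neg]
      refine div_le_div_of_nonneg_right ((abs_sub _ _).trans (add_le_add ?_ le_rfl)) hh.le
      rw [abs_mul]
      exact mul_le_of_le_one_right (abs_nonneg _) (Real.abs_sin_le_one _))
    (fun _ _ => mem_univ _) (by simp [H.init, H'.init]) t ht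
  rw [Real.dist_eq, Real.coe_toNNReal _ hK.le, zero_add, gronwallBound_of_K_ne_0 hK.ne'] at key
  refine key.trans ?_
  have e1 : Real.exp (2 * B / h * (t - -δ)) ≤ Real.exp (4 * δ * B / h) := by
    rw [Real.exp_le_exp]
    have : t - -δ ≤ 2 * δ := by linarith [ht.2]
    calc 2 * B / h * (t - -δ) ≤ 2 * B / h * (2 * δ) := by gcongr
      _ = _ := by ring
  have e2 : ε / (2 * B / h) = (|ξ - ξ'| + |l - l'|) / (2 * B) := by
    simp only [ε]; field_simp
  simp only [e2, zero_mul, zero_add]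
  calc (|ξ - ξ'| + |l - l'|) / (2 * B) * (Real.exp (2 * B / h * (t - -δ)) - 1)
      ≤ (|ξ - ξ'| + |l - l'|) / B * Real.exp (4 * δ * B / h) := by
        gcongr ?_ / ?_ * ?_
        · have : 0 ≤ 2 * B / h * (t - -δ) := mul_nonneg hK.le (by linarith [ht.1])
          linarith [Real.one_le_exp this]
        · linarith
        · linarith
        · linarith
    _ = _ := by ring

/-- At `π/2` the sine vanishes for every `t`, and the field is `-l / h`. The level is therefore a
barrier whatever the sign of `ξ + t`. The same happens at `0`, from the other side, for `l < 0`. -/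
theorem le_pi_div_two_of_pos (hδ : 0 < δ) (hh : 0 < h) (H : IsAngle δ h ξ l θ) (hl : 0 < l) :
    θ δ ≤ Real.pi / 2 := by
  refine H.le_of_field_neg le_rfl le_rfl (by rw [H.init]; linarith [Real.pi_pos])
    (fun t _ => ?_) δ ⟨by linarith, le_rfl⟩
  rw [angleField, mul_div_cancel₀ _ two_ne_zero, Real.sin_pi, mul_zero, zero_sub]
  exact div_neg_of_neg_of_pos (by linarith) hh

theorem nonneg_of_neg (hδ : 0 < δ) (hh : 0 < h) (H : IsAngle δ h ξ l θ) (hl : l < 0) :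
    0 ≤ θ δ := by
  refine H.ge_of_field_pos le_rfl le_rfl (by rw [H.init]; linarith [Real.pi_pos])
    (fun t _ => ?_) δ ⟨by linarith, le_rfl⟩
  rw [angleField, mul_zero, Real.sin_zero, mul_zero, zero_sub]
  exact div_pos (by linarith) hh

/-- Reflection `t ↦ -t`. -/
theorem reflect (H : IsAngle δ h ξ l θ) (hf : θ δ = -(Real.pi / 4)) :
    IsAngle δ h (-ξ) l fun t => -θ (-t) := by
  refine ⟨by simp [hf], fun t ht => ?_⟩
  have h1 := H.hasDerivAt (-t) ⟨by linarith [ht.2], by linarith [ht.1]⟩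
  have h2 := (h1.comp t (hasDerivAt_neg t)).neg
  refine h2.congr_deriv ?_
  simp only [angleField, mul_neg, Real.sin_neg]
  ring

/-- On the level `π/4` the field is `(ξ + t - l) / h`, which changes sign once, at `t = l - ξ`.
Before that time the level is a barrier from above. After it, an angle above the level would stay
above until `δ`, against the final value `-π/4`. -/
theorem le_pi_div_four (hh : 0 < h) (H : IsAngle δ h ξ l θ) (hf : θ δ = -(Real.pi / 4)) :
    ∀ t ∈ Icc (-δ) δ, θ t ≤ Real.pi / 4 := by
  have e : ∀ t, angleField h ξ l t (Real.pi / 4) = (ξ + t - l) / h := fun t => by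
    rw [angleField, show 2 * (Real.pi / 4) = Real.pi / 2 by ring, Real.sin_pi_div_two, mul_one]
  intro t ht
  rcases le_or_gt t (l - ξ) with h1 | h1
  · refine H.le_of_field_neg le_rfl ht.2 H.init.le (fun s hs => ?_) t ⟨ht.1, le_rfl⟩
    rw [e]
    exact div_neg_of_neg_of_pos (by linarith [hs.2]) hh
  · by_contra! hlt
    have := H.ge_of_field_pos ht.1 le_rfl hlt.le (fun s hs => by
      rw [e]; exact div_pos (by linarith [hs.1]) hh) δ ⟨ht.2, le_rfl⟩
    linarith [Real.pi_pos]

theorem abs_le_pi_div_four (hh : 0 < h) (H : IsAngle δ h ξ l θ) (hf : θ δ = -(Real.pi / 4)) :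
    ∀ t ∈ Icc (-δ) δ, |θ t| ≤ Real.pi / 4 := by
  intro t ht
  have h1 := H.le_pi_div_four hh hf t ht
  have h2 := (H.reflect hf).le_pi_div_four hh (by simp [H.init]) (-t)
    ⟨by linarith [ht.2], by linarith [ht.1]⟩
  rw [neg_neg] at h2
  exact abs_le.2 ⟨by linarith, h1⟩

/-- If `l < ξ - δ`, the field on the level `π/4` is positive over the whole interval, so the angle
never drops below its initial value. With the reflection, this is the source of (c) and of the
coercivity of `μ₁⁺` in `ξ`. -/
theorem sub_le_of_eq (hδ : 0 < δ) (hh : 0 < h) (H : IsAngle δ h ξ l θ)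
    (hf : θ δ = -(Real.pi / 4)) : ξ - δ ≤ l := by
  by_contra! hlt
  have := H.ge_of_field_pos le_rfl le_rfl H.init.ge (fun s hs => by
    rw [angleField, show 2 * (Real.pi / 4) = Real.pi / 2 by ring, Real.sin_pi_div_two, mul_one]
    exact div_pos (by linarith [hs.1]) hh) δ ⟨by linarith, le_rfl⟩
  linarith [Real.pi_pos]

theorem abs_sub_le_of_eq (hδ : 0 < δ) (hh : 0 < h) (H : IsAngle δ h ξ l θ)
    (hf : θ δ = -(Real.pi / 4)) : |ξ| - δ ≤ l := by
  rcases abs_cases ξ with ⟨e, -⟩ | ⟨e, -⟩ <;> rw [e]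
  · exact H.sub_le_of_eq hδ hh hf
  · exact (H.reflect hf).sub_le_of_eq hδ hh (by simp [H.init])

end IsAngle

/-! ### Dependence on the parameters -/

/-- The projection of the real line onto `[-δ, δ]`. -/
def clamp (δ t : ℝ) : ℝ := max (-δ) (min δ t)

theorem continuous_clamp (δ : ℝ) : Continuous (clamp δ) := by unfold clamp; fun_prop

theorem clamp_mem {δ : ℝ} (hδ : 0 < δ) (t : ℝ) : clamp δ t ∈ Icc (-δ) δ :=
  ⟨le_max_left _ _, max_le (by linarith) (min_le_left _ _)⟩

theorem clamp_of_mem {δ t : ℝ} (ht : t ∈ Icc (-δ) δ) : clamp δ t = t := by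
  rw [clamp, min_eq_right ht.2, max_eq_right ht.1]

theorem clamp_eventuallyEq {δ t : ℝ} (ht : t ∈ Ioo (-δ) δ) : clamp δ =ᶠ[𝓝 t] id :=
  Filter.eventually_of_mem (isOpen_Ioo.mem_nhds ht) fun _ hs =>
    clamp_of_mem (Ioo_subset_Icc_self hs)

/-- The dependence on `(ξ, l)` is uniform in `t` by `dist_le`, and for fixed parameters the angle is
continuous in `t`. The triangle inequality combines the two. -/
theorem continuous_angle {δ h : ℝ} (hδ : 0 < δ) (hh : 0 < h) :
    Continuous fun q : ℝ × ℝ × ℝ => angle δ h q.1 q.2.1 (clamp δ q.2.2) := by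
  rw [continuous_iff_continuousAt]
  rintro ⟨ξ, l, t⟩
  have H := isAngle_angle hδ hh ξ l
  set C : ℝ := Real.exp (4 * δ * (|ξ| + δ) / h) / (|ξ| + δ)
  rw [ContinuousAt, tendsto_iff_dist_tendsto_zero]
  have hc : Continuous fun s : ℝ => angle δ h ξ l (clamp δ s) :=
    H.continuousOn.comp_continuous (continuous_clamp δ) (clamp_mem hδ)
  have hlim : Tendsto (fun q : ℝ × ℝ × ℝ => (|ξ - q.1| + |l - q.2.1|) * C +
      |angle δ h ξ l (clamp δ q.2.2) - angle δ h ξ l (clamp δ t)|) (𝓝 (ξ, l, t)) (𝓝 0) := by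
    have : Continuous (fun q : ℝ × ℝ × ℝ => (|ξ - q.1| + |l - q.2.1|) * C +
      |angle δ h ξ l (clamp δ q.2.2) - angle δ h ξ l (clamp δ t)|) := by
      have h2 := hc.comp (show Continuous fun q : ℝ × ℝ × ℝ => q.2.2 by fun_prop)
      exact Continuous.add (by fun_prop) (h2.sub continuous_const).abs
    simpa using this.tendsto (ξ, l, t)
  refine squeeze_zero (fun _ => dist_nonneg) (fun q => ?_) hlim
  have h1 := H.dist_le hδ hh (isAngle_angle hδ hh q.1 q.2.1) _ (clamp_mem hδ q.2.2)
  rw [Real.dist_eq]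
  rw [abs_sub_comm] at h1
  exact (abs_sub_le _ (angle δ h ξ l (clamp δ q.2.2)) _).trans (add_le_add h1 le_rfl)

theorem continuous_angle_right {δ h : ℝ} (hδ : 0 < δ) (hh : 0 < h) :
    Continuous fun q : ℝ × ℝ => angle δ h q.1 q.2 δ := by
  have := (continuous_angle hδ hh).comp
    (show Continuous fun q : ℝ × ℝ => (q.1, q.2, δ) by fun_prop)
  simpa [Function.comp_def, clamp_of_mem (right_mem_Icc.2 (show -δ ≤ δ by linarith))] using this

/-- For `l = 0` the level `π/2` is an equilibrium and not a strict barrier, so the bound is obtained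
as a limit from larger `l`. The next lemma uses in the same way a limit from negative `l`. -/
theorem angle_le_pi_div_two {δ h : ℝ} (hδ : 0 < δ) (hh : 0 < h) (ξ : ℝ) {l : ℝ} (hl : 0 ≤ l) :
    angle δ h ξ l δ ≤ Real.pi / 2 := by
  have hc : Continuous fun l : ℝ => angle δ h ξ l δ :=
    (continuous_angle_right hδ hh).comp (by fun_prop : Continuous fun l : ℝ => (ξ, l))
  refine le_of_tendsto (hc.continuousWithinAt (s := Ioi l) (x := l)) ?_
  filter_upwards [self_mem_nhdsWithin] with l' hl'
  exact (isAngle_angle hδ hh ξ l').le_pi_div_two_of_pos hδ hh (hl.trans_lt hl')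

theorem angle_zero_nonneg {δ h : ℝ} (hδ : 0 < δ) (hh : 0 < h) (ξ : ℝ) :
    0 ≤ angle δ h ξ 0 δ := by
  have hc : Continuous fun l : ℝ => angle δ h ξ l δ :=
    (continuous_angle_right hδ hh).comp (by fun_prop : Continuous fun l : ℝ => (ξ, l))
  refine ge_of_tendsto (hc.continuousWithinAt (s := Iio 0) (x := 0)) ?_
  filter_upwards [self_mem_nhdsWithin] with l' hl'
  exact (isAngle_angle hδ hh ξ l').nonneg_of_neg hδ hh hl'

theorem angle_antitone {δ h : ℝ} (hδ : 0 < δ) (hh : 0 < h) (ξ : ℝ) :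
    Antitone fun l => angle δ h ξ l δ := by
  intro l l' hl
  rcases hl.eq_or_lt with rfl | hl
  · exact le_rfl
  · exact (isAngle_angle hδ hh ξ l).antitone hh (isAngle_angle hδ hh ξ l') hl δ
      ⟨by linarith, le_rfl⟩

theorem exists_angle_le {δ h : ℝ} (hδ : 0 < δ) (hh : 0 < h) (ξ : ℝ) :
    ∃ l, 0 ≤ l ∧ angle δ h ξ l δ ≤ -(Real.pi / 4) := by
  -- For this `l` the slope of the angle is at most `-π/(4δ)`, so over the length `2δ` it falls by
  -- at least `π/2`, from `π/4` to `-π/4`.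
  set l : ℝ := |ξ| + δ + h * Real.pi / (4 * δ)
  refine ⟨l, by positivity, ?_⟩
  have H := isAngle_angle hδ hh ξ l
  have hd : ∀ t : ℝ, HasDerivAt (fun t => Real.pi / 4 - (t + δ) * (Real.pi / (4 * δ)))
      (-(Real.pi / (4 * δ))) t := fun t => by
    have := (((hasDerivAt_id t).add_const δ).mul_const (Real.pi / (4 * δ))).const_sub
      (Real.pi / 4)
    simpa using this
  have key := image_le_of_deriv_right_le_deriv_boundary H.continuousOn
    (fun t ht => (H.hasDerivAt t (Ico_subset_Icc_self ht)).hasDerivWithinAt)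
    (B := fun t => Real.pi / 4 - (t + δ) * (Real.pi / (4 * δ)))
    (B' := fun _ => -(Real.pi / (4 * δ))) (by rw [H.init]; simp)
    (fun t _ => (hd t).continuousAt.continuousWithinAt)
    (fun t _ => (hd t).hasDerivWithinAt) (fun t ht => ?_)
    (right_mem_Icc.2 (show -δ ≤ δ by linarith))
  · refine key.trans (le_of_eq ?_)
    field_simp
    ring
  · have h1 : (ξ + t) * Real.sin (2 * angle δ h ξ l t) ≤ |ξ| + δ := by
      refine (le_abs_self _).trans ?_
      rw [abs_mul]
      refine (mul_le_of_le_one_right (abs_nonneg _) (Real.abs_sin_le_one _)).trans ?_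
      exact (abs_add_le _ _).trans (add_le_add le_rfl (abs_le.2 ⟨ht.1, ht.2.le⟩))
    rw [angleField, div_le_iff₀ hh]
    have : h * Real.pi / (4 * δ) = Real.pi / (4 * δ) * h := by ring
    simp only [l]
    linarith

/-- The first positive `l` at which the Prüfer angle satisfies the boundary condition at `δ`. -/
theorem exists_first_crossing {δ h : ℝ} (hδ : 0 < δ) (hh : 0 < h) (ξ : ℝ) :
    ∃ m, 0 < m ∧ angle δ h ξ m δ = -(Real.pi / 4) ∧
      ∀ l, 0 ≤ l → l < m → -(Real.pi / 4) < angle δ h ξ l δ := by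
  have hc : Continuous fun l : ℝ => angle δ h ξ l δ :=
    (continuous_angle_right hδ hh).comp (by fun_prop : Continuous fun l : ℝ => (ξ, l))
  set A : Set ℝ := {l | 0 ≤ l ∧ angle δ h ξ l δ ≤ -(Real.pi / 4)}
  have hcl : IsClosed A :=
    (isClosed_le continuous_const continuous_id).inter (isClosed_le hc continuous_const)
  have hbd : BddBelow A := ⟨0, fun l hl => hl.1⟩
  have hm : sInf A ∈ A := hcl.csInf_mem (exists_angle_le hδ hh ξ) hbd
  have h0 := angle_zero_nonneg hδ hh ξ
  have hpos : 0 < sInf A := by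
    rcases hm.1.eq_or_lt with e | e
    · have := hm.2
      rw [← e] at this
      linarith [Real.pi_pos]
    · exact e
  have hlt : ∀ l, 0 ≤ l → l < sInf A → -(Real.pi / 4) < angle δ h ξ l δ := by
    intro l hl hlm
    by_contra! hcon
    exact absurd (csInf_le hbd (⟨hl, hcon⟩ : l ∈ A)) (not_le.2 hlm)
  refine ⟨sInf A, hpos, le_antisymm hm.2 ?_, hlt⟩
  -- Below the infimum the angle is strictly above `-π/4`. The limit from the left gives the
  -- inequality opposite to the one from membership.
  refine ge_of_tendsto (hc.continuousWithinAt (s := Iio (sInf A)) (x := sInf A)) ?_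
  filter_upwards [Ioo_mem_nhdsLT hpos] with l hl
  exact (hlt l hl.1.le hl.2).le

/-! ### Fundamental solutions of the fibered equation -/

/-- The Prüfer radius. -/
def radius (δ h ξ l t : ℝ) : ℝ :=
  Real.exp (-∫ τ in (-δ)..t, (ξ + τ) * Real.cos (2 * angle δ h ξ l (clamp δ τ)) / h)

/-- First component of the real solution satisfying the boundary condition at `-δ`. -/
def left1 (δ h ξ l t : ℝ) : ℝ := radius δ h ξ l t * Real.cos (angle δ h ξ l (clamp δ t))

/-- Second component of the real solution satisfying the boundary condition at `-δ`. -/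
def left2 (δ h ξ l t : ℝ) : ℝ := radius δ h ξ l t * Real.sin (angle δ h ξ l (clamp δ t))

/-- First component of the real solution satisfying the boundary condition at `δ`. -/
def right1 (δ h ξ l t : ℝ) : ℝ := left1 δ h (-ξ) l (-t)

/-- Second component of the real solution satisfying the boundary condition at `δ`. -/
def right2 (δ h ξ l t : ℝ) : ℝ := -left2 δ h (-ξ) l (-t)

/-- The defect of the boundary condition at `δ` of the solution `(left1, left2)`. -/
def defect (δ h ξ l : ℝ) : ℝ := left1 δ h ξ l δ + left2 δ h ξ l δ

/-- `(a, b)` solves `(ξ + t) b - h b' = l a + f`, `(ξ + t) a + h a' = l b + g` on `(-δ, δ)`. -/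
structure IsSol (δ h ξ l : ℝ) (f g a b : ℝ → ℂ) : Prop where
  cont1 : ContinuousOn a (Icc (-δ) δ)
  cont2 : ContinuousOn b (Icc (-δ) δ)
  deriv1 : ∀ t ∈ Ioo (-δ) δ, HasDerivAt a ((l * b t - ((ξ + t : ℝ) : ℂ) * a t + g t) / h) t
  deriv2 : ∀ t ∈ Ioo (-δ) δ, HasDerivAt b ((((ξ + t : ℝ) : ℂ) * b t - l * a t - f t) / h) t

theorem continuous_radius {δ h : ℝ} (hδ : 0 < δ) (hh : 0 < h) :
    Continuous fun q : ℝ × ℝ × ℝ => radius δ h q.1 q.2.1 q.2.2 := by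
  unfold radius
  refine Real.continuous_exp.comp (Continuous.neg ?_)
  refine intervalIntegral.continuous_parametric_intervalIntegral_of_continuous
    (f := fun (q : ℝ × ℝ × ℝ) τ => (q.1 + τ) * Real.cos (2 * angle δ h q.1 q.2.1 (clamp δ τ)) / h)
    ?_ (by fun_prop)
  have h1 := (continuous_angle hδ hh).comp
    (show Continuous fun x : (ℝ × ℝ × ℝ) × ℝ => (x.1.1, x.1.2.1, x.2) by fun_prop)
  simp only [Function.comp_def] at h1
  unfold Function.uncurry
  fun_prop

theorem continuous_left1 {δ h : ℝ} (hδ : 0 < δ) (hh : 0 < h) :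
    Continuous fun q : ℝ × ℝ × ℝ => left1 δ h q.1 q.2.1 q.2.2 :=
  (continuous_radius hδ hh).mul (Real.continuous_cos.comp (continuous_angle hδ hh))

theorem continuous_left2 {δ h : ℝ} (hδ : 0 < δ) (hh : 0 < h) :
    Continuous fun q : ℝ × ℝ × ℝ => left2 δ h q.1 q.2.1 q.2.2 :=
  (continuous_radius hδ hh).mul (Real.continuous_sin.comp (continuous_angle hδ hh))

theorem continuous_right1 {δ h : ℝ} (hδ : 0 < δ) (hh : 0 < h) :
    Continuous fun q : ℝ × ℝ × ℝ => right1 δ h q.1 q.2.1 q.2.2 :=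
  (continuous_left1 hδ hh).comp
    (show Continuous fun q : ℝ × ℝ × ℝ => (-q.1, q.2.1, -q.2.2) by fun_prop)

theorem continuous_right2 {δ h : ℝ} (hδ : 0 < δ) (hh : 0 < h) :
    Continuous fun q : ℝ × ℝ × ℝ => right2 δ h q.1 q.2.1 q.2.2 :=
  ((continuous_left2 hδ hh).comp
    (show Continuous fun q : ℝ × ℝ × ℝ => (-q.1, q.2.1, -q.2.2) by fun_prop)).neg

theorem continuous_defect {δ h : ℝ} (hδ : 0 < δ) (hh : 0 < h) :
    Continuous fun q : ℝ × ℝ => defect δ h q.1 q.2 :=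
  ((continuous_left1 hδ hh).comp
      (show Continuous fun q : ℝ × ℝ => (q.1, q.2, δ) by fun_prop)).add
    ((continuous_left2 hδ hh).comp (show Continuous fun q : ℝ × ℝ => (q.1, q.2, δ) by fun_prop))

theorem hasDerivAt_radius {δ h : ℝ} (hδ : 0 < δ) (hh : 0 < h) (ξ l t : ℝ) :
    HasDerivAt (radius δ h ξ l)
      (radius δ h ξ l t * -((ξ + t) * Real.cos (2 * angle δ h ξ l (clamp δ t)) / h)) t := by
  have hc : Continuous fun τ => (ξ + τ) * Real.cos (2 * angle δ h ξ l (clamp δ τ)) / h := by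
    have h1 := (continuous_angle hδ hh).comp (show Continuous fun x : ℝ => (ξ, l, x) by fun_prop)
    simp only [Function.comp_def] at h1
    fun_prop
  exact (intervalIntegral.integral_hasDerivAt_right (hc.intervalIntegrable _ _)
    (hc.stronglyMeasurableAtFilter _ _) hc.continuousAt).neg.exp

theorem hasDerivAt_angle_clamp {δ h : ℝ} (hδ : 0 < δ) (hh : 0 < h) (ξ l : ℝ) {t : ℝ}
    (ht : t ∈ Ioo (-δ) δ) :
    HasDerivAt (fun t => angle δ h ξ l (clamp δ t))
      (angleField h ξ l t (angle δ h ξ l (clamp δ t))) t := by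
  have ht' := Ioo_subset_Icc_self ht
  rw [clamp_of_mem ht']
  refine ((isAngle_angle hδ hh ξ l).hasDerivAt t ht').congr_of_eventuallyEq ?_
  exact (clamp_eventuallyEq ht).fun_comp (angle δ h ξ l)

theorem hasDerivAt_left1 {δ h : ℝ} (hδ : 0 < δ) (hh : 0 < h) (ξ l : ℝ) {t : ℝ}
    (ht : t ∈ Ioo (-δ) δ) : HasDerivAt (left1 δ h ξ l)
      ((l * left2 δ h ξ l t - (ξ + t) * left1 δ h ξ l t) / h) t := by
  refine ((hasDerivAt_radius hδ hh ξ l t).mul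
    (hasDerivAt_angle_clamp hδ hh ξ l ht).cos).congr_deriv ?_
  simp only [angleField, left1, left2]
  set x := angle δ h ξ l (clamp δ t)
  rw [Real.cos_two_mul, Real.sin_two_mul]
  field_simp
  linear_combination (-2 * (ξ + t) * radius δ h ξ l t * Real.cos x) * Real.sin_sq_add_cos_sq x

theorem hasDerivAt_left2 {δ h : ℝ} (hδ : 0 < δ) (hh : 0 < h) (ξ l : ℝ) {t : ℝ}
    (ht : t ∈ Ioo (-δ) δ) : HasDerivAt (left2 δ h ξ l)
      (((ξ + t) * left2 δ h ξ l t - l * left1 δ h ξ l t) / h) t := by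
  refine ((hasDerivAt_radius hδ hh ξ l t).mul
    (hasDerivAt_angle_clamp hδ hh ξ l ht).sin).congr_deriv ?_
  simp only [angleField, left1, left2]
  set x := angle δ h ξ l (clamp δ t)
  rw [Real.cos_two_mul, Real.sin_two_mul]
  field_simp
  ring

theorem left_neg {δ h : ℝ} (hδ : 0 < δ) (hh : 0 < h) (ξ l : ℝ) :
    left1 δ h ξ l (-δ) = √2 / 2 ∧ left2 δ h ξ l (-δ) = √2 / 2 := by
  have e : clamp δ (-δ) = -δ := clamp_of_mem (left_mem_Icc.2 (by linarith))
  simp [left1, left2, radius, e, (isAngle_angle hδ hh ξ l).init]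

theorem right_pos {δ h : ℝ} (hδ : 0 < δ) (hh : 0 < h) (ξ l : ℝ) :
    right1 δ h ξ l δ = √2 / 2 ∧ right2 δ h ξ l δ = -(√2 / 2) := by
  simp [right1, right2, left_neg hδ hh]

theorem defect_eq {δ h : ℝ} (hδ : 0 < δ) (ξ l : ℝ) :
    defect δ h ξ l = radius δ h ξ l δ *
      (Real.cos (angle δ h ξ l δ) + Real.sin (angle δ h ξ l δ)) := by
  rw [defect, left1, left2, clamp_of_mem (right_mem_Icc.2 (by linarith)), mul_add]

theorem isSol_left {δ h : ℝ} (hδ : 0 < δ) (hh : 0 < h) (ξ l : ℝ) :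
    IsSol δ h ξ l 0 0 (fun t => left1 δ h ξ l t) (fun t => left2 δ h ξ l t) := by
  have hc : Continuous fun t : ℝ => (ξ, l, t) := by fun_prop
  refine ⟨?_, ?_, fun t ht => ?_, fun t ht => ?_⟩
  · exact (Complex.continuous_ofReal.comp ((continuous_left1 hδ hh).comp hc)).continuousOn
  · exact (Complex.continuous_ofReal.comp ((continuous_left2 hδ hh).comp hc)).continuousOn
  · exact (hasDerivAt_left1 hδ hh ξ l ht).ofReal_comp.congr_deriv (by push_cast; simp)
  · exact (hasDerivAt_left2 hδ hh ξ l ht).ofReal_comp.congr_deriv (by push_cast; simp)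

theorem isSol_right {δ h : ℝ} (hδ : 0 < δ) (hh : 0 < h) (ξ l : ℝ) :
    IsSol δ h ξ l 0 0 (fun t => right1 δ h ξ l t) (fun t => right2 δ h ξ l t) := by
  have hc : Continuous fun t : ℝ => (ξ, l, t) := by fun_prop
  have hm : ∀ t ∈ Ioo (-δ) δ, -t ∈ Ioo (-δ) δ := fun t ht =>
    ⟨by linarith [ht.2], by linarith [ht.1]⟩
  refine ⟨?_, ?_, fun t ht => ?_, fun t ht => ?_⟩
  · exact (Complex.continuous_ofReal.comp ((continuous_right1 hδ hh).comp hc)).continuousOn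
  · exact (Complex.continuous_ofReal.comp ((continuous_right2 hδ hh).comp hc)).continuousOn
  · refine ((hasDerivAt_left1 hδ hh (-ξ) l (hm t ht)).comp t
      (hasDerivAt_neg t)).ofReal_comp.congr_deriv ?_
    simp only [right1, right2, Pi.zero_apply]
    push_cast
    ring
  · refine ((hasDerivAt_left2 hδ hh (-ξ) l (hm t ht)).comp t
      (hasDerivAt_neg t)).neg.ofReal_comp.congr_deriv ?_
    simp only [right1, right2, Pi.zero_apply]
    push_cast
    ring

theorem eq_of_hasDerivAt_zero {δ : ℝ} {f : ℝ → ℂ} (hf : ContinuousOn f (Icc (-δ) δ))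
    (hf' : ∀ t ∈ Ioo (-δ) δ, HasDerivAt f 0 t) {x y : ℝ} (hx : x ∈ Icc (-δ) δ)
    (hy : y ∈ Icc (-δ) δ) : f x = f y := by
  have key : ∀ x ∈ Icc (-δ) δ, f (-δ) = f x := fun x hx => by
    have := intervalIntegral.integral_eq_sub_of_hasDerivAt_of_le hx.1
      (hf.mono (Icc_subset_Icc_right hx.2))
      (fun t ht => hf' t ⟨ht.1, ht.2.trans_le hx.2⟩) (by simp)
    rw [intervalIntegral.integral_zero] at this
    exact (sub_eq_zero.1 this.symm).symm
  rw [← key x hx, key y hy]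

/-- The Wronskian of two solutions is constant. -/
theorem IsSol.wronskian {δ h ξ l : ℝ} {a b c d : ℝ → ℂ} (H : IsSol δ h ξ l 0 0 a b)
    (H' : IsSol δ h ξ l 0 0 c d) {x y : ℝ} (hx : x ∈ Icc (-δ) δ) (hy : y ∈ Icc (-δ) δ) :
    a x * d x - b x * c x = a y * d y - b y * c y := by
  refine eq_of_hasDerivAt_zero (f := fun t => a t * d t - b t * c t)
    ((H.cont1.mul H'.cont2).sub (H.cont2.mul H'.cont1)) (fun t ht => ?_) hx hy
  refine (((H.deriv1 t ht).mul (H'.deriv2 t ht)).sub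
    ((H.deriv2 t ht).mul (H'.deriv1 t ht))).congr_deriv ?_
  simp only [Pi.zero_apply]
  ring

/-- The Wronskian is evaluated at `δ`, where the right solution is `(√2/2)(1, -1)`. Thus the defect
measures the independence of the two boundary solutions, and it is the denominator of the Green
function. -/
theorem wronskian_left_right {δ h : ℝ} (hδ : 0 < δ) (hh : 0 < h) (ξ l : ℝ) {t : ℝ}
    (ht : t ∈ Icc (-δ) δ) :
    left1 δ h ξ l t * right2 δ h ξ l t - left2 δ h ξ l t * right1 δ h ξ l t =
      -(√2 / 2) * defect δ h ξ l := by
  have := (isSol_left hδ hh ξ l).wronskian (isSol_right hδ hh ξ l) ht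
    (right_mem_Icc.2 (by linarith))
  norm_cast at this
  rw [this, (right_pos hδ hh ξ l).1, (right_pos hδ hh ξ l).2, defect]
  ring

/-- A solution satisfying both boundary conditions vanishes if the defect does not. -/
theorem IsSol.eq_zero {δ h ξ l : ℝ} (hδ : 0 < δ) (hh : 0 < h) {a b : ℝ → ℂ}
    (H : IsSol δ h ξ l 0 0 a b) (h1 : a δ = -b δ) (h2 : a (-δ) = b (-δ))
    (hd : defect δ h ξ l ≠ 0) : ∀ t ∈ Icc (-δ) δ, a t = 0 ∧ b t = 0 := by
  intro t ht
  -- The Wronskian with the left solution vanishes at `-δ`, where both satisfy the same boundary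
  -- condition, and the one with the right solution vanishes at `δ`. This is a homogeneous 2×2
  -- system for `(a t, b t)` whose determinant is a multiple of the defect.
  have e1 := (isSol_left hδ hh ξ l).wronskian H ht (left_mem_Icc.2 (show -δ ≤ δ by linarith))
  have e2 := (isSol_right hδ hh ξ l).wronskian H ht (right_mem_Icc.2 (show -δ ≤ δ by linarith))
  rw [(left_neg hδ hh ξ l).1, (left_neg hδ hh ξ l).2, h2, sub_self] at e1
  rw [(right_pos hδ hh ξ l).1, (right_pos hδ hh ξ l).2, h1] at e2
  have e3 : ((-(√2 / 2) * defect δ h ξ l : ℝ) : ℂ) ≠ 0 := by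
    rw [Complex.ofReal_ne_zero]
    exact mul_ne_zero (by simp) hd
  rw [← wronskian_left_right hδ hh ξ l ht] at e3
  push_cast at e1 e2 e3
  constructor
  · refine (mul_eq_zero.1 (?_ : _ * a t = 0)).resolve_left e3
    linear_combination (right1 δ h ξ l t : ℂ) * e1 - (left1 δ h ξ l t : ℂ) * e2
  · refine (mul_eq_zero.1 (?_ : _ * b t = 0)).resolve_left e3
    linear_combination (right2 δ h ξ l t : ℂ) * e1 - (left2 δ h ξ l t : ℂ) * e2

/-! ### Eigenvalues of the fibered operator -/

theorem hasDerivAt_spinor {u : ℝ → Spinor} {u' : Spinor} {t : ℝ}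
    (h0 : HasDerivAt (fun t => u t 0) (u' 0) t) (h1 : HasDerivAt (fun t => u t 1) (u' 1) t) :
    HasDerivAt u u' t := by
  have h2 : HasDerivAt (fun t i => u t i) (fun i => u' i) t := hasDerivAt_pi.2 fun i => by
    fin_cases i
    · exact h0
    · exact h1
  exact ((PiLp.continuousLinearEquiv 2 ℝ fun _ : Fin 2 => ℂ).symm.toContinuousLinearMap.hasFDerivAt
    |>.comp_hasDerivAt t h2 :)

@[simp] theorem spinor_zero (a b : ℂ) : (!₂[a, b] : Spinor) 0 = a := rfl

@[simp] theorem spinor_one (a b : ℂ) : (!₂[a, b] : Spinor) 1 = b := rfl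

theorem spinor_ext {x y : Spinor} (h0 : x 0 = y 0) (h1 : x 1 = y 1) : x = y := by
  ext i
  fin_cases i
  · exact h0
  · exact h1

theorem hasDerivAt_spinor_apply {u : ℝ → Spinor} {u' : Spinor} {t : ℝ}
    (H : HasDerivAt u u' t) (i : Fin 2) : HasDerivAt (fun t => u t i) (u' i) t :=
  (EuclideanSpace.proj (𝕜 := ℂ) i).restrictScalars ℝ |>.hasFDerivAt.comp_hasDerivAt t H

theorem continuousOn_spinor {X : Type*} [TopologicalSpace X] {u : X → Spinor} {s : Set X}
    (h0 : ContinuousOn (fun t => u t 0) s) (h1 : ContinuousOn (fun t => u t 1) s) :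
    ContinuousOn u s := by
  have : ContinuousOn (fun t => WithLp.toLp 2 (fun i => u t i)) s := by
    refine (PiLp.continuous_toLp 2 _).comp_continuousOn (continuousOn_pi.2 fun i => ?_)
    fin_cases i
    · exact h0
    · exact h1
  exact this

theorem memLp_of_continuousOn {E : Type*} [NormedAddCommGroup E] {δ : ℝ}
    {u : ℝ → E} (hu : ContinuousOn u (Icc (-δ) δ)) : MemLp u 2 (intervalMeasure δ) := by
  obtain ⟨C, hC⟩ := isCompact_Icc.exists_bound_of_continuousOn hu
  refine MemLp.of_bound ((hu.mono Ioo_subset_Icc_self).aestronglyMeasurable measurableSet_Ioo) C ?_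
  filter_upwards [ae_restrict_mem measurableSet_Ioo] with t ht
  exact hC t (Ioo_subset_Icc_self ht)

/-- A continuous function with continuous derivative in the open interval belongs to `H¹`. -/
theorem isH1Interval_of_hasDerivAt {δ : ℝ} {u v : ℝ → Spinor}
    (hu : ContinuousOn u (Icc (-δ) δ)) (hv : ContinuousOn v (Icc (-δ) δ))
    (hd : ∀ t ∈ Ioo (-δ) δ, HasDerivAt u (v t) t) : IsH1Interval δ u v := by
  refine ⟨memLp_of_continuousOn hu, memLp_of_continuousOn hv, fun t ht => ?_⟩
  rw [intervalIntegral.integral_eq_sub_of_hasDerivAt_of_le ht.1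
    (hu.mono (Icc_subset_Icc_right ht.2)) (fun s hs => hd s ⟨hs.1, hs.2.trans_le ht.2⟩)
    (intervalIntegrable_of_memLp (memLp_of_continuousOn hv) ht)]
  abel

/-- The derivative of a solution of the fibered equation. -/
def solDeriv (h ξ l : ℝ) (u : ℝ → Spinor) (t : ℝ) : Spinor :=
  !₂[(l * u t 1 - ((ξ + t : ℝ) : ℂ) * u t 0) / h, (((ξ + t : ℝ) : ℂ) * u t 1 - l * u t 0) / h]

theorem IsSol.eq_fiberExpr {h ξ l : ℝ} (hh : 0 < h) (u : ℝ → Spinor) (t : ℝ) :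
    fiberExpr h ξ u (solDeriv h ξ l u) t = (l : ℂ) • u t := by
  have : (h : ℂ) ≠ 0 := by exact_mod_cast hh.ne'
  refine spinor_ext ?_ ?_
  · simp only [fiberExpr, solDeriv, spinor_zero, spinor_one, PiLp.smul_apply, smul_eq_mul]
    field_simp
    ring
  · simp only [fiberExpr, solDeriv, spinor_zero, spinor_one, PiLp.smul_apply, smul_eq_mul]
    field_simp
    ring

/-- The eigenfunction candidate. -/
def leftSpinor (δ h ξ l t : ℝ) : Spinor := !₂[(left1 δ h ξ l t : ℂ), (left2 δ h ξ l t : ℂ)]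

theorem continuousOn_solDeriv {δ h ξ l : ℝ} {u : ℝ → Spinor}
    (hu : ContinuousOn u (Icc (-δ) δ)) : ContinuousOn (solDeriv h ξ l u) (Icc (-δ) δ) := by
  have c0 : ContinuousOn (fun t => u t 0) (Icc (-δ) δ) :=
    (EuclideanSpace.proj (𝕜 := ℂ) (0 : Fin 2)).continuous.comp_continuousOn hu
  have c1 : ContinuousOn (fun t => u t 1) (Icc (-δ) δ) :=
    (EuclideanSpace.proj (𝕜 := ℂ) (1 : Fin 2)).continuous.comp_continuousOn hu
  refine continuousOn_spinor ?_ ?_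
  · simp only [solDeriv, spinor_zero]
    fun_prop
  · simp only [solDeriv, spinor_one]
    fun_prop

theorem continuous_leftSpinor {δ h : ℝ} (hδ : 0 < δ) (hh : 0 < h) (ξ l : ℝ) :
    Continuous (leftSpinor δ h ξ l) := by
  rw [← continuousOn_univ]
  have hc : Continuous fun t : ℝ => (ξ, l, t) := by fun_prop
  refine continuousOn_spinor ?_ ?_
  · exact (Complex.continuous_ofReal.comp ((continuous_left1 hδ hh).comp hc)).continuousOn
  · exact (Complex.continuous_ofReal.comp ((continuous_left2 hδ hh).comp hc)).continuousOn

theorem hasDerivAt_leftSpinor {δ h : ℝ} (hδ : 0 < δ) (hh : 0 < h) (ξ l : ℝ) {t : ℝ}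
    (ht : t ∈ Ioo (-δ) δ) :
    HasDerivAt (leftSpinor δ h ξ l) (solDeriv h ξ l (leftSpinor δ h ξ l) t) t :=
  hasDerivAt_spinor (by simpa [solDeriv, leftSpinor] using (isSol_left hδ hh ξ l).deriv1 t ht)
    (by simpa [solDeriv, leftSpinor] using (isSol_left hδ hh ξ l).deriv2 t ht)

theorem leftSpinor_ne_zero {δ h : ℝ} (hδ : 0 < δ) (hh : 0 < h) (ξ l : ℝ) :
    leftSpinor δ h ξ l (-δ) ≠ 0 := by
  intro h0
  have := congrArg (fun x : Spinor => x 0) h0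
  simp [leftSpinor, (left_neg hδ hh ξ l).1] at this

theorem fiberBC_leftSpinor {δ h : ℝ} (hδ : 0 < δ) (hh : 0 < h) {ξ l : ℝ}
    (hd : defect δ h ξ l = 0) : FiberBC δ (leftSpinor δ h ξ l) := by
  constructor
  · simp only [leftSpinor, spinor_zero, spinor_one]
    rw [defect] at hd
    rw [← Complex.ofReal_neg, Complex.ofReal_inj]
    linarith
  · simp [leftSpinor, left_neg hδ hh]

theorem isEigenvalue_of_defect_eq_zero {δ h : ℝ} (hδ : 0 < δ) (hh : 0 < h) {ξ l : ℝ}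
    (hd : defect δ h ξ l = 0) : IsEigenvalue (fiberDirac δ h ξ) (l : ℂ) := by
  set u := leftSpinor δ h ξ l
  have hu : Continuous u := continuous_leftSpinor hδ hh ξ l
  have hH : IsH1Interval δ u (solDeriv h ξ l u) :=
    isH1Interval_of_hasDerivAt hu.continuousOn (continuousOn_solDeriv hu.continuousOn)
      fun t ht => hasDerivAt_leftSpinor hδ hh ξ l ht
  set ψ : L2Interval δ := hH.memLp.toLp u
  have hψ : ψ =ᵐ[intervalMeasure δ] u := hH.memLp.coeFn_toLp
  have hg : (ψ, (l : ℂ) • ψ) ∈ fiberGraph δ h ξ := by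
    refine ⟨u, _, hH, fiberBC_leftSpinor hδ hh hd, hψ, ?_⟩
    filter_upwards [Lp.coeFn_smul (l : ℂ) ψ, hψ] with t e1 e2
    rw [e1, IsSol.eq_fiberExpr hh, Pi.smul_apply, e2]
  rw [← fiberDirac_graph, LinearPMap.mem_graph_iff] at hg
  obtain ⟨y, hy1, hy2⟩ := hg
  refine ⟨y, ?_, by rw [hy2, hy1]⟩
  -- A continuous function that vanishes almost everywhere on the interval vanishes up to its
  -- endpoints, but the value at `-δ` is not zero.
  intro h0
  have hz : u =ᵐ[intervalMeasure δ] 0 := by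
    have e : ψ = 0 := hy1.symm.trans h0
    refine hψ.symm.trans ?_
    rw [e]
    exact Lp.coeFn_zero _ _ _
  have hz2 : EqOn u 0 (Ioo (-δ) δ) :=
    Measure.eqOn_open_of_ae_eq (μ := volume) hz isOpen_Ioo hu.continuousOn continuousOn_const
  have hz3 : EqOn u 0 (closure (Ioo (-δ) δ)) := hz2.closure hu continuous_const
  rw [closure_Ioo (by linarith)] at hz3
  exact leftSpinor_ne_zero hδ hh ξ l (hz3 (left_mem_Icc.2 (by linarith)))

theorem IsH1Interval.continuousOn {δ : ℝ} (hδ : 0 < δ) {u v : ℝ → Spinor}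
    (H : IsH1Interval δ u v) : ContinuousOn u (Icc (-δ) δ) := by
  have hle : -δ ≤ δ := by linarith
  have hint := intervalIntegrable_of_memLp H.memLp_deriv (right_mem_Icc.2 hle)
  refine (continuousOn_const (c := u (-δ))).add
    ((intervalIntegral.continuousOn_primitive_interval' hint left_mem_uIcc).mono ?_) |>.congr
      H.eq_integral
  rw [uIcc_of_le hle]

/-- Regularity bootstrap: almost everywhere the weak derivative equals an expression in `u` itself,
which is continuous because `u` is. The integral formula for `u` then makes it differentiable in the
classical sense. -/
theorem isSol_of_eigenfunction {δ h ξ l : ℝ} (hδ : 0 < δ) (hh : 0 < h) {u v : ℝ → Spinor}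
    (H : IsH1Interval δ u v)
    (he : ∀ᵐ t ∂(intervalMeasure δ), fiberExpr h ξ u v t = (l : ℂ) • u t) :
    IsSol δ h ξ l 0 0 (fun t => u t 0) (fun t => u t 1) := by
  have hle : -δ ≤ δ := by linarith
  have hh' : (h : ℂ) ≠ 0 := by exact_mod_cast hh.ne'
  have hc := H.continuousOn hδ
  have hcd : ContinuousOn (solDeriv h ξ l u) (Icc (-δ) δ) := continuousOn_solDeriv hc
  have hv : v =ᵐ[intervalMeasure δ] solDeriv h ξ l u := by
    filter_upwards [he] with t ht
    have e0 := congrArg (fun x : Spinor => x 0) ht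
    have e1 := congrArg (fun x : Spinor => x 1) ht
    simp only [fiberExpr, spinor_zero, spinor_one,
      PiLp.smul_apply, smul_eq_mul] at e0 e1
    refine spinor_ext ?_ ?_
    · simp only [solDeriv, spinor_zero]
      rw [eq_div_iff hh']
      linear_combination e1
    · simp only [solDeriv, spinor_one]
      rw [eq_div_iff hh']
      linear_combination -e0
  have hd : ∀ t ∈ Ioo (-δ) δ, HasDerivAt u (solDeriv h ξ l u t) t := by
    intro t ht
    have h1 : ∀ s ∈ Icc (-δ) δ, u s = u (-δ) + ∫ x in (-δ)..s, solDeriv h ξ l u x := by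
      intro s hs
      rw [H.eq_integral s hs]
      congr 1
      refine intervalIntegral.integral_congr_ae_restrict ?_
      rw [uIoc_of_le hs.1]
      have : volume.restrict (Ioc (-δ) s) ≤ volume.restrict (Ioc (-δ) δ) :=
        Measure.restrict_mono (Ioc_subset_Ioc_right hs.2) le_rfl
      refine ae_mono this ?_
      rw [← restrict_Ioo_eq_restrict_Ioc]
      exact hv
    have hcs : ContinuousAt (solDeriv h ξ l u) t := hcd.continuousAt (Icc_mem_nhds ht.1 ht.2)
    have h2 := (intervalIntegral.integral_hasDerivAt_right
      ((hcd.mono (Icc_subset_Icc_right ht.2.le)).intervalIntegrable_of_Icc ht.1.le)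
      ((hcd.mono Ioo_subset_Icc_self).stronglyMeasurableAtFilter isOpen_Ioo t ht) hcs).const_add
        (u (-δ))
    refine h2.congr_of_eventuallyEq ?_
    filter_upwards [isOpen_Ioo.mem_nhds ht] with s hs
    exact h1 s (Ioo_subset_Icc_self hs)
  refine ⟨(EuclideanSpace.proj (𝕜 := ℂ) (0 : Fin 2)).continuous.comp_continuousOn hc,
    (EuclideanSpace.proj (𝕜 := ℂ) (1 : Fin 2)).continuous.comp_continuousOn hc,
    fun t ht => ?_, fun t ht => ?_⟩
  · exact (hasDerivAt_spinor_apply (hd t ht) 0).congr_deriv (by simp [solDeriv])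
  · exact (hasDerivAt_spinor_apply (hd t ht) 1).congr_deriv (by simp [solDeriv])

theorem isEigenvalue_iff {δ h : ℝ} (hδ : 0 < δ) (hh : 0 < h) {ξ l : ℝ} :
    IsEigenvalue (fiberDirac δ h ξ) (l : ℂ) ↔ defect δ h ξ l = 0 := by
  refine ⟨?_, isEigenvalue_of_defect_eq_zero hδ hh⟩
  rintro ⟨x, hx0, hx⟩
  by_contra hd
  have hg : ((x : L2Interval δ), fiberDirac δ h ξ x) ∈ fiberGraph δ h ξ := by
    rw [← fiberDirac_graph]
    exact LinearPMap.mem_graph _ x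
  obtain ⟨u, v, hH, hB, h1, h2⟩ := hg
  have hS := isSol_of_eigenfunction (l := l) hδ hh hH (by
    rw [hx] at h2
    filter_upwards [h1, h2, Lp.coeFn_smul (l : ℂ) (x : L2Interval δ)] with t e1 e2 e3
    rw [← e2, e3, Pi.smul_apply, e1])
  have hz := hS.eq_zero hδ hh hB.1 hB.2 hd
  refine hx0 (Lp.ext ?_)
  filter_upwards [h1, ae_restrict_mem measurableSet_Ioo,
    Lp.coeFn_zero Spinor 2 (intervalMeasure δ)] with t e1 e2 e3
  have := hz t (Ioo_subset_Icc_self e2)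
  rw [e1, e3]
  exact spinor_ext this.1 this.2

theorem defect_eq_zero_of_angle {δ h : ℝ} (hδ : 0 < δ) {ξ l : ℝ}
    (ha : angle δ h ξ l δ = -(Real.pi / 4)) : defect δ h ξ l = 0 := by
  rw [defect_eq hδ, ha]
  simp

/-- The defect has the sign of `sin (x + π/4)`. The upper bound on the angle `x` excludes the next
zero, at `3π/4`. -/
theorem defect_pos_of_angle {δ h : ℝ} (hδ : 0 < δ) {ξ l : ℝ}
    (h1 : -(Real.pi / 4) < angle δ h ξ l δ) (h2 : angle δ h ξ l δ ≤ Real.pi / 2) :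
    0 < defect δ h ξ l := by
  rw [defect_eq hδ]
  refine mul_pos (Real.exp_pos _) ?_
  set x := angle δ h ξ l δ
  have h3 : 0 < Real.sin (x + Real.pi / 4) :=
    Real.sin_pos_of_pos_of_lt_pi (by linarith) (by linarith [Real.pi_pos])
  rw [Real.sin_add, Real.cos_pi_div_four, Real.sin_pi_div_four, ← add_mul] at h3
  have := pos_of_mul_pos_left h3 (by positivity)
  linarith

/-- The first crossing is an eigenvalue because the defect vanishes there. There is no smaller
positive one because the defect stays positive before it. -/
theorem mu1_spec {δ h : ℝ} (hδ : 0 < δ) (hh : 0 < h) (ξ : ℝ) :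
    IsLeast (positiveEigenvalues δ ξ h) (mu1 δ ξ h) ∧
      angle δ h ξ (mu1 δ ξ h) δ = -(Real.pi / 4) ∧
      ∀ l, 0 ≤ l → l < mu1 δ ξ h → -(Real.pi / 4) < angle δ h ξ l δ := by
  obtain ⟨m, hm0, hm1, hm2⟩ := exists_first_crossing hδ hh ξ
  have hle : IsLeast (positiveEigenvalues δ ξ h) m := by
    refine ⟨⟨hm0, (isEigenvalue_iff hδ hh).2 (defect_eq_zero_of_angle hδ hm1)⟩, ?_⟩
    rintro l ⟨hl0, hl⟩
    by_contra! hlt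
    exact (defect_pos_of_angle hδ (hm2 l hl0.le hlt)
      (angle_le_pi_div_two hδ hh ξ hl0.le)).ne' ((isEigenvalue_iff hδ hh).1 hl)
  have e : mu1 δ ξ h = m := hle.csInf_eq
  rw [e]
  exact ⟨hle, hm1, hm2⟩

theorem mu1_pos {δ h : ℝ} (hδ : 0 < δ) (hh : 0 < h) (ξ : ℝ) : 0 < mu1 δ ξ h :=
  (mu1_spec hδ hh ξ).1.1.1

theorem defect_pos_of_lt_mu1 {δ h : ℝ} (hδ : 0 < δ) (hh : 0 < h) {ξ l : ℝ} (hl0 : 0 ≤ l)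
    (hl : l < mu1 δ ξ h) : 0 < defect δ h ξ l :=
  defect_pos_of_angle hδ ((mu1_spec hδ hh ξ).2.2 l hl0 hl) (angle_le_pi_div_two hδ hh ξ hl0)

theorem abs_sub_le_mu1 {δ h : ℝ} (hδ : 0 < δ) (hh : 0 < h) (ξ : ℝ) : |ξ| - δ ≤ mu1 δ ξ h :=
  (isAngle_angle hδ hh ξ _).abs_sub_le_of_eq hδ hh (mu1_spec hδ hh ξ).2.1

/-! ### Comparison of `μ₁⁺` with the Gaussian ratio -/

/-- The Gaussian weight `e^{-(ξ + t)² / h}`. -/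
def gauss (h ξ t : ℝ) : ℝ := Real.exp (-(ξ + t) ^ 2 / h)

theorem continuous_gauss (h ξ : ℝ) : Continuous (gauss h ξ) := by unfold gauss; fun_prop

theorem gauss_pos (h ξ t : ℝ) : 0 < gauss h ξ t := Real.exp_pos _

theorem integral_gauss_pos {δ : ℝ} (hδ : 0 < δ) (h ξ : ℝ) : 0 < ∫ t in (-δ)..δ, gauss h ξ t :=
  intervalIntegral.intervalIntegral_pos_of_pos ((continuous_gauss h ξ).intervalIntegrable _ _)
    (gauss_pos h ξ) (by linarith)

theorem nu1_eq (δ ξ h : ℝ) :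
    nu1 δ ξ h = h * (gauss h ξ (-δ) + gauss h ξ δ) / ∫ t in (-δ)..δ, gauss h ξ t := rfl

theorem nu1_pos {δ h : ℝ} (hδ : 0 < δ) (hh : 0 < h) (ξ : ℝ) : 0 < nu1 δ ξ h := by
  rw [nu1_eq]
  exact div_pos (mul_pos hh (add_pos (gauss_pos _ _ _) (gauss_pos _ _ _)))
    (integral_gauss_pos hδ h ξ)

/-- The function is `y = tan θ`, the ratio of the components of the eigenfunction, which satisfies
`h y' = 2(ξ + t) y - μ₁⁺ (1 + y²)`. The Gaussian is the integrating factor that removes the linear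
term. The bound `|y| ≤ 1` comes from `|θ| ≤ π/4`. -/
theorem exists_riccati {δ h : ℝ} (hδ : 0 < δ) (hh : 0 < h) (ξ : ℝ) :
    ∃ y : ℝ → ℝ, ContinuousOn y (Icc (-δ) δ) ∧ (∀ t ∈ Icc (-δ) δ, |y t| ≤ 1) ∧ y (-δ) = 1 ∧
      y δ = -1 ∧ ∀ t ∈ Icc (-δ) δ, HasDerivAt (fun t => gauss h ξ t * y t)
        (-(mu1 δ ξ h / h * (gauss h ξ t * (1 + y t ^ 2)))) t := by
  set m := mu1 δ ξ h
  have H := isAngle_angle hδ hh ξ m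
  have hf : angle δ h ξ m δ = -(Real.pi / 4) := (mu1_spec hδ hh ξ).2.1
  set θ := angle δ h ξ m
  have hθ := H.abs_le_pi_div_four hh hf
  have hcos : ∀ t ∈ Icc (-δ) δ, 0 < Real.cos (θ t) := fun t ht => by
    have := abs_le.1 (hθ t ht)
    exact Real.cos_pos_of_mem_Ioo ⟨by linarith [Real.pi_pos], by linarith [Real.pi_pos]⟩
  have hd : ∀ t ∈ Icc (-δ) δ, HasDerivAt (fun t => Real.tan (θ t))
      (1 / Real.cos (θ t) ^ 2 * angleField h ξ m t (θ t)) t := fun t ht =>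
    (Real.hasDerivAt_tan (hcos t ht).ne').comp t (H.hasDerivAt t ht)
  refine ⟨fun t => Real.tan (θ t), fun t ht => (hd t ht).continuousAt.continuousWithinAt,
    fun t ht => ?_, by simp [H.init], by simp [hf], fun t ht => ?_⟩
  · have h1 := abs_le.1 (hθ t ht)
    have hm : StrictMonoOn Real.tan (Ioo (-(Real.pi / 2)) (Real.pi / 2)) := Real.strictMonoOn_tan
    have mem : ∀ x, -(Real.pi / 4) ≤ x → x ≤ Real.pi / 4 →
        x ∈ Ioo (-(Real.pi / 2)) (Real.pi / 2) := fun x h1 h2 =>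
      ⟨by linarith [Real.pi_pos], by linarith [Real.pi_pos]⟩
    have hp := Real.pi_pos
    have u1 := hm.monotoneOn (mem _ h1.1 h1.2) (mem (Real.pi / 4) (by linarith) le_rfl) h1.2
    have u2 := hm.monotoneOn (mem (-(Real.pi / 4)) le_rfl (by linarith)) (mem _ h1.1 h1.2) h1.1
    rw [Real.tan_neg, Real.tan_pi_div_four] at u2
    rw [Real.tan_pi_div_four] at u1
    exact abs_le.2 ⟨u2, u1⟩
  · have hg : HasDerivAt (gauss h ξ) (gauss h ξ t * (-(2 * (ξ + t)) / h)) t := by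
      have := ((((hasDerivAt_id t).const_add ξ).pow 2).neg.div_const h).exp
      refine this.congr_deriv ?_
      simp [gauss]
    refine (hg.mul (hd t ht)).congr_deriv ?_
    have hc := (hcos t ht).ne'
    simp only [angleField, Real.tan_eq_sin_div_cos, Real.sin_two_mul]
    set x := θ t
    field_simp
    linear_combination (gauss h ξ t * m) * Real.sin_sq_add_cos_sq x

/-- The basic identity and the bounds that it implies. -/
theorem exists_mu1_mul_eq {δ h : ℝ} (hδ : 0 < δ) (hh : 0 < h) (ξ : ℝ) :
    ∃ Q, 0 ≤ Q ∧ Q ≤ ∫ t in (-δ)..δ, gauss h ξ t ∧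
      Q ≤ 2 * δ * (gauss h ξ (-δ) + gauss h ξ δ) ∧
      mu1 δ ξ h * ((∫ t in (-δ)..δ, gauss h ξ t) + Q) =
        h * (gauss h ξ (-δ) + gauss h ξ δ) := by
  obtain ⟨y, hyc, hy1, hya, hyb, hd⟩ := exists_riccati hδ hh ξ
  set m := mu1 δ ξ h
  have hm : 0 < m := mu1_pos hδ hh ξ
  have hle : -δ ≤ δ := by linarith
  have hgc := continuous_gauss h ξ
  have hQi : IntervalIntegrable (fun t => gauss h ξ t * y t ^ 2) volume (-δ) δ :=
    ContinuousOn.intervalIntegrable_of_Icc hle (hgc.continuousOn.mul (hyc.pow 2))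
  have hgi : IntervalIntegrable (gauss h ξ) volume (-δ) δ := hgc.intervalIntegrable _ _
  have hdi : IntervalIntegrable (fun t => -(m / h * (gauss h ξ t * (1 + y t ^ 2)))) volume
      (-δ) δ := by
    refine ContinuousOn.intervalIntegrable_of_Icc hle ?_
    have := hgc.continuousOn (s := Icc (-δ) δ)
    fun_prop
  -- The product `g y` decreases from `g(-δ)` to `-g(δ)`, hence is bounded by boundary values of the
  -- Gaussian alone. This gives the bound on `Q` that is exponentially small compared with `∫ g`
  -- when `ξ = 0` and `h → 0`.
  have hanti : AntitoneOn (fun t => gauss h ξ t * y t) (Icc (-δ) δ) := by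
    refine antitoneOn_of_deriv_nonpos (convex_Icc _ _) (hgc.continuousOn.mul hyc) ?_ ?_
    · intro t ht
      rw [interior_Icc] at ht
      exact (hd t (Ioo_subset_Icc_self ht)).differentiableAt.differentiableWithinAt
    · intro t ht
      rw [interior_Icc] at ht
      rw [(hd t (Ioo_subset_Icc_self ht)).deriv, neg_nonpos]
      have := gauss_pos h ξ t
      positivity
  have hN : ∀ t ∈ Icc (-δ) δ, |gauss h ξ t * y t| ≤ gauss h ξ (-δ) + gauss h ξ δ := by
    intro t ht
    have u1 := hanti (left_mem_Icc.2 hle) ht ht.1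
    have u2 := hanti ht (right_mem_Icc.2 hle) ht.2
    simp only [hya, hyb] at u1 u2
    rw [abs_le]
    constructor <;> linarith [gauss_pos h ξ δ, gauss_pos h ξ (-δ)]
  have hI := intervalIntegral.integral_eq_sub_of_hasDerivAt
    (fun t ht => hd t (by rwa [uIcc_of_le hle] at ht)) hdi
  simp only [hya, hyb] at hI
  -- `Q` is the part of the integrated identity that comes from `y²`. It is the whole discrepancy
  -- between `μ₁⁺` and `ν₁`.
  refine ⟨∫ t in (-δ)..δ, gauss h ξ t * y t ^ 2, ?_, ?_, ?_, ?_⟩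
  · exact intervalIntegral.integral_nonneg hle fun t _ =>
      mul_nonneg (gauss_pos _ _ _).le (sq_nonneg _)
  · refine intervalIntegral.integral_mono_on hle hQi hgi fun t ht => ?_
    have h1 := (sq_le_one_iff_abs_le_one (y t)).2 (hy1 t ht)
    exact mul_le_of_le_one_right (gauss_pos _ _ _).le h1
  · have h1 : ∫ t in (-δ)..δ, gauss h ξ t * y t ^ 2 ≤
        ∫ _ in (-δ)..δ, (gauss h ξ (-δ) + gauss h ξ δ) := by
      refine intervalIntegral.integral_mono_on hle hQi (by simp) fun t ht => ?_
      calc gauss h ξ t * y t ^ 2 = (gauss h ξ t * y t) * y t := by ring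
        _ ≤ |gauss h ξ t * y t| * |y t| := by rw [← abs_mul]; exact le_abs_self _
        _ ≤ (gauss h ξ (-δ) + gauss h ξ δ) * 1 :=
          mul_le_mul (hN t ht) (hy1 t ht) (abs_nonneg _) ((abs_nonneg _).trans (hN t ht))
        _ = _ := mul_one _
    refine h1.trans (le_of_eq ?_)
    rw [intervalIntegral.integral_const, smul_eq_mul]
    ring
  · rw [intervalIntegral.integral_neg, intervalIntegral.integral_const_mul] at hI
    simp only [mul_add, mul_one] at hI
    rw [intervalIntegral.integral_add hgi hQi] at hI
    field_simp at hI
    linarith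

theorem mu1_le_nu1 {δ h : ℝ} (hδ : 0 < δ) (hh : 0 < h) (ξ : ℝ) : mu1 δ ξ h ≤ nu1 δ ξ h := by
  obtain ⟨Q, hQ0, -, -, e⟩ := exists_mu1_mul_eq hδ hh ξ
  rw [nu1_eq, le_div_iff₀ (integral_gauss_pos hδ h ξ)]
  nlinarith [mul_nonneg (mu1_pos hδ hh ξ).le hQ0]

theorem nu1_le_two_mul_mu1 {δ h : ℝ} (hδ : 0 < δ) (hh : 0 < h) (ξ : ℝ) :
    nu1 δ ξ h ≤ 2 * mu1 δ ξ h := by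
  obtain ⟨Q, -, hQ, -, e⟩ := exists_mu1_mul_eq hδ hh ξ
  rw [nu1_eq, div_le_iff₀ (integral_gauss_pos hδ h ξ)]
  nlinarith [mul_le_mul_of_nonneg_left hQ (mu1_pos hδ hh ξ).le]

/-- This divides the identity by `∫ g` and uses the boundary bound on `Q`. The comparison is sharp
when `ν₁` is small relative to `h`. -/
theorem nu1_le_mu1_mul {δ h : ℝ} (hδ : 0 < δ) (hh : 0 < h) (ξ : ℝ) :
    nu1 δ ξ h ≤ mu1 δ ξ h * (1 + 2 * δ * (nu1 δ ξ h / h)) := by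
  obtain ⟨Q, -, -, hQ, e⟩ := exists_mu1_mul_eq hδ hh ξ
  have hF := integral_gauss_pos hδ h ξ
  have e2 : nu1 δ ξ h / h = (gauss h ξ (-δ) + gauss h ξ δ) / ∫ t in (-δ)..δ, gauss h ξ t := by
    rw [nu1_eq]; field_simp
  rw [e2, nu1_eq, ← e]
  rw [div_le_iff₀ hF]
  calc mu1 δ ξ h * ((∫ t in (-δ)..δ, gauss h ξ t) + Q)
      ≤ mu1 δ ξ h * ((∫ t in (-δ)..δ, gauss h ξ t) +
        2 * δ * (gauss h ξ (-δ) + gauss h ξ δ)) := by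
        gcongr
        exact (mu1_pos hδ hh ξ).le
    _ = _ := by field_simp

/-- `μ₁⁺` is bounded below by any `x / (1 + 2δx/h)` with `0 ≤ x ≤ ν₁`. -/
theorem le_mu1_of_le_nu1 {δ h : ℝ} (hδ : 0 < δ) (hh : 0 < h) (ξ : ℝ) {x : ℝ} (hx : 0 ≤ x)
    (hxn : x ≤ nu1 δ ξ h) : x / (1 + 2 * δ * (x / h)) ≤ mu1 δ ξ h := by
  have h1 := nu1_le_mu1_mul hδ hh ξ
  have hn := nu1_pos hδ hh ξ
  have hm := mu1_pos hδ hh ξ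
  rw [div_le_iff₀ (by positivity)]
  -- The comparison is solved for the terms with `ν₁`. If the bracket is nonnegative, `ν₁` may be
  -- replaced by the smaller `x`. Otherwise the left side is nonpositive and the claim is trivial.
  have h2 : nu1 δ ξ h * (1 - mu1 δ ξ h * (2 * δ / h)) ≤ mu1 δ ξ h := by
    have : mu1 δ ξ h * (1 + 2 * δ * (nu1 δ ξ h / h)) =
      mu1 δ ξ h + nu1 δ ξ h * (mu1 δ ξ h * (2 * δ / h)) := by ring
    linarith
  have h3 : x * (1 - mu1 δ ξ h * (2 * δ / h)) ≤ mu1 δ ξ h := by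
    rcases le_or_gt 0 (1 - mu1 δ ξ h * (2 * δ / h)) with h4 | h4
    · exact (mul_le_mul_of_nonneg_right hxn h4).trans h2
    · exact (mul_nonpos_of_nonneg_of_nonpos hx h4.le).trans hm.le
  have : mu1 δ ξ h * (1 + 2 * δ * (x / h)) =
    mu1 δ ξ h + x * (mu1 δ ξ h * (2 * δ / h)) := by ring
  linarith

/-- Symmetrizing in `t` turns the Gaussian into `e^{-ξ²/h} e^{-t²/h} cosh(2ξt/h)`. The hyperbolic
cosine is largest at `t = ±δ`. Moving `ξ` away from `0` therefore multiplies the boundary values by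
at least as much as it multiplies the integral. -/
theorem nu1_zero_le {δ h : ℝ} (hδ : 0 < δ) (hh : 0 < h) (ξ : ℝ) : nu1 δ 0 h ≤ nu1 δ ξ h := by
  have hle : -δ ≤ δ := by linarith
  have key : ∀ t, gauss h ξ t + gauss h ξ (-t) =
      2 * (Real.exp (-ξ ^ 2 / h) * gauss h 0 t * Real.cosh (2 * ξ * t / h)) := by
    intro t
    rw [Real.cosh_eq]
    simp only [gauss]
    have e1 : -(ξ + t) ^ 2 / h = -ξ ^ 2 / h + -(0 + t) ^ 2 / h + -(2 * ξ * t / h) := by ring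
    have e2 : -(ξ + -t) ^ 2 / h = -ξ ^ 2 / h + -(0 + t) ^ 2 / h + 2 * ξ * t / h := by ring
    rw [e1, e2]
    simp only [Real.exp_add]
    ring
  have hg0 : gauss h 0 (-δ) = gauss h 0 δ := by simp [gauss]
  set c := Real.cosh (2 * ξ * δ / h)
  have hc : 0 < c := Real.cosh_pos _
  set E := Real.exp (-ξ ^ 2 / h)
  have hE : 0 < E := Real.exp_pos _
  have hI : ∫ t in (-δ)..δ, gauss h ξ t ≤ E * c * ∫ t in (-δ)..δ, gauss h 0 t := by
    have e1 : ∫ t in (-δ)..δ, gauss h ξ (-t) = ∫ t in (-δ)..δ, gauss h ξ t := by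
      simp
    have i1 : IntervalIntegrable (gauss h ξ) volume (-δ) δ :=
      (continuous_gauss h ξ).intervalIntegrable _ _
    have i2 : IntervalIntegrable (fun t => gauss h ξ (-t)) volume (-δ) δ :=
      ((continuous_gauss h ξ).comp continuous_neg).intervalIntegrable _ _
    have e2 : 2 * ∫ t in (-δ)..δ, gauss h ξ t =
        ∫ t in (-δ)..δ, (gauss h ξ t + gauss h ξ (-t)) := by
      rw [intervalIntegral.integral_add i1 i2, e1, two_mul]
    have e3 : ∫ t in (-δ)..δ, (gauss h ξ t + gauss h ξ (-t)) ≤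
        ∫ t in (-δ)..δ, 2 * (E * c) * gauss h 0 t := by
      refine intervalIntegral.integral_mono_on hle (i1.add i2)
        (((continuous_gauss h 0).const_mul _).intervalIntegrable _ _) fun t ht => ?_
      rw [key]
      have h1 : Real.cosh (2 * ξ * t / h) ≤ c := by
        rw [Real.cosh_le_cosh, abs_div, abs_div, abs_mul, abs_mul (2 * ξ), abs_of_pos hδ]
        gcongr
        exact abs_le.2 ⟨ht.1, ht.2⟩
      calc 2 * (E * gauss h 0 t * Real.cosh (2 * ξ * t / h))
          ≤ 2 * (E * gauss h 0 t * c) := by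
            have := gauss_pos h 0 t
            gcongr
        _ = _ := by ring
    rw [intervalIntegral.integral_const_mul] at e3
    linarith
  rw [nu1_eq, nu1_eq, div_le_div_iff₀ (integral_gauss_pos hδ h 0) (integral_gauss_pos hδ h ξ),
    add_comm (gauss h ξ (-δ)), key, hg0]
  calc h * (gauss h 0 δ + gauss h 0 δ) * ∫ t in (-δ)..δ, gauss h ξ t
      ≤ h * (gauss h 0 δ + gauss h 0 δ) * (E * c * ∫ t in (-δ)..δ, gauss h 0 t) := by
        have := gauss_pos h 0 δ
        gcongr
    _ = _ := by ring

/-! ### Semiclassical asymptotics -/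

/-- The substitution `t = √h x` turns the quotient into the Gaussian integral over `[-δ/√h, δ/√h]`.
-/
theorem tendsto_integral_gauss {δ : ℝ} (hδ : 0 < δ) :
    Tendsto (fun h : ℝ => (∫ t in (-δ)..δ, gauss h 0 t) / √h) (𝓝[>] 0) (𝓝 (√Real.pi)) := by
  have hgi : Integrable fun x : ℝ => Real.exp (-1 * x ^ 2) := integrable_exp_neg_mul_sq one_pos
  have hlim : Tendsto (fun h : ℝ => δ / √h) (𝓝[>] 0) atTop := by
    have h1 : Tendsto (fun h : ℝ => √h) (𝓝[>] 0) (𝓝[>] 0) := by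
      refine tendsto_nhdsWithin_iff.2 ⟨?_, ?_⟩
      · have := (Real.continuous_sqrt.tendsto 0).mono_left
          (nhdsWithin_le_nhds (s := Ioi (0 : ℝ)))
        simpa using this
      · filter_upwards [self_mem_nhdsWithin] with h hh
        exact Real.sqrt_pos.2 hh
    exact (tendsto_inv_nhdsGT_zero.comp h1).const_mul_atTop hδ
  have h2 := intervalIntegral_tendsto_integral hgi (tendsto_neg_atTop_atBot.comp hlim) hlim
  have e : ∫ x : ℝ, Real.exp (-1 * x ^ 2) = √Real.pi := by
    rw [integral_gaussian]; simp
  rw [e] at h2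
  refine h2.congr' ?_
  filter_upwards [self_mem_nhdsWithin] with h hh
  have hs : 0 < √h := Real.sqrt_pos.2 hh
  have := intervalIntegral.integral_comp_div (a := -δ) (b := δ)
    (fun x => Real.exp (-1 * x ^ 2)) hs.ne'
  rw [eq_div_iff hs.ne', mul_comm]
  simp only [Function.comp_def]
  rw [neg_div, smul_eq_mul] at this
  rw [← this]
  refine intervalIntegral.integral_congr fun t _ => ?_
  simp only [gauss, div_pow, Real.sq_sqrt (le_of_lt hh)]
  congr 1
  ring

theorem nu1_zero_equivalent {δ : ℝ} (hδ : 0 < δ) :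
    (fun h : ℝ => nu1 δ 0 h) ~[𝓝[>] 0]
      fun h : ℝ => 2 * √(h / Real.pi) * Real.exp (-δ ^ 2 / h) := by
  have hpi : 0 < √Real.pi := Real.sqrt_pos.2 Real.pi_pos
  rw [isEquivalent_iff_tendsto_one]
  · have h1 := (tendsto_integral_gauss hδ).inv₀ hpi.ne' |>.const_mul (√Real.pi)
    rw [mul_inv_cancel₀ hpi.ne'] at h1
    refine h1.congr' ?_
    filter_upwards [self_mem_nhdsWithin] with h hh
    have hs : 0 < √h := Real.sqrt_pos.2 hh
    have hF := integral_gauss_pos hδ h 0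
    have e0 : gauss h 0 (-δ) = Real.exp (-δ ^ 2 / h) := by simp [gauss]
    have e1 : gauss h 0 δ = Real.exp (-δ ^ 2 / h) := by simp [gauss]
    have e2 : h = √h * √h := (Real.mul_self_sqrt (le_of_lt hh)).symm
    have hE : 0 < Real.exp (-δ ^ 2 / h) := Real.exp_pos _
    rw [Pi.div_apply, nu1_eq, e0, e1, Real.sqrt_div' _ Real.pi_pos.le]
    generalize Real.exp (-δ ^ 2 / h) = E at *
    generalize (∫ t in (-δ)..δ, gauss h 0 t) = F at *
    field_simp
    rw [Real.sq_sqrt (le_of_lt hh)]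
    ring
  · filter_upwards [self_mem_nhdsWithin] with h hh
    have hs : 0 < √(h / Real.pi) := Real.sqrt_pos.2 (div_pos hh Real.pi_pos)
    positivity

theorem tendsto_exp_div_sqrt {δ : ℝ} (hδ : 0 < δ) :
    Tendsto (fun h : ℝ => Real.exp (-δ ^ 2 / h) / √h) (𝓝[>] 0) (𝓝 0) := by
  -- With `x = δ²/h` the quotient is `(√h / δ²) · x e^{-x}`, a product of two factors tending to
  -- zero.
  have h1 : Tendsto (fun h : ℝ => δ ^ 2 / h) (𝓝[>] 0) atTop :=
    tendsto_inv_nhdsGT_zero.const_mul_atTop (by positivity)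
  have h2 := (Real.tendsto_pow_mul_exp_neg_atTop_nhds_zero 1).comp h1
  have h3 : Tendsto (fun h : ℝ => √h / δ ^ 2) (𝓝[>] 0) (𝓝 0) := by
    have := ((Real.continuous_sqrt.tendsto 0).mono_left
      (nhdsWithin_le_nhds (s := Ioi (0 : ℝ)))).div_const (δ ^ 2)
    simpa using this
  have h4 := h3.mul h2
  rw [mul_zero] at h4
  refine h4.congr' ?_
  filter_upwards [self_mem_nhdsWithin] with h hh
  have hs : 0 < √h := Real.sqrt_pos.2 hh
  have hh' : h ≠ 0 := ne_of_gt hh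
  simp only [Function.comp_apply, pow_one, neg_div]
  field_simp
  rw [Real.sq_sqrt (le_of_lt hh)]

theorem tendsto_nu1_zero_div {δ : ℝ} (hδ : 0 < δ) :
    Tendsto (fun h : ℝ => nu1 δ 0 h / h) (𝓝[>] 0) (𝓝 0) := by
  have hpi : 0 < √Real.pi := Real.sqrt_pos.2 Real.pi_pos
  have h1 := ((tendsto_integral_gauss hδ).inv₀ hpi.ne').mul
    ((tendsto_exp_div_sqrt hδ).const_mul 2)
  rw [mul_zero, mul_zero] at h1
  refine h1.congr' ?_
  filter_upwards [self_mem_nhdsWithin] with h hh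
  have hs : 0 < √h := Real.sqrt_pos.2 hh
  have hh' : h ≠ 0 := ne_of_gt hh
  have hF := integral_gauss_pos hδ h 0
  have e0 : gauss h 0 (-δ) = Real.exp (-δ ^ 2 / h) := by simp [gauss]
  have e1 : gauss h 0 δ = Real.exp (-δ ^ 2 / h) := by simp [gauss]
  rw [nu1_eq, e0, e1]
  field_simp
  ring

theorem lambdaEss_le {δ h : ℝ} (hδ : 0 < δ) (hh : 0 < h) (ξ : ℝ) :
    lambdaEss δ h ≤ mu1 δ ξ h :=
  ciInf_le ⟨0, by rintro _ ⟨ξ, rfl⟩; exact (mu1_pos hδ hh ξ).le⟩ ξ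

/-- Taking `x = ν₁(0, h)`, the minimum of `ν₁`, makes the lower bound for `μ₁⁺(ξ, h)` independent of
`ξ`. -/
theorem le_lambdaEss {δ h : ℝ} (hδ : 0 < δ) (hh : 0 < h) :
    nu1 δ 0 h / (1 + 2 * δ * (nu1 δ 0 h / h)) ≤ lambdaEss δ h :=
  le_ciInf fun ξ => le_mu1_of_le_nu1 hδ hh ξ (nu1_pos hδ hh 0).le (nu1_zero_le hδ hh ξ)

theorem lambdaEss_pos {δ h : ℝ} (hδ : 0 < δ) (hh : 0 < h) : 0 < lambdaEss δ h :=
  lt_of_lt_of_le (div_pos (nu1_pos hδ hh 0) (by have := nu1_pos hδ hh 0; positivity))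
    (le_lambdaEss hδ hh)

theorem lambdaEss_equivalent {δ : ℝ} (hδ : 0 < δ) :
    (fun h : ℝ => lambdaEss δ h) ~[𝓝[>] 0]
      fun h : ℝ => 2 * √(h / Real.pi) * Real.exp (-δ ^ 2 / h) := by
  refine IsEquivalent.trans ?_ (nu1_zero_equivalent hδ)
  rw [isEquivalent_iff_tendsto_one]
  · have h1 : Tendsto (fun h : ℝ => (1 + 2 * δ * (nu1 δ 0 h / h))⁻¹) (𝓝[>] 0) (𝓝 1) := by
      have := (((tendsto_nu1_zero_div hδ).const_mul (2 * δ)).const_add 1).inv₀ (by simp)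
      simpa using this
    refine tendsto_of_tendsto_of_tendsto_of_le_of_le' h1 tendsto_const_nhds ?_ ?_
    · filter_upwards [self_mem_nhdsWithin] with h hh
      have hn := nu1_pos hδ hh 0
      rw [Pi.div_apply, le_div_iff₀ hn, mul_comm, ← div_eq_mul_inv]
      exact le_lambdaEss hδ hh
    · filter_upwards [self_mem_nhdsWithin] with h hh
      rw [Pi.div_apply, div_le_one (nu1_pos hδ hh 0)]
      exact (lambdaEss_le hδ hh 0).trans (mu1_le_nu1 hδ hh 0)
  · filter_upwards [self_mem_nhdsWithin] with h hh
    exact (nu1_pos hδ hh 0).ne'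

theorem exists_lower_bound {δ : ℝ} (hδ : 0 < δ) :
    ∃ r : ℝ → ℝ, Tendsto r (𝓝[>] 0) (𝓝 0) ∧
      ∀ h : ℝ, 0 < h → ∀ ξ : ℝ, mu1 δ ξ h ≤ 2 * √h * Real.exp (-δ ^ 2 / h) →
        nu1 δ ξ h * (1 + r h) ≤ mu1 δ ξ h := by
  -- This is the factor `(1 + 2δ ν₁/h)⁻¹`, minus one, with `ν₁` replaced by `4√h e^{-δ²/h}`. That
  -- bound follows from `ν₁ ≤ 2 μ₁⁺` and the assumption on `μ₁⁺`.
  refine ⟨fun h => (1 + 8 * δ * (Real.exp (-δ ^ 2 / h) / √h))⁻¹ - 1, ?_, fun h hh ξ hm => ?_⟩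
  · have := ((((tendsto_exp_div_sqrt hδ).const_mul (8 * δ)).const_add 1).inv₀ (by simp)).sub_const 1
    simpa using this
  · have hs : 0 < √h := Real.sqrt_pos.2 hh
    have hn := nu1_pos hδ hh ξ
    refine le_trans ?_ (le_mu1_of_le_nu1 hδ hh ξ hn.le le_rfl)
    rw [add_sub_cancel, ← div_eq_mul_inv]
    have h1 := nu1_le_two_mul_mu1 hδ hh ξ
    have h2 : nu1 δ ξ h ≤ 4 * √h * Real.exp (-δ ^ 2 / h) := by linarith
    have h3 : 2 * δ * (nu1 δ ξ h / h) ≤ 8 * δ * (Real.exp (-δ ^ 2 / h) / √h) := by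
      have e : 8 * δ * (Real.exp (-δ ^ 2 / h) / √h) =
          2 * δ * (4 * √h * Real.exp (-δ ^ 2 / h) / h) := by
        field_simp
        rw [Real.sq_sqrt hh.le]
        ring
      rw [e]
      gcongr
    gcongr

/-! ### The resolvent of the fibered operator -/

/-- Pairing of a function with the solution satisfying the boundary condition at `-δ`. -/
def pairLeft (δ h ξ l : ℝ) (F : ℝ → Spinor) (t : ℝ) : ℂ :=
  ∫ τ in (-δ)..t, ((left1 δ h ξ l τ : ℂ) * F τ 0 + (left2 δ h ξ l τ : ℂ) * F τ 1)

/-- Pairing of a function with the solution satisfying the boundary condition at `δ`. -/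
def pairRight (δ h ξ l : ℝ) (F : ℝ → Spinor) (t : ℝ) : ℂ :=
  ∫ τ in δ..t, ((right1 δ h ξ l τ : ℂ) * F τ 0 + (right2 δ h ξ l τ : ℂ) * F τ 1)

/-- The solution of `(𝒟_ξ - l) u = F`. -/
def res (δ h ξ l : ℝ) (F : ℝ → Spinor) (t : ℝ) : Spinor :=
  !₂[((√2 / (h * defect δ h ξ l) : ℝ) : ℂ) * (right1 δ h ξ l t * pairLeft δ h ξ l F t -
      left1 δ h ξ l t * pairRight δ h ξ l F t),
    ((√2 / (h * defect δ h ξ l) : ℝ) : ℂ) * (right2 δ h ξ l t * pairLeft δ h ξ l F t -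
      left2 δ h ξ l t * pairRight δ h ξ l F t)]

/-- The derivative of the solution of `(𝒟_ξ - l) u = F`. -/
def inhomDeriv (h ξ l : ℝ) (F u : ℝ → Spinor) (t : ℝ) : Spinor :=
  !₂[(l * u t 1 - ((ξ + t : ℝ) : ℂ) * u t 0 + F t 1) / h,
    (((ξ + t : ℝ) : ℂ) * u t 1 - l * u t 0 - F t 0) / h]

theorem fiberExpr_inhomDeriv {h ξ l : ℝ} (hh : 0 < h) (F u : ℝ → Spinor) (t : ℝ) :
    fiberExpr h ξ u (inhomDeriv h ξ l F u) t = (l : ℂ) • u t + F t := by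
  have : (h : ℂ) ≠ 0 := by exact_mod_cast hh.ne'
  refine spinor_ext ?_ ?_
  · simp only [fiberExpr, inhomDeriv, spinor_zero, spinor_one, PiLp.add_apply, PiLp.smul_apply,
      smul_eq_mul]
    field_simp
    ring
  · simp only [fiberExpr, inhomDeriv, spinor_zero, spinor_one, PiLp.add_apply, PiLp.smul_apply,
      smul_eq_mul]
    field_simp
    ring

theorem continuous_spinor {X : Type*} [TopologicalSpace X] {u : X → Spinor}
    (h0 : Continuous fun t => u t 0) (h1 : Continuous fun t => u t 1) : Continuous u :=
  continuousOn_univ.1 (continuousOn_spinor h0.continuousOn h1.continuousOn)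

theorem continuous_spinor_apply {X : Type*} [TopologicalSpace X] {u : X → Spinor}
    (hu : Continuous u) (i : Fin 2) : Continuous fun t => u t i :=
  (EuclideanSpace.proj (𝕜 := ℂ) i).continuous.comp hu

theorem continuous_inhomDeriv {h l c : ℝ} {F u : ℝ × ℝ → Spinor} (hF : Continuous F)
    (hu : Continuous u) : Continuous fun q : ℝ × ℝ =>
      inhomDeriv h (c * q.1) l (fun τ => F (q.1, τ)) (fun τ => u (q.1, τ)) q.2 := by
  have a0 := continuous_spinor_apply hF 0
  have a1 := continuous_spinor_apply hF 1
  have b0 := continuous_spinor_apply hu 0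
  have b1 := continuous_spinor_apply hu 1
  refine continuous_spinor ?_ ?_
  · simp only [inhomDeriv, spinor_zero]
    fun_prop
  · simp only [inhomDeriv, spinor_one]
    fun_prop

/-- Joint continuity of the solution in the frequency and the transversal variable. -/
theorem continuous_res {δ h l : ℝ} (hδ : 0 < δ) (hh : 0 < h) (hd : ∀ ξ, defect δ h ξ l ≠ 0)
    (c : ℝ) {F : ℝ × ℝ → Spinor} (hF : Continuous F) :
    Continuous fun q : ℝ × ℝ => res δ h (c * q.1) l (fun τ => F (q.1, τ)) q.2 := by
  have hq : Continuous fun q : ℝ × ℝ => (c * q.1, l, q.2) := by fun_prop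
  have l1 : Continuous fun q : ℝ × ℝ => (left1 δ h (c * q.1) l q.2 : ℂ) :=
    Complex.continuous_ofReal.comp ((continuous_left1 hδ hh).comp hq)
  have l2 : Continuous fun q : ℝ × ℝ => (left2 δ h (c * q.1) l q.2 : ℂ) :=
    Complex.continuous_ofReal.comp ((continuous_left2 hδ hh).comp hq)
  have r1 : Continuous fun q : ℝ × ℝ => (right1 δ h (c * q.1) l q.2 : ℂ) :=
    Complex.continuous_ofReal.comp ((continuous_right1 hδ hh).comp hq)
  have r2 : Continuous fun q : ℝ × ℝ => (right2 δ h (c * q.1) l q.2 : ℂ) :=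
    Complex.continuous_ofReal.comp ((continuous_right2 hδ hh).comp hq)
  have d1 : Continuous fun q : ℝ × ℝ => ((√2 / (h * defect δ h (c * q.1) l) : ℝ) : ℂ) := by
    have := (continuous_defect hδ hh).comp (show Continuous fun q : ℝ × ℝ => (c * q.1, l) by
      fun_prop)
    exact Complex.continuous_ofReal.comp (continuous_const.div (continuous_const.mul this)
      fun q => mul_ne_zero hh.ne' (hd _))
  have a0 := continuous_spinor_apply hF 0
  have a1 := continuous_spinor_apply hF 1
  have hx : Continuous fun x : (ℝ × ℝ) × ℝ => (x.1.1, x.2) := by fun_prop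
  have P : Continuous fun q : ℝ × ℝ => pairLeft δ h (c * q.1) l (fun τ => F (q.1, τ)) q.2 := by
    refine intervalIntegral.continuous_parametric_intervalIntegral_of_continuous
      (f := fun (q : ℝ × ℝ) τ => ((left1 δ h (c * q.1) l τ : ℂ) * F (q.1, τ) 0 +
        (left2 δ h (c * q.1) l τ : ℂ) * F (q.1, τ) 1)) ?_ continuous_snd
    have key : Continuous fun q : ℝ × ℝ => (left1 δ h (c * q.1) l q.2 : ℂ) * F q 0 +
        (left2 δ h (c * q.1) l q.2 : ℂ) * F q 1 := (l1.mul a0).add (l2.mul a1)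
    have k2 := key.comp hx
    simp only [Function.comp_def] at k2
    exact k2
  have R : Continuous fun q : ℝ × ℝ => pairRight δ h (c * q.1) l (fun τ => F (q.1, τ)) q.2 := by
    refine intervalIntegral.continuous_parametric_intervalIntegral_of_continuous
      (f := fun (q : ℝ × ℝ) τ => ((right1 δ h (c * q.1) l τ : ℂ) * F (q.1, τ) 0 +
        (right2 δ h (c * q.1) l τ : ℂ) * F (q.1, τ) 1)) ?_ continuous_snd
    have key : Continuous fun q : ℝ × ℝ => (right1 δ h (c * q.1) l q.2 : ℂ) * F q 0 +
        (right2 δ h (c * q.1) l q.2 : ℂ) * F q 1 := (r1.mul a0).add (r2.mul a1)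
    have k2 := key.comp hx
    simp only [Function.comp_def] at k2
    exact k2
  exact continuous_spinor (d1.mul ((r1.mul P).sub (l1.mul R)))
    (d1.mul ((r2.mul P).sub (l2.mul R)))

theorem continuous_res_right {δ h l : ℝ} (hδ : 0 < δ) (hh : 0 < h)
    (hd : ∀ ξ, defect δ h ξ l ≠ 0) (ξ : ℝ) {F : ℝ → Spinor} (hF : Continuous F) :
    Continuous (res δ h ξ l F) := by
  have := (continuous_res hδ hh hd ξ (hF.comp continuous_snd)).comp
    (show Continuous fun t : ℝ => ((1 : ℝ), t) by fun_prop)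
  simpa [Function.comp_def] using this

/-- Variation of constants. Differentiating the two pairings produces `F` times the Wronskian of the
boundary solutions, and `√2 / (h · defect)` is exactly minus the inverse of `h` times that
Wronskian. -/
theorem hasDerivAt_res {δ h l : ℝ} (hδ : 0 < δ) (hh : 0 < h) {ξ : ℝ}
    (hd : defect δ h ξ l ≠ 0) {F : ℝ → Spinor} (hF : Continuous F) {t : ℝ}
    (ht : t ∈ Ioo (-δ) δ) :
    HasDerivAt (res δ h ξ l F) (inhomDeriv h ξ l F (res δ h ξ l F) t) t := by
  have hq : Continuous fun t : ℝ => (ξ, l, t) := by fun_prop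
  have l1 := Complex.continuous_ofReal.comp ((continuous_left1 hδ hh).comp hq)
  have l2 := Complex.continuous_ofReal.comp ((continuous_left2 hδ hh).comp hq)
  have r1 := Complex.continuous_ofReal.comp ((continuous_right1 hδ hh).comp hq)
  have r2 := Complex.continuous_ofReal.comp ((continuous_right2 hδ hh).comp hq)
  have cP := (l1.mul (continuous_spinor_apply hF 0)).add (l2.mul (continuous_spinor_apply hF 1))
  have cR := (r1.mul (continuous_spinor_apply hF 0)).add (r2.mul (continuous_spinor_apply hF 1))
  have dP : HasDerivAt (pairLeft δ h ξ l F) _ t :=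
    intervalIntegral.integral_hasDerivAt_right (cP.intervalIntegrable _ _)
      (cP.stronglyMeasurableAtFilter _ _) cP.continuousAt
  have dR : HasDerivAt (pairRight δ h ξ l F) _ t :=
    intervalIntegral.integral_hasDerivAt_right (cR.intervalIntegrable _ _)
      (cR.stronglyMeasurableAtFilter _ _) cR.continuousAt
  have hl := isSol_left hδ hh ξ l
  have hr := isSol_right hδ hh ξ l
  have hW := congrArg (fun x : ℝ => (x : ℂ)) (wronskian_left_right hδ hh ξ l
    (Ioo_subset_Icc_self ht))
  push_cast at hW
  have h2 : ((√2 : ℝ) : ℂ) * ((√2 : ℝ) : ℂ) = 2 := by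
    rw [← Complex.ofReal_mul, Real.mul_self_sqrt (by norm_num)]; norm_num
  have hh' : (h : ℂ) ≠ 0 := by exact_mod_cast hh.ne'
  have hd' : (defect δ h ξ l : ℂ) ≠ 0 := by exact_mod_cast hd
  refine hasDerivAt_spinor ?_ ?_
  · refine ((((hr.deriv1 t ht).mul dP).sub ((hl.deriv1 t ht).mul dR)).const_mul
      ((√2 / (h * defect δ h ξ l) : ℝ) : ℂ)).congr_deriv ?_
    simp only [inhomDeriv, res, spinor_zero, spinor_one, Pi.zero_apply]
    push_cast
    field_simp
    linear_combination (-((√2 : ℝ) : ℂ) * F t 1 * h) * hW + (h * defect δ h ξ l * F t 1 / 2) * h2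
  · refine ((((hr.deriv2 t ht).mul dP).sub ((hl.deriv2 t ht).mul dR)).const_mul
      ((√2 / (h * defect δ h ξ l) : ℝ) : ℂ)).congr_deriv ?_
    simp only [inhomDeriv, res, spinor_zero, spinor_one, Pi.zero_apply]
    push_cast
    field_simp
    linear_combination (((√2 : ℝ) : ℂ) * F t 0 * h) * hW - (h * defect δ h ξ l * F t 0 / 2) * h2

/-- At each endpoint one of the two pairings is an integral over a point. What remains is a multiple
of the boundary solution adapted to that endpoint. -/
theorem fiberBC_res {δ h : ℝ} (hδ : 0 < δ) (hh : 0 < h) (ξ l : ℝ) (F : ℝ → Spinor) :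
    FiberBC δ (res δ h ξ l F) := by
  constructor
  · simp only [res, spinor_zero, spinor_one, pairRight, intervalIntegral.integral_same,
      right_pos hδ hh]
    push_cast
    ring
  · simp only [res, spinor_zero, spinor_one, pairLeft, intervalIntegral.integral_same,
      left_neg hδ hh]
    push_cast
    ring

theorem spinor_norm_sq (x : Spinor) : ‖x‖ ^ 2 = ‖x 0‖ ^ 2 + ‖x 1‖ ^ 2 := by
  rw [EuclideanSpace.norm_sq_eq, Fin.sum_univ_two]

/-- The norm of the fibered operator. -/
theorem integral_norm_sq_fiberExpr {δ h ξ : ℝ} (hδ : 0 < δ) {u v : ℝ → Spinor}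
    (hu : ContinuousOn u (Icc (-δ) δ)) (hv : ContinuousOn v (Icc (-δ) δ))
    (hd : ∀ t ∈ Ioo (-δ) δ, HasDerivAt u (v t) t) (hB : FiberBC δ u) :
    ∫ t in (-δ)..δ, ‖fiberExpr h ξ u v t‖ ^ 2 =
      ∫ t in (-δ)..δ, (h ^ 2 * ‖v t‖ ^ 2 + (ξ + t) ^ 2 * ‖u t‖ ^ 2 +
        h * (‖u t 1‖ ^ 2 - ‖u t 0‖ ^ 2)) := by
  have hle : -δ ≤ δ := by linarith
  have pr : ∀ {w : ℝ → Spinor}, ContinuousOn w (Icc (-δ) δ) → ∀ i : Fin 2,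
      ContinuousOn (fun t => w t i) (Icc (-δ) δ) := fun hw i =>
    (EuclideanSpace.proj (𝕜 := ℂ) i).continuous.comp_continuousOn hw
  have u0 := pr hu 0
  have u1 := pr hu 1
  have v0 := pr hv 0
  have v1 := pr hv 1
  -- `G` is the derivative of `h (ξ + t)(‖u₁‖² - ‖u₂‖²)`, which vanishes at both ends because the
  -- boundary conditions equate the moduli of the components. It carries the cross terms of the
  -- square, up to the zeroth order term `h (‖u₂‖² - ‖u₁‖²)`.
  set G : ℝ → ℝ := fun t => h * (‖u t 0‖ ^ 2 - ‖u t 1‖ ^ 2) +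
    h * (ξ + t) * (2 * inner ℝ (u t 0) (v t 0) - 2 * inner ℝ (u t 1) (v t 1))
  have hG : ContinuousOn G (Icc (-δ) δ) := by
    refine ContinuousOn.add (by fun_prop) (ContinuousOn.mul (by fun_prop) ?_)
    exact (((ContinuousOn.inner (𝕜 := ℝ) u0 v0).const_smul (2 : ℝ)).sub
      ((ContinuousOn.inner (𝕜 := ℝ) u1 v1).const_smul (2 : ℝ)) :)
  have hI := intervalIntegral.integral_eq_sub_of_hasDerivAt_of_le hle
    (f := fun t => h * (ξ + t) * (‖u t 0‖ ^ 2 - ‖u t 1‖ ^ 2)) (f' := G) (by fun_prop)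
    (fun t ht => by
      have e0 := (hasDerivAt_spinor_apply (hd t ht) 0).norm_sq
      have e1 := (hasDerivAt_spinor_apply (hd t ht) 1).norm_sq
      refine ((((hasDerivAt_id t).const_add ξ).const_mul h).mul (e0.sub e1)).congr_deriv ?_
      simp [G])
    (hG.intervalIntegrable_of_Icc hle)
  have b1 : ‖u δ 0‖ = ‖u δ 1‖ := by rw [hB.1, norm_neg]
  have b2 : ‖u (-δ) 0‖ = ‖u (-δ) 1‖ := by rw [hB.2]
  rw [b1, b2, sub_self, sub_self, mul_zero, mul_zero, sub_zero] at hI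
  have hc : ContinuousOn (fun t => h ^ 2 * ‖v t‖ ^ 2 + (ξ + t) ^ 2 * ‖u t‖ ^ 2 +
      h * (‖u t 1‖ ^ 2 - ‖u t 0‖ ^ 2)) (Icc (-δ) δ) := by fun_prop
  rw [← sub_eq_zero, ← hI, sub_eq_iff_eq_add, ← intervalIntegral.integral_add
    (hG.intervalIntegrable_of_Icc hle) (hc.intervalIntegrable_of_Icc hle)]
  refine intervalIntegral.integral_congr fun t _ => ?_
  simp only [G, spinor_norm_sq, fiberExpr, Matrix.cons_val_zero, Matrix.cons_val_one,
    Complex.sq_norm,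
    Complex.normSq_apply, Complex.inner]
  simp only [Complex.sub_re, Complex.add_re, Complex.sub_im, Complex.add_im, Complex.mul_re,
    Complex.mul_im, Complex.ofReal_re, Complex.ofReal_im, Complex.conj_re, Complex.conj_im]
  ring

/-- One-dimensional Sobolev inequality. -/
theorem norm_sq_le_of_hasDerivAt {δ : ℝ} (hδ : 0 < δ) {u v : ℝ → Spinor}
    (hu : ContinuousOn u (Icc (-δ) δ)) (hv : ContinuousOn v (Icc (-δ) δ))
    (hd : ∀ t ∈ Ioo (-δ) δ, HasDerivAt u (v t) t) {t : ℝ} (ht : t ∈ Icc (-δ) δ) :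
    ‖u t‖ ^ 2 ≤ (1 / (2 * δ) + 1) * (∫ s in (-δ)..δ, ‖u s‖ ^ 2) + ∫ s in (-δ)..δ, ‖v s‖ ^ 2 := by
  have hle : -δ ≤ δ := by linarith
  have u0 : ∀ i : Fin 2, ContinuousOn (fun t => u t i) (Icc (-δ) δ) := fun i =>
    (EuclideanSpace.proj (𝕜 := ℂ) i).continuous.comp_continuousOn hu
  have v0 : ∀ i : Fin 2, ContinuousOn (fun t => v t i) (Icc (-δ) δ) := fun i =>
    (EuclideanSpace.proj (𝕜 := ℂ) i).continuous.comp_continuousOn hv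
  set G : ℝ → ℝ := fun t => 2 * inner ℝ (u t 0) (v t 0) + 2 * inner ℝ (u t 1) (v t 1)
  have hG : ContinuousOn G (Icc (-δ) δ) :=
    (((ContinuousOn.inner (𝕜 := ℝ) (u0 0) (v0 0)).const_smul (2 : ℝ)).add
      ((ContinuousOn.inner (𝕜 := ℝ) (u0 1) (v0 1)).const_smul (2 : ℝ)) :)
  have hS : ContinuousOn (fun s => ‖u s‖ ^ 2 + ‖v s‖ ^ 2) (Icc (-δ) δ) := by fun_prop
  have hSi := hS.intervalIntegrable_of_Icc (μ := volume) hle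
  have hu2 : ContinuousOn (fun s => ‖u s‖ ^ 2) (Icc (-δ) δ) := by fun_prop
  have hv2 : ContinuousOn (fun s => ‖v s‖ ^ 2) (Icc (-δ) δ) := by fun_prop
  have hGS : ∀ s, |G s| ≤ ‖u s‖ ^ 2 + ‖v s‖ ^ 2 := by
    intro s
    have a0 := abs_real_inner_le_norm (u s 0) (v s 0)
    have a1 := abs_real_inner_le_norm (u s 1) (v s 1)
    simp only [G, spinor_norm_sq]
    refine (abs_add_le _ _).trans ?_
    rw [abs_mul, abs_mul, abs_of_pos (by norm_num : (0 : ℝ) < 2)]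
    nlinarith [sq_nonneg (‖u s 0‖ - ‖v s 0‖), sq_nonneg (‖u s 1‖ - ‖v s 1‖)]
  have hder : ∀ s ∈ Ioo (-δ) δ, HasDerivAt (fun s => ‖u s‖ ^ 2) (G s) s := fun s hs => by
    simp only [spinor_norm_sq]
    exact (hasDerivAt_spinor_apply (hd s hs) 0).norm_sq.add
      (hasDerivAt_spinor_apply (hd s hs) 1).norm_sq
  set S := ∫ s in (-δ)..δ, (‖u s‖ ^ 2 + ‖v s‖ ^ 2)
  -- The oscillation of `‖u‖²` between any two points is at most `S`. Averaging over `s` then bounds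
  -- the value at `t`.
  have key : ∀ s ∈ Icc (-δ) δ, ‖u t‖ ^ 2 ≤ ‖u s‖ ^ 2 + S := by
    have mono : ∀ a b, a ∈ Icc (-δ) δ → b ∈ Icc (-δ) δ → a ≤ b →
        |‖u b‖ ^ 2 - ‖u a‖ ^ 2| ≤ S := by
      intro a b ha hb hab
      have hs : Icc a b ⊆ Icc (-δ) δ := Icc_subset_Icc ha.1 hb.2
      rw [← intervalIntegral.integral_eq_sub_of_hasDerivAt_of_le hab
        (f := fun s => ‖u s‖ ^ 2) (hu2.mono hs)
        (fun s hs' => hder s ⟨ha.1.trans_lt hs'.1, hs'.2.trans_le hb.2⟩)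
        ((hG.mono hs).intervalIntegrable_of_Icc hab)]
      refine (intervalIntegral.abs_integral_le_integral_abs hab).trans ?_
      refine (intervalIntegral.integral_mono_on hab
        ((hG.mono hs).intervalIntegrable_of_Icc hab).abs
        ((hS.mono hs).intervalIntegrable_of_Icc hab) fun s _ => hGS s).trans ?_
      exact intervalIntegral.integral_mono_interval ha.1 hab hb.2
        (Eventually.of_forall fun s => by positivity) hSi
    intro s hs
    rcases le_total s t with h1 | h1
    · have := (abs_le.1 (mono s t hs ht h1)).2
      linarith
    · have := (abs_le.1 (mono t s ht hs h1)).1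
      linarith
  have hint := intervalIntegral.integral_mono_on hle
    (f := fun _ => ‖u t‖ ^ 2) (g := fun s => ‖u s‖ ^ 2 + S) (μ := volume) (by simp)
    ((hu2.add continuousOn_const).intervalIntegrable_of_Icc hle) key
  rw [intervalIntegral.integral_const, intervalIntegral.integral_add
    (hu2.intervalIntegrable_of_Icc hle) (by simp), intervalIntegral.integral_const, smul_eq_mul,
    smul_eq_mul] at hint
  have hSe : S = (∫ s in (-δ)..δ, ‖u s‖ ^ 2) + ∫ s in (-δ)..δ, ‖v s‖ ^ 2 :=
    intervalIntegral.integral_add (hu2.intervalIntegrable_of_Icc hle)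
      (hv2.intervalIntegrable_of_Icc hle)
  have h2 : ‖u t‖ ^ 2 ≤ (1 / (2 * δ)) * (∫ s in (-δ)..δ, ‖u s‖ ^ 2) + S := by
    have : (1 / (2 * δ)) * (∫ s in (-δ)..δ, ‖u s‖ ^ 2) + S =
        ((∫ s in (-δ)..δ, ‖u s‖ ^ 2) + (δ - -δ) * S) / (2 * δ) := by
      field_simp; ring
    rw [this, le_div_iff₀ (by positivity)]
    linarith
  linarith

theorem sq_integral_le {δ : ℝ} (hδ : 0 < δ) {f : ℝ → ℝ} (hf : ContinuousOn f (Icc (-δ) δ)) :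
    (∫ t in (-δ)..δ, f t) ^ 2 ≤ 2 * δ * ∫ t in (-δ)..δ, f t ^ 2 := by
  have hle : -δ ≤ δ := by linarith
  set J := ∫ t in (-δ)..δ, f t
  -- Cauchy–Schwarz by expanding the square of `f - c`, where `c` is the mean of `f`.
  set c := J / (2 * δ)
  have i1 := hf.intervalIntegrable_of_Icc (μ := volume) hle
  have i2 : IntervalIntegrable (fun t => f t ^ 2) volume (-δ) δ :=
    ContinuousOn.intervalIntegrable_of_Icc hle (by fun_prop)
  have h0 : 0 ≤ ∫ t in (-δ)..δ, (f t ^ 2 - 2 * c * f t + c ^ 2) :=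
    intervalIntegral.integral_nonneg hle fun t _ => by nlinarith [sq_nonneg (f t - c)]
  rw [intervalIntegral.integral_add (i2.sub (i1.const_mul _)) (by simp),
    intervalIntegral.integral_sub i2 (i1.const_mul _), intervalIntegral.integral_const_mul,
    intervalIntegral.integral_const, smul_eq_mul] at h0
  have e : J = 2 * δ * c := by simp only [c]; field_simp
  change 0 ≤ (∫ t in (-δ)..δ, f t ^ 2) - 2 * c * J + (δ - -δ) * c ^ 2 at h0
  rw [e] at h0 ⊢
  nlinarith

theorem norm_spinor_le (a b : ℂ) : ‖(!₂[a, b] : Spinor)‖ ≤ ‖a‖ + ‖b‖ := by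
  refine le_of_sq_le_sq ?_ (by positivity)
  rw [spinor_norm_sq, spinor_zero, spinor_one]
  nlinarith [norm_nonneg a, norm_nonneg b]

theorem norm_pairing_le {p q : ℝ → ℝ} {F : ℝ → Spinor} {P : ℝ} {δ : ℝ} (hδ : 0 < δ)
    (hF : Continuous F) (hp : ∀ t ∈ Icc (-δ) δ, |p t| ≤ P) (hq : ∀ t ∈ Icc (-δ) δ, |q t| ≤ P)
    {a b : ℝ} (ha : a ∈ Icc (-δ) δ) (hb : b ∈ Icc (-δ) δ) (hab : a ≤ b) :
    ‖∫ τ in a..b, ((p τ : ℂ) * F τ 0 + (q τ : ℂ) * F τ 1)‖ ≤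
      2 * P * ∫ τ in (-δ)..δ, ‖F τ‖ := by
  have hle : -δ ≤ δ := by linarith
  have hP : 0 ≤ P := (abs_nonneg _).trans (hp _ ha)
  refine (intervalIntegral.norm_integral_le_of_norm_le hab (g := fun τ => 2 * P * ‖F τ‖)
    (Eventually.of_forall fun τ hτ => ?_)
    ((continuous_const.mul hF.norm).intervalIntegrable _ _)).trans ?_
  · have hτ' : τ ∈ Icc (-δ) δ := ⟨ha.1.trans hτ.1.le, hτ.2.trans hb.2⟩
    have f0 : ‖F τ 0‖ ≤ ‖F τ‖ := PiLp.norm_apply_le (F τ) 0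
    have f1 : ‖F τ 1‖ ≤ ‖F τ‖ := PiLp.norm_apply_le (F τ) 1
    refine (norm_add_le _ _).trans ?_
    rw [norm_mul, norm_mul, Complex.norm_real, Complex.norm_real, Real.norm_eq_abs,
      Real.norm_eq_abs]
    have e0 := mul_le_mul (hp τ hτ') f0 (norm_nonneg _) hP
    have e1 := mul_le_mul (hq τ hτ') f1 (norm_nonneg _) hP
    linarith
  · rw [intervalIntegral.integral_const_mul]
    refine mul_le_mul_of_nonneg_left ?_ (by positivity)
    exact intervalIntegral.integral_mono_interval ha.1 hab hb.2
      (Eventually.of_forall fun s => norm_nonneg _) (hF.norm.intervalIntegrable _ _)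

/-- The boundary solutions are jointly continuous in `(ξ, t)`, and the inverse of the defect is
continuous in `ξ` because the defect never vanishes. All are bounded on the compact range. -/
theorem exists_res_bound_of_abs_le {δ h l : ℝ} (hδ : 0 < δ) (hh : 0 < h)
    (hd : ∀ ξ, defect δ h ξ l ≠ 0) (M : ℝ) :
    ∃ C, 0 ≤ C ∧ ∀ ξ, |ξ| ≤ M → ∀ F : ℝ → Spinor, Continuous F →
      ∫ t in (-δ)..δ, ‖res δ h ξ l F t‖ ^ 2 ≤ C * ∫ t in (-δ)..δ, ‖F t‖ ^ 2 := by
  have hle : -δ ≤ δ := by linarith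
  have hq : Continuous fun q : ℝ × ℝ => (q.1, l, q.2) := by fun_prop
  have hK : IsCompact (Icc (-M) M ×ˢ Icc (-δ) δ) := isCompact_Icc.prod isCompact_Icc
  obtain ⟨P1, h1⟩ := hK.exists_bound_of_continuousOn
    ((continuous_left1 hδ hh).comp hq).continuousOn
  obtain ⟨P2, h2⟩ := hK.exists_bound_of_continuousOn
    ((continuous_left2 hδ hh).comp hq).continuousOn
  obtain ⟨P3, h3⟩ := hK.exists_bound_of_continuousOn
    ((continuous_right1 hδ hh).comp hq).continuousOn
  obtain ⟨P4, h4⟩ := hK.exists_bound_of_continuousOn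
    ((continuous_right2 hδ hh).comp hq).continuousOn
  have hdc : Continuous fun ξ => √2 / (h * defect δ h ξ l) := by
    have := (continuous_defect hδ hh).comp (show Continuous fun ξ : ℝ => (ξ, l) by fun_prop)
    exact continuous_const.div (continuous_const.mul this) fun q => mul_ne_zero hh.ne' (hd _)
  obtain ⟨K, h5⟩ := (isCompact_Icc (a := -M) (b := M)).exists_bound_of_continuousOn
    hdc.continuousOn
  set P := max (max P1 P2) (max P3 P4)
  simp only [Function.comp_apply, Real.norm_eq_abs, mem_prod, and_imp, Prod.forall] at h1 h2 h3 h4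
  have hPmax : P1 ≤ P ∧ P2 ≤ P ∧ P3 ≤ P ∧ P4 ≤ P := by simp [P]
  -- Each component of the solution is at most `4 |K| P² J`, and the norm is at most the sum of
  -- both. One factor `2δ` is the length of the interval, the other comes from `sq_integral_le`.
  refine ⟨(8 * |K| * P ^ 2) ^ 2 * (2 * δ) * (2 * δ), by positivity, fun ξ hξ F hF => ?_⟩
  have hξ' : ξ ∈ Icc (-M) M := abs_le.1 hξ
  have b1 : ∀ t ∈ Icc (-δ) δ, |left1 δ h ξ l t| ≤ P := fun t ht =>
    (h1 ξ t hξ' ht).trans hPmax.1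
  have b2 : ∀ t ∈ Icc (-δ) δ, |left2 δ h ξ l t| ≤ P := fun t ht =>
    (h2 ξ t hξ' ht).trans hPmax.2.1
  have b3 : ∀ t ∈ Icc (-δ) δ, |right1 δ h ξ l t| ≤ P := fun t ht =>
    (h3 ξ t hξ' ht).trans hPmax.2.2.1
  have b4 : ∀ t ∈ Icc (-δ) δ, |right2 δ h ξ l t| ≤ P := fun t ht =>
    (h4 ξ t hξ' ht).trans hPmax.2.2.2
  have hP : 0 ≤ P := (abs_nonneg _).trans (b1 δ (right_mem_Icc.2 hle))
  set J := ∫ τ in (-δ)..δ, ‖F τ‖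
  have hJ : 0 ≤ J := intervalIntegral.integral_nonneg hle fun _ _ => norm_nonneg _
  have hk : ‖((√2 / (h * defect δ h ξ l) : ℝ) : ℂ)‖ ≤ |K| := by
    rw [Complex.norm_real]
    exact (h5 ξ hξ').trans (le_abs_self _)
  have key : ∀ t ∈ Icc (-δ) δ, ‖res δ h ξ l F t‖ ≤ 8 * |K| * P ^ 2 * J := by
    intro t ht
    have pl : ‖pairLeft δ h ξ l F t‖ ≤ 2 * P * J :=
      norm_pairing_le hδ hF b1 b2 (left_mem_Icc.2 hle) ht ht.1
    have pr : ‖pairRight δ h ξ l F t‖ ≤ 2 * P * J := by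
      rw [pairRight, intervalIntegral.integral_symm, norm_neg]
      exact norm_pairing_le hδ hF b3 b4 ht (right_mem_Icc.2 hle) ht.2
    have comp : ∀ x y : ℝ, |x| ≤ P → |y| ≤ P →
        ‖((√2 / (h * defect δ h ξ l) : ℝ) : ℂ) * (x * pairLeft δ h ξ l F t -
          y * pairRight δ h ξ l F t)‖ ≤ 4 * |K| * P ^ 2 * J := by
      intro x y hx hy
      rw [norm_mul]
      have e1 : ‖(x : ℂ) * pairLeft δ h ξ l F t‖ ≤ P * (2 * P * J) := by
        rw [norm_mul, Complex.norm_real]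
        exact mul_le_mul hx pl (norm_nonneg _) hP
      have e2 : ‖(y : ℂ) * pairRight δ h ξ l F t‖ ≤ P * (2 * P * J) := by
        rw [norm_mul, Complex.norm_real]
        exact mul_le_mul hy pr (norm_nonneg _) hP
      calc _ ≤ |K| * (P * (2 * P * J) + P * (2 * P * J)) :=
            mul_le_mul hk ((norm_sub_le _ _).trans (add_le_add e1 e2)) (norm_nonneg _)
              (abs_nonneg _)
        _ = _ := by ring
    refine (norm_spinor_le _ _).trans ?_
    have := add_le_add (comp _ _ (b3 t ht) (b1 t ht)) (comp _ _ (b4 t ht) (b2 t ht))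
    linarith
  have hJ2 := sq_integral_le hδ hF.norm.continuousOn
  calc ∫ t in (-δ)..δ, ‖res δ h ξ l F t‖ ^ 2
      ≤ ∫ _ in (-δ)..δ, (8 * |K| * P ^ 2 * J) ^ 2 := by
        refine intervalIntegral.integral_mono_on hle ?_ (by simp) fun t ht =>
          pow_le_pow_left₀ (norm_nonneg _) (key t ht) 2
        exact ((continuous_res_right hδ hh hd ξ hF).norm.pow 2).intervalIntegrable _ _
    _ = (8 * |K| * P ^ 2) ^ 2 * (2 * δ) * J ^ 2 := by
        rw [intervalIntegral.integral_const, smul_eq_mul]; ring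
    _ ≤ (8 * |K| * P ^ 2) ^ 2 * (2 * δ) * (2 * δ * ∫ t in (-δ)..δ, ‖F t‖ ^ 2) := by gcongr
    _ = _ := by ring

theorem continuous_inhomDeriv_right {h ξ l : ℝ} {F u : ℝ → Spinor} (hF : Continuous F)
    (hu : Continuous u) : Continuous (inhomDeriv h ξ l F u) := by
  have := (continuous_inhomDeriv (h := h) (l := l) (c := ξ) (hF.comp continuous_snd)
    (hu.comp continuous_snd)).comp (show Continuous fun t : ℝ => ((1 : ℝ), t) by fun_prop)
  simpa [Function.comp_def] using this

/-- The basic energy estimate for the fibered resolvent equation. -/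
theorem energy_estimate {δ h l : ℝ} (hδ : 0 < δ) (hh : 0 < h)
    (hd : ∀ ξ, defect δ h ξ l ≠ 0) (ξ : ℝ) {F : ℝ → Spinor} (hF : Continuous F) :
    (h ^ 2 * ∫ t in (-δ)..δ, ‖inhomDeriv h ξ l F (res δ h ξ l F) t‖ ^ 2) +
      (∫ t in (-δ)..δ, (ξ + t) ^ 2 * ‖res δ h ξ l F t‖ ^ 2) ≤
    (2 * l ^ 2 + h) * (∫ t in (-δ)..δ, ‖res δ h ξ l F t‖ ^ 2) +
      2 * ∫ t in (-δ)..δ, ‖F t‖ ^ 2 := by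
  have hle : -δ ≤ δ := by linarith
  set u := res δ h ξ l F
  set v := inhomDeriv h ξ l F u
  have hu : Continuous u := continuous_res_right hδ hh hd ξ hF
  have hv : Continuous v := continuous_inhomDeriv_right hF hu
  have hder : ∀ t ∈ Ioo (-δ) δ, HasDerivAt u (v t) t := fun t ht =>
    hasDerivAt_res hδ hh (hd ξ) hF ht
  have hid := integral_norm_sq_fiberExpr (h := h) (ξ := ξ) hδ hu.continuousOn hv.continuousOn hder
    (fiberBC_res hδ hh ξ l F)
  have ii : ∀ {f : ℝ → ℝ}, Continuous f → IntervalIntegrable f volume (-δ) δ := fun hf =>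
    hf.intervalIntegrable _ _
  have cu0 := continuous_spinor_apply hu 0
  have cu1 := continuous_spinor_apply hu 1
  have e1 : ∫ t in (-δ)..δ, ‖fiberExpr h ξ u v t‖ ^ 2 ≤
      2 * l ^ 2 * (∫ t in (-δ)..δ, ‖u t‖ ^ 2) + 2 * ∫ t in (-δ)..δ, ‖F t‖ ^ 2 := by
    rw [← intervalIntegral.integral_const_mul, ← intervalIntegral.integral_const_mul,
      ← intervalIntegral.integral_add (ii (by fun_prop)) (ii (by fun_prop))]
    simp only [v, fiberExpr_inhomDeriv hh]
    refine intervalIntegral.integral_mono_on hle (ii (by fun_prop)) (ii (by fun_prop))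
      fun t _ => ?_
    have n1 := norm_add_le ((l : ℂ) • u t) (F t)
    rw [norm_smul, Complex.norm_real, Real.norm_eq_abs] at n1
    calc ‖(l : ℂ) • u t + F t‖ ^ 2 ≤ (|l| * ‖u t‖ + ‖F t‖) ^ 2 := by gcongr
      _ ≤ 2 * (|l| * ‖u t‖) ^ 2 + 2 * ‖F t‖ ^ 2 := by
        nlinarith [sq_nonneg (|l| * ‖u t‖ - ‖F t‖)]
      _ = _ := by rw [mul_pow, sq_abs]; ring
  -- The indefinite term `h (‖u₂‖² - ‖u₁‖²)` is bounded below by `-h ‖u‖²`. This is where the `h` in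
  -- the final constant comes from.
  have e2 : (h ^ 2 * ∫ t in (-δ)..δ, ‖v t‖ ^ 2) +
      (∫ t in (-δ)..δ, (ξ + t) ^ 2 * ‖u t‖ ^ 2) - h * (∫ t in (-δ)..δ, ‖u t‖ ^ 2) ≤
      ∫ t in (-δ)..δ, (h ^ 2 * ‖v t‖ ^ 2 + (ξ + t) ^ 2 * ‖u t‖ ^ 2 +
        h * (‖u t 1‖ ^ 2 - ‖u t 0‖ ^ 2)) := by
    rw [← intervalIntegral.integral_const_mul, ← intervalIntegral.integral_const_mul,
      ← intervalIntegral.integral_add (ii (by fun_prop)) (ii (by fun_prop)),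
      ← intervalIntegral.integral_sub (ii (by fun_prop)) (ii (by fun_prop))]
    refine intervalIntegral.integral_mono_on hle (ii (by fun_prop)) (ii (by fun_prop))
      fun t _ => ?_
    rw [spinor_norm_sq (u t)]
    nlinarith [mul_nonneg hh.le (sq_nonneg ‖u t 1‖)]
  linarith

theorem exists_res_bound_L2 {δ h l : ℝ} (hδ : 0 < δ) (hh : 0 < h)
    (hd : ∀ ξ, defect δ h ξ l ≠ 0) :
    ∃ C, 0 ≤ C ∧ ∀ ξ, ∀ F : ℝ → Spinor, Continuous F →
      ∫ t in (-δ)..δ, ‖res δ h ξ l F t‖ ^ 2 ≤ C * ∫ t in (-δ)..δ, ‖F t‖ ^ 2 := by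
  have hle : -δ ≤ δ := by linarith
  -- Beyond this threshold `(ξ + t)² ≥ 1 + 2l² + h` on the interval, so the potential in the energy
  -- estimate absorbs `(2l² + h)‖u‖²` with one `‖u‖²` to spare. This leaves the constant `2`.
  obtain ⟨C, hC0, hC⟩ := exists_res_bound_of_abs_le hδ hh hd (δ + (1 + 2 * l ^ 2 + h))
  refine ⟨max C 2, hC0.trans (le_max_left _ _), fun ξ F hF => ?_⟩
  have hF0 : 0 ≤ ∫ t in (-δ)..δ, ‖F t‖ ^ 2 :=
    intervalIntegral.integral_nonneg hle fun _ _ => by positivity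
  rcases le_or_gt |ξ| (δ + (1 + 2 * l ^ 2 + h)) with hξ | hξ
  · exact (hC ξ hξ F hF).trans (mul_le_mul_of_nonneg_right (le_max_left _ _) hF0)
  · refine le_trans ?_ (mul_le_mul_of_nonneg_right (le_max_right C 2) hF0)
    have hE := energy_estimate hδ hh hd ξ hF
    have hu := continuous_res_right hδ hh hd ξ hF
    have h1 : (1 + 2 * l ^ 2 + h) * (∫ t in (-δ)..δ, ‖res δ h ξ l F t‖ ^ 2) ≤
        ∫ t in (-δ)..δ, (ξ + t) ^ 2 * ‖res δ h ξ l F t‖ ^ 2 := by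
      rw [← intervalIntegral.integral_const_mul]
      refine intervalIntegral.integral_mono_on hle
        (Continuous.intervalIntegrable (by fun_prop) _ _)
        (Continuous.intervalIntegrable (by fun_prop) _ _) fun t ht => ?_
      gcongr
      have h2 : 1 + 2 * l ^ 2 + h ≤ |ξ + t| := by
        have h3 := abs_sub_abs_le_abs_sub ξ (-t)
        rw [abs_neg, sub_neg_eq_add] at h3
        have h4 : |t| ≤ δ := abs_le.2 ⟨ht.1, ht.2⟩
        linarith
      rw [← sq_abs (ξ + t)]
      nlinarith [sq_nonneg l]
    have h5 : 0 ≤ h ^ 2 * ∫ t in (-δ)..δ, ‖inhomDeriv h ξ l F (res δ h ξ l F) t‖ ^ 2 :=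
      mul_nonneg (sq_nonneg h) (intervalIntegral.integral_nonneg hle fun _ _ => by positivity)
    linarith

/-- The fibered resolvents are bounded into the natural energy space, uniformly in the
frequency. -/
theorem exists_res_bound {δ h l : ℝ} (hδ : 0 < δ) (hh : 0 < h)
    (hd : ∀ ξ, defect δ h ξ l ≠ 0) :
    ∃ C, 0 ≤ C ∧ ∀ ξ, ∀ F : ℝ → Spinor, Continuous F →
      (∫ t in (-δ)..δ, ‖res δ h ξ l F t‖ ^ 2 ≤ C * ∫ t in (-δ)..δ, ‖F t‖ ^ 2) ∧
      (ξ ^ 2 * ∫ t in (-δ)..δ, ‖res δ h ξ l F t‖ ^ 2 ≤ C * ∫ t in (-δ)..δ, ‖F t‖ ^ 2) ∧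
      (∫ t in (-δ)..δ, ‖inhomDeriv h ξ l F (res δ h ξ l F) t‖ ^ 2 ≤
        C * ∫ t in (-δ)..δ, ‖F t‖ ^ 2) ∧
      ∀ t ∈ Icc (-δ) δ, ‖res δ h ξ l F t‖ ^ 2 ≤ C * ∫ t in (-δ)..δ, ‖F t‖ ^ 2 := by
  have hle : -δ ≤ δ := by linarith
  obtain ⟨C, hC0, hC⟩ := exists_res_bound_L2 hδ hh hd
  -- `C2` bounds the energy, `C3` uses `ξ² ≤ 2(ξ + t)² + 2δ²`, `C4` divides the derivative term by
  -- `h²`, and `C5` comes from the Sobolev inequality. Their sum with `C` serves all four estimates.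
  set C2 := (2 * l ^ 2 + h) * C + 2
  have hC2 : 0 ≤ C2 := by positivity
  set C3 := 2 * C2 + 2 * δ ^ 2 * C
  set C4 := C2 / h ^ 2
  set C5 := (1 / (2 * δ) + 1) * C + C4
  have n3 : 0 ≤ C3 := by positivity
  have n4 : 0 ≤ C4 := by positivity
  have n5 : 0 ≤ C5 := by positivity
  refine ⟨C + C3 + C4 + C5, by positivity, fun ξ F hF => ?_⟩
  set u := res δ h ξ l F
  set v := inhomDeriv h ξ l F u
  have hu : Continuous u := continuous_res_right hδ hh hd ξ hF
  have hv : Continuous v := continuous_inhomDeriv_right hF hu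
  set N := ∫ t in (-δ)..δ, ‖F t‖ ^ 2
  have hN : 0 ≤ N := intervalIntegral.integral_nonneg hle fun _ _ => by positivity
  have h1 := hC ξ F hF
  have hE := energy_estimate hδ hh hd ξ hF
  change h ^ 2 * (∫ t in (-δ)..δ, ‖v t‖ ^ 2) + (∫ t in (-δ)..δ, (ξ + t) ^ 2 * ‖u t‖ ^ 2) ≤
    (2 * l ^ 2 + h) * (∫ t in (-δ)..δ, ‖u t‖ ^ 2) + 2 * N at hE
  change ∫ t in (-δ)..δ, ‖u t‖ ^ 2 ≤ C * N at h1
  have hE2 : h ^ 2 * (∫ t in (-δ)..δ, ‖v t‖ ^ 2) + (∫ t in (-δ)..δ, (ξ + t) ^ 2 * ‖u t‖ ^ 2) ≤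
      C2 * N := by
    have := mul_le_mul_of_nonneg_left h1 (by positivity : 0 ≤ 2 * l ^ 2 + h)
    simp only [C2]
    linarith
  have hv0 : 0 ≤ ∫ t in (-δ)..δ, ‖v t‖ ^ 2 :=
    intervalIntegral.integral_nonneg hle fun _ _ => by positivity
  have hu0 : 0 ≤ ∫ t in (-δ)..δ, (ξ + t) ^ 2 * ‖u t‖ ^ 2 :=
    intervalIntegral.integral_nonneg hle fun _ _ => by positivity
  have h3 : ξ ^ 2 * (∫ t in (-δ)..δ, ‖u t‖ ^ 2) ≤ C3 * N := by
    have h3a : ξ ^ 2 * (∫ t in (-δ)..δ, ‖u t‖ ^ 2) ≤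
        2 * (∫ t in (-δ)..δ, (ξ + t) ^ 2 * ‖u t‖ ^ 2) +
          2 * δ ^ 2 * ∫ t in (-δ)..δ, ‖u t‖ ^ 2 := by
      rw [← intervalIntegral.integral_const_mul, ← intervalIntegral.integral_const_mul,
        ← intervalIntegral.integral_const_mul, ← intervalIntegral.integral_add
          (Continuous.intervalIntegrable (by fun_prop) _ _)
          (Continuous.intervalIntegrable (by fun_prop) _ _)]
      refine intervalIntegral.integral_mono_on hle
        (Continuous.intervalIntegrable (by fun_prop) _ _)
        (Continuous.intervalIntegrable (by fun_prop) _ _) fun t ht => ?_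
      have ht2 : t ^ 2 ≤ δ ^ 2 := sq_le_sq' ht.1 ht.2
      have : ξ ^ 2 ≤ 2 * (ξ + t) ^ 2 + 2 * δ ^ 2 := by
        nlinarith [sq_nonneg (ξ + 2 * t)]
      nlinarith [mul_le_mul_of_nonneg_right this (sq_nonneg ‖u t‖)]
    have := mul_le_mul_of_nonneg_left h1 (by positivity : 0 ≤ 2 * δ ^ 2)
    have h4 : 0 ≤ h ^ 2 * ∫ t in (-δ)..δ, ‖v t‖ ^ 2 := mul_nonneg (sq_nonneg h) hv0
    simp only [C3]
    linarith
  have h4 : (∫ t in (-δ)..δ, ‖v t‖ ^ 2) ≤ C4 * N := by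
    rw [div_mul_eq_mul_div, le_div_iff₀ (by positivity)]
    linarith
  have up : ∀ {x c : ℝ}, x ≤ c * N → c ≤ C + C3 + C4 + C5 → x ≤ (C + C3 + C4 + C5) * N :=
    fun hx hc => hx.trans (mul_le_mul_of_nonneg_right hc hN)
  refine ⟨up h1 (by linarith), up h3 (by linarith), up h4 (by linarith), fun t ht =>
    up (c := C5) ?_ (by linarith)⟩
  have h5 := norm_sq_le_of_hasDerivAt hδ hu.continuousOn hv.continuousOn
    (fun t ht => hasDerivAt_res hδ hh (hd ξ) hF ht) ht
  have h6 := mul_le_mul_of_nonneg_left h1 (by positivity : 0 ≤ 1 / (2 * δ) + 1)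
  simp only [C5]
  linarith

/-! ### Plancherel for integrable and square integrable functions -/

section Plancherel

open FourierTransform
open scoped SchwartzMap

theorem integral_fourierInv_smul_eq {g : ℝ → ℂ} {f : ℝ → Spinor} (hg : Integrable g)
    (hf : Integrable f) : ∫ x, 𝓕⁻ g x • f x = ∫ x, g x • 𝓕⁻ f x := by
  have h1 : ∫ x, 𝓕 (fun x => g (-x)) x • f x = ∫ x, g (-x) • 𝓕 f x := by
    simpa using! VectorFourier.integral_fourierIntegral_smul_eq_flip (L := innerₗ ℝ)
      Real.continuous_fourierChar continuous_inner hg.comp_neg hf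
  rw [Real.fourierInv_eq_fourier_comp_neg g, h1, ← integral_neg_eq_self]
  simp only [neg_neg, Real.fourierInv_eq_fourier_neg]

theorem continuous_fourierInv {f : ℝ → Spinor} (hf : Integrable f) : Continuous (𝓕⁻ f) := by
  rw [Real.fourierInv_eq_fourier_comp_neg]
  exact VectorFourier.fourierIntegral_continuous Real.continuous_fourierChar
    (by exact continuous_inner) hf.comp_neg

/-- The integral and the `L²` inverse transforms are compared by pairing with smooth compactly
supported functions, which are Schwartz. The `L²` transform is compatible with tempered
distributions, and the integral one satisfies the multiplication formula. -/
theorem fourierInv_ae_eq {f : ℝ → Spinor} (hf : Integrable f) (hf2 : MemLp f 2) :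
    𝓕⁻ f =ᵐ[volume] (𝓕⁻ (hf2.toLp f) : Lp (α := ℝ) Spinor 2 volume) := by
  set L : Lp (α := ℝ) Spinor 2 volume := 𝓕⁻ (hf2.toLp f)
  refine ae_eq_of_integral_contDiff_smul_eq (continuous_fourierInv hf).locallyIntegrable
    ((Lp.memLp L).locallyIntegrable (by norm_num)) fun g hg hgc => ?_
  have hg' : ContDiff ℝ ∞ fun x => (g x : ℂ) := Complex.ofRealCLM.contDiff.comp hg
  have hgc' : HasCompactSupport fun x => (g x : ℂ) := hgc.comp_left Complex.ofReal_zero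
  set G : 𝓢(ℝ, ℂ) := hgc'.toSchwartzMap hg'
  have hG : ∀ x, G x = (g x : ℂ) := fun x => rfl
  have e1 : ∫ x, G x • (L : ℝ → Spinor) x = ∫ x, (𝓕⁻ G) x • f x := by
    have h1 := congrArg (fun T => T G)
      (Lp.fourierInv_toTemperedDistribution_eq (hf2.toLp f))
    simp only [TemperedDistribution.fourierInv_apply, Lp.toTemperedDistribution_apply] at h1
    rw [← h1]
    refine integral_congr_ae ?_
    filter_upwards [hf2.coeFn_toLp] with x hx
    rw [hx]
  have e2 : ∫ x, (𝓕⁻ G) x • f x = ∫ x, G x • 𝓕⁻ f x := by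
    have := integral_fourierInv_smul_eq (g := G) G.integrable hf
    rw [← this, SchwartzMap.fourierInv_coe]
  rw [e2] at e1
  simp only [hG, Complex.coe_smul] at e1
  exact e1.symm

theorem eLpNorm_fourierInv {f : ℝ → Spinor} (hf : Integrable f) (hf2 : MemLp f 2) :
    eLpNorm (𝓕⁻ f) 2 volume = eLpNorm f 2 volume := by
  rw [eLpNorm_congr_ae (fourierInv_ae_eq hf hf2), ← eLpNorm_congr_ae hf2.coeFn_toLp,
    ← Lp.enorm_def, ← Lp.enorm_def]
  have : ‖(𝓕⁻ (hf2.toLp f) : Lp (α := ℝ) Spinor 2 volume)‖ = ‖hf2.toLp f‖ :=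
    (Lp.fourierTransformₗᵢ ℝ Spinor).symm.norm_map _
  rw [← ofReal_norm, ← ofReal_norm, this]

end Plancherel

/-! ### Partial Fourier synthesis on the strip -/

/-- The plane wave `e^{2πiks}`. -/
def wave (k s : ℝ) : ℂ := Complex.exp ((2 * Real.pi * (k * s) : ℝ) * Complex.I)

theorem norm_wave (k s : ℝ) : ‖wave k s‖ = 1 := Complex.norm_exp_ofReal_mul_I _

theorem continuous_wave : Continuous fun q : ℝ × ℝ => wave q.1 q.2 := by unfold wave; fun_prop

theorem hasDerivAt_wave (k s : ℝ) :
    HasDerivAt (wave k) (wave k s * (2 * Real.pi * k * Complex.I)) s := by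
  have h1 : HasDerivAt (fun s : ℝ => ((2 * Real.pi * (k * s) : ℝ) : ℂ) * Complex.I)
      (2 * Real.pi * k * Complex.I) s := by
    have := ((((hasDerivAt_id s).const_mul k).const_mul (2 * Real.pi)).ofReal_comp).mul_const
      Complex.I
    refine this.congr_deriv ?_
    push_cast
    ring
  exact h1.cexp

/-- The weight that controls symbols. -/
def decay (k : ℝ) : ℝ := (1 + k ^ 2)⁻¹

theorem decay_pos (k : ℝ) : 0 < decay k := by unfold decay; positivity

theorem integrable_decay : Integrable decay := integrable_inv_one_add_sq

theorem decay_le_one (k : ℝ) : decay k ≤ 1 := inv_le_one_of_one_le₀ (by nlinarith [sq_nonneg k])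

/-- Continuous symbols `b(k, t)` that decay like `(1 + k²)⁻¹`, uniformly in `t`. -/
structure IsSymbol (δ : ℝ) (b : ℝ × ℝ → Spinor) : Prop where
  cont : Continuous b
  bound : ∃ C, ∀ k, ∀ t ∈ Icc (-δ) δ, ‖b (k, t)‖ ≤ C * decay k

/-- The synthesis `(s, t) ↦ ∫ e^{2πiks} b(k, t) dk`. -/
def synth (δ : ℝ) (b : ℝ × ℝ → Spinor) (p : ℝ × ℝ) : Spinor :=
  ∫ k, wave k p.1 • b (k, clamp δ p.2)

namespace IsSymbol

variable {δ : ℝ} {b : ℝ × ℝ → Spinor}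

theorem continuous_slice (H : IsSymbol δ b) (k : ℝ) : Continuous fun t => b (k, t) :=
  H.cont.comp (by fun_prop)

theorem integrable_slice (hδ : 0 < δ) (H : IsSymbol δ b) (t : ℝ) :
    Integrable fun k => b (k, clamp δ t) := by
  obtain ⟨C, hC⟩ := H.bound
  refine (integrable_decay.const_mul C).mono' ?_ (Eventually.of_forall fun k =>
    hC k _ (clamp_mem hδ t))
  exact (H.cont.comp (by fun_prop : Continuous fun k : ℝ => (k, clamp δ t))).aestronglyMeasurable

theorem memLp_slice (hδ : 0 < δ) (H : IsSymbol δ b) (t : ℝ) :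
    MemLp (fun k => b (k, clamp δ t)) 2 := by
  obtain ⟨C, hC⟩ := H.bound
  have hm : Continuous fun k => b (k, clamp δ t) :=
    H.cont.comp (by fun_prop : Continuous fun k : ℝ => (k, clamp δ t))
  rw [memLp_two_iff_integrable_sq_norm hm.aestronglyMeasurable]
  refine (integrable_decay.const_mul (C ^ 2)).mono' (hm.norm.pow 2).aestronglyMeasurable
    (Eventually.of_forall fun k => ?_)
  have h1 := hC k _ (clamp_mem hδ t)
  rw [Real.norm_of_nonneg (by positivity)]
  calc ‖b (k, clamp δ t)‖ ^ 2 ≤ (C * decay k) ^ 2 := by gcongr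
    _ = C ^ 2 * (decay k * decay k) := by ring
    _ ≤ C ^ 2 * (1 * decay k) := by
      have := decay_le_one k
      have := (decay_pos k).le
      gcongr
    _ = C ^ 2 * decay k := by ring

theorem integrable_wave (hδ : 0 < δ) (H : IsSymbol δ b) (s t : ℝ) :
    Integrable fun k => wave k s • b (k, clamp δ t) := by
  refine (H.integrable_slice hδ t).mono ?_ (Eventually.of_forall fun k => ?_)
  · exact ((continuous_wave.comp (by fun_prop : Continuous fun k : ℝ => (k, s))).smul
      (H.cont.comp (by fun_prop : Continuous fun k : ℝ => (k, clamp δ t)))).aestronglyMeasurable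
  · rw [norm_smul, norm_wave, one_mul]

theorem continuous_synth (hδ : 0 < δ) (H : IsSymbol δ b) : Continuous (synth δ b) := by
  obtain ⟨C, hC⟩ := H.bound
  refine continuous_of_dominated (bound := fun k => C * decay k)
    (fun p => (H.integrable_wave hδ p.1 p.2).aestronglyMeasurable)
    (fun p => Eventually.of_forall fun k => ?_) (integrable_decay.const_mul C)
    (Eventually.of_forall fun k => ?_)
  · rw [norm_smul, norm_wave, one_mul]
    exact hC k _ (clamp_mem hδ _)
  · have hc := continuous_clamp δ
    exact (continuous_wave.comp (by fun_prop : Continuous fun p : ℝ × ℝ => (k, p.1))).smul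
      (H.cont.comp (by fun_prop : Continuous fun p : ℝ × ℝ => (k, clamp δ p.2)))

theorem synth_add (hδ : 0 < δ) (H : IsSymbol δ b) (H' : IsSymbol δ b') :
    synth δ (b + b') = synth δ b + synth δ b' := by
  ext1 p
  simp only [synth, Pi.add_apply, smul_add]
  exact integral_add (H.integrable_wave hδ _ _) (H'.integrable_wave hδ _ _)

theorem synth_eq_fourierInv (δ : ℝ) (b : ℝ × ℝ → Spinor) (s t : ℝ) :
    synth δ b (s, t) = FourierTransform.fourierInv (fun k => b (k, clamp δ t)) s := by
  rw [Real.fourierInv_eq', synth]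
  refine integral_congr_ae (Eventually.of_forall fun k => ?_)
  simp [wave, mul_comm s k]

/-- Plancherel on a horizontal line. -/
theorem eLpNorm_synth_line (hδ : 0 < δ) (H : IsSymbol δ b) (t : ℝ) :
    eLpNorm (fun s => synth δ b (s, t)) 2 volume =
      eLpNorm (fun k => b (k, clamp δ t)) 2 volume := by
  rw [← eLpNorm_fourierInv (H.integrable_slice hδ t) (H.memLp_slice hδ t)]
  congr 1
  ext1 s
  exact synth_eq_fourierInv δ b s t

theorem hasDerivAt_synth_fst (hδ : 0 < δ) (H : IsSymbol δ b)
    (H' : IsSymbol δ fun q => (2 * Real.pi * q.1 * Complex.I) • b q) (s t : ℝ) :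
    HasDerivAt (fun s => synth δ b (s, t))
      (synth δ (fun q => (2 * Real.pi * q.1 * Complex.I) • b q) (s, t)) s := by
  obtain ⟨C, hC⟩ := H'.bound
  have := hasDerivAt_integral_of_dominated_loc_of_deriv_le (𝕜 := ℝ) (μ := volume)
    (F := fun s k => wave k s • b (k, clamp δ t))
    (F' := fun s k => wave k s • (2 * Real.pi * k * Complex.I) • b (k, clamp δ t))
    (x₀ := s) (s := univ) (bound := fun k => C * decay k) univ_mem
    (Eventually.of_forall fun s => (H.integrable_wave hδ s t).aestronglyMeasurable)
    (H.integrable_wave hδ s t) (H'.integrable_wave hδ s t).aestronglyMeasurable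
    (Eventually.of_forall fun k s _ => ?_) (integrable_decay.const_mul C)
    (Eventually.of_forall fun k s _ => ?_)
  · exact this.2
  · rw [norm_smul, norm_wave, one_mul]
    exact hC k _ (clamp_mem hδ _)
  · rw [smul_smul]
    exact (hasDerivAt_wave k s).smul_const _

theorem hasDerivAt_synth_snd (hδ : 0 < δ) (H : IsSymbol δ b) (H' : IsSymbol δ b')
    (hd : ∀ k, ∀ t ∈ Ioo (-δ) δ, HasDerivAt (fun t => b (k, t)) (b' (k, t)) t) (s : ℝ) {t : ℝ}
    (ht : t ∈ Ioo (-δ) δ) :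
    HasDerivAt (fun t => synth δ b (s, t)) (synth δ b' (s, t)) t := by
  obtain ⟨C, hC⟩ := H'.bound
  have := hasDerivAt_integral_of_dominated_loc_of_deriv_le (𝕜 := ℝ) (μ := volume)
    (F := fun t k => wave k s • b (k, clamp δ t))
    (F' := fun t k => wave k s • b' (k, clamp δ t))
    (x₀ := t) (s := Ioo (-δ) δ) (bound := fun k => C * decay k) (isOpen_Ioo.mem_nhds ht)
    (Eventually.of_forall fun t => (H.integrable_wave hδ s t).aestronglyMeasurable)
    (H.integrable_wave hδ s t) (H'.integrable_wave hδ s t).aestronglyMeasurable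
    (Eventually.of_forall fun k t _ => ?_) (integrable_decay.const_mul C)
    (Eventually.of_forall fun k t ht => ?_)
  · exact this.2
  · rw [norm_smul, norm_wave, one_mul]
    exact hC k _ (clamp_mem hδ _)
  -- Near an interior point the clamp is the identity, so it does not affect the derivative.
  · rw [clamp_of_mem (Ioo_subset_Icc_self ht)]
    refine HasDerivAt.const_smul (wave k s) ?_
    refine (hd k t ht).congr_of_eventuallyEq ?_
    filter_upwards [isOpen_Ioo.mem_nhds ht] with t' ht'
    rw [clamp_of_mem (Ioo_subset_Icc_self ht')]

end IsSymbol

theorem synth_smul (δ : ℝ) (b : ℝ × ℝ → Spinor) (c : ℂ) : synth δ (c • b) = c • synth δ b := by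
  ext1 p
  simp only [synth, Pi.smul_apply, smul_comm _ c]
  exact integral_smul _ _

/-! ### Square integrals on the strip -/

theorem stripMeasure_eq_prod (δ : ℝ) :
    stripMeasure δ = (volume : Measure ℝ).prod (intervalMeasure δ) := by
  rw [stripMeasure, strip, Measure.volume_eq_prod, ← Measure.prod_restrict, Measure.restrict_univ]

theorem eLpNorm_two_sq {X : Type*} [MeasurableSpace X] (μ : Measure X) (f : X → Spinor) :
    eLpNorm f 2 μ ^ 2 = ∫⁻ x, ‖f x‖ₑ ^ 2 ∂μ := by
  have := eLpNorm_nnreal_pow_eq_lintegral (μ := μ) (f := f) (p := 2) (by norm_num)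
  simpa using this

theorem lintegral_sq_eq_ofReal {δ : ℝ} (hδ : 0 < δ) {f : ℝ → Spinor} (hf : Continuous f) :
    ∫⁻ t in Ioo (-δ) δ, ‖f t‖ₑ ^ 2 = ENNReal.ofReal (∫ t in (-δ)..δ, ‖f t‖ ^ 2) := by
  rw [intervalIntegral.integral_of_le (by linarith), integral_Ioc_eq_integral_Ioo,
    ofReal_integral_eq_lintegral_ofReal]
  · simp only [← ofReal_norm, ENNReal.ofReal_pow (norm_nonneg _)]
  · exact ((hf.norm.pow 2).integrableOn_Icc (a := -δ) (b := δ)).mono_set Ioo_subset_Icc_self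
  · exact Eventually.of_forall fun t => by positivity

/-- Plancherel on the strip. -/
theorem IsSymbol.eLpNorm_synth_sq {δ : ℝ} {b : ℝ × ℝ → Spinor} (hδ : 0 < δ) (H : IsSymbol δ b) :
    eLpNorm (synth δ b) 2 (stripMeasure δ) ^ 2 =
      ∫⁻ k, ∫⁻ t in Ioo (-δ) δ, ‖b (k, t)‖ₑ ^ 2 := by
  have hc := H.continuous_synth hδ
  have hb := H.cont
  have hm : Measurable fun p : ℝ × ℝ => ‖synth δ b p‖ₑ ^ 2 := by fun_prop
  have hm' : Measurable fun p : ℝ × ℝ => ‖b p‖ₑ ^ 2 := by fun_prop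
  -- Tonelli makes the longitudinal integral the inner one. Plancherel then applies on each line `t
  -- = const`.
  rw [eLpNorm_two_sq, stripMeasure_eq_prod, lintegral_prod_symm' _ hm,
    lintegral_lintegral_swap (f := fun k t => ‖b (k, t)‖ₑ ^ 2) hm'.aemeasurable]
  refine setLIntegral_congr_fun measurableSet_Ioo fun t ht => ?_
  have := congrArg (fun x => x ^ 2) (H.eLpNorm_synth_line hδ t)
  simp only [eLpNorm_two_sq] at this
  rw [clamp_of_mem (Ioo_subset_Icc_self ht)] at this
  exact this

/-- A slicewise bound of symbols gives a bound of the syntheses. -/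
theorem IsSymbol.eLpNorm_synth_le {δ : ℝ} {a b : ℝ × ℝ → Spinor} (hδ : 0 < δ)
    (Ha : IsSymbol δ a) (Hb : IsSymbol δ b) {C : ℝ} (hC : 0 ≤ C)
    (h : ∀ k, ∫ t in (-δ)..δ, ‖b (k, t)‖ ^ 2 ≤ C ^ 2 * ∫ t in (-δ)..δ, ‖a (k, t)‖ ^ 2) :
    eLpNorm (synth δ b) 2 (stripMeasure δ) ≤
      ENNReal.ofReal C * eLpNorm (synth δ a) 2 (stripMeasure δ) := by
  have key : ∀ k, ∫⁻ t in Ioo (-δ) δ, ‖b (k, t)‖ₑ ^ 2 ≤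
      ENNReal.ofReal C ^ 2 * ∫⁻ t in Ioo (-δ) δ, ‖a (k, t)‖ₑ ^ 2 := fun k => by
    rw [lintegral_sq_eq_ofReal hδ (Ha.continuous_slice k),
      lintegral_sq_eq_ofReal hδ (Hb.continuous_slice k),
      ← ENNReal.ofReal_pow hC, ← ENNReal.ofReal_mul (by positivity)]
    exact ENNReal.ofReal_le_ofReal (h k)
  refine (ENNReal.pow_le_pow_left_iff two_ne_zero).1 ?_
  have := Ha.cont
  have hm : Measurable fun p : ℝ × ℝ => ‖a p‖ₑ ^ 2 := by fun_prop
  rw [mul_pow, Ha.eLpNorm_synth_sq hδ, Hb.eLpNorm_synth_sq hδ, ← lintegral_const_mul _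
    hm.lintegral_prod_right']
  exact lintegral_mono key

/-- A pointwise bound of symbols gives a bound of the synthesis on a horizontal line. -/
theorem IsSymbol.eLpNorm_line_le {δ : ℝ} {a b : ℝ × ℝ → Spinor} (hδ : 0 < δ)
    (Ha : IsSymbol δ a) (Hb : IsSymbol δ b) {C : ℝ} (hC : 0 ≤ C) {τ : ℝ} (hτ : τ ∈ Icc (-δ) δ)
    (h : ∀ k, ‖b (k, τ)‖ ^ 2 ≤ C ^ 2 * ∫ t in (-δ)..δ, ‖a (k, t)‖ ^ 2) :
    eLpNorm (fun s => synth δ b (s, τ)) 2 volume ≤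
      ENNReal.ofReal C * eLpNorm (synth δ a) 2 (stripMeasure δ) := by
  have key : ∀ k, ‖b (k, clamp δ τ)‖ₑ ^ 2 ≤
      ENNReal.ofReal C ^ 2 * ∫⁻ t in Ioo (-δ) δ, ‖a (k, t)‖ₑ ^ 2 := fun k => by
    rw [lintegral_sq_eq_ofReal hδ (Ha.continuous_slice k),
      ← ENNReal.ofReal_pow hC, ← ENNReal.ofReal_mul (by positivity), ← ofReal_norm,
      ← ENNReal.ofReal_pow (norm_nonneg _), clamp_of_mem hτ]
    exact ENNReal.ofReal_le_ofReal (h k)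
  refine (ENNReal.pow_le_pow_left_iff two_ne_zero).1 ?_
  have := Ha.cont
  have hm : Measurable fun p : ℝ × ℝ => ‖a p‖ₑ ^ 2 := by fun_prop
  rw [mul_pow, Ha.eLpNorm_synth_sq hδ, Hb.eLpNorm_synth_line hδ, eLpNorm_two_sq,
    ← lintegral_const_mul _ hm.lintegral_prod_right']
  exact lintegral_mono key

theorem IsSymbol.memLp_synth {δ : ℝ} {b : ℝ × ℝ → Spinor} (hδ : 0 < δ) (H : IsSymbol δ b) :
    MemLp (synth δ b) 2 (stripMeasure δ) := by
  refine ⟨(H.continuous_synth hδ).aestronglyMeasurable, ?_⟩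
  obtain ⟨C, hC⟩ := H.bound
  refine (ENNReal.pow_lt_top_iff (n := 2)).1 ?_ |>.resolve_right two_ne_zero
  rw [H.eLpNorm_synth_sq hδ]
  have h1 : ∀ k, ∫⁻ t in Ioo (-δ) δ, ‖b (k, t)‖ₑ ^ 2 ≤
      ENNReal.ofReal (C ^ 2 * (2 * δ)) * ENNReal.ofReal (decay k) := fun k => by
    calc ∫⁻ t in Ioo (-δ) δ, ‖b (k, t)‖ₑ ^ 2
        ≤ ∫⁻ _ in Ioo (-δ) δ, ENNReal.ofReal (C ^ 2 * decay k) := by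
          refine setLIntegral_mono' measurableSet_Ioo fun t ht => ?_
          rw [← ofReal_norm, ← ENNReal.ofReal_pow (norm_nonneg _)]
          refine ENNReal.ofReal_le_ofReal ?_
          have h2 := hC k t (Ioo_subset_Icc_self ht)
          calc ‖b (k, t)‖ ^ 2 ≤ (C * decay k) ^ 2 := by gcongr
            _ = C ^ 2 * (decay k * decay k) := by ring
            _ ≤ C ^ 2 * (1 * decay k) := by
              have := decay_le_one k
              have := (decay_pos k).le
              gcongr
            _ = C ^ 2 * decay k := by ring
      _ = _ := by
        have := (decay_pos k).le
        rw [setLIntegral_const, Real.volume_Ioo, ← ENNReal.ofReal_mul (by positivity),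
          ← ENNReal.ofReal_mul (by positivity)]
        congr 1
        ring
  refine (lintegral_mono h1).trans_lt ?_
  have := integrable_decay
  rw [lintegral_const_mul' _ _ ENNReal.ofReal_ne_top]
  exact ENNReal.mul_lt_top ENNReal.ofReal_lt_top this.lintegral_lt_top

theorem IsSymbol.memLp_line {δ : ℝ} {b : ℝ × ℝ → Spinor} (hδ : 0 < δ) (H : IsSymbol δ b)
    (t : ℝ) : MemLp (fun s => synth δ b (s, t)) 2 := by
  refine ⟨((H.continuous_synth hδ).comp
    (by fun_prop : Continuous fun s : ℝ => (s, t))).aestronglyMeasurable, ?_⟩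
  rw [H.eLpNorm_synth_line hδ]
  exact (H.memLp_slice hδ t).2

/-! ### Functions on the strip that are differentiable in the classical sense -/

theorem hasDerivAt_test_fst {φ : ℝ × ℝ → ℝ} (hφ : ContDiff ℝ ∞ φ) (s t : ℝ) :
    HasDerivAt (fun s => φ (s, t)) (fderiv ℝ φ (s, t) (1, 0)) s :=
  ((hφ.differentiable (by simp)) (s, t)).hasFDerivAt.comp_hasDerivAt s
    ((hasDerivAt_id s).prodMk (hasDerivAt_const s t))

theorem hasDerivAt_test_snd {φ : ℝ × ℝ → ℝ} (hφ : ContDiff ℝ ∞ φ) (s t : ℝ) :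
    HasDerivAt (fun t => φ (s, t)) (fderiv ℝ φ (s, t) (0, 1)) t :=
  ((hφ.differentiable (by simp)) (s, t)).hasFDerivAt.comp_hasDerivAt t
    ((hasDerivAt_const t s).prodMk (hasDerivAt_id t))

/-- A test function supported in the open strip vanishes on both boundary lines, so the boundary
terms disappear. -/
theorem weak_t_of_green {δ : ℝ} {u ut : ℝ × ℝ → Spinor} {gp gm : ℝ → Spinor}
    (H : HasTraces δ u ut gp gm) : HasWeakDeriv δ (0, 1) u ut := by
  intro φ hφ hc hs
  have h0 : ∀ t, t ∉ Ioo (-δ) δ → ∀ s, φ (s, t) = 0 := fun t ht s =>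
    image_eq_zero_of_notMem_tsupport fun hp => ht (hs hp).2
  rw [H.green φ hφ hc]
  simp [h0 δ (by simp), h0 (-δ) (by simp)]

/-- Two-dimensional functions that are continuously differentiable up to the boundary belong to
`H¹`, and their traces are their boundary values. -/
theorem isH1Strip_hasTraces_of_hasDerivAt {δ : ℝ} (hδ : 0 < δ) {u us ut : ℝ × ℝ → Spinor}
    (cu : Continuous u) (cs : Continuous us) (ct : Continuous ut)
    (mu : MemLp u 2 (stripMeasure δ)) (ms : MemLp us 2 (stripMeasure δ))
    (mt : MemLp ut 2 (stripMeasure δ)) (mp : MemLp (fun s => u (s, δ)) 2)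
    (mm : MemLp (fun s => u (s, -δ)) 2)
    (ds : ∀ s t, HasDerivAt (fun s => u (s, t)) (us (s, t)) s)
    (dt : ∀ s, ∀ t ∈ Ioo (-δ) δ, HasDerivAt (fun t => u (s, t)) (ut (s, t)) t) :
    IsH1Strip δ u us ut ∧ HasTraces δ u ut (fun s => u (s, δ)) fun s => u (s, -δ) := by
  have hle : -δ ≤ δ := by linarith
  have hT : HasTraces δ u ut (fun s => u (s, δ)) fun s => u (s, -δ) := by
    refine ⟨mp, mm, fun φ hφ hc => ?_⟩
    have c1 := continuous_test_deriv hφ (0, 1)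
    have i1 := integrable_test c1 (hc.fderiv_apply ℝ (0, 1)) mu
    have i2 := integrable_test hφ.continuous hc mt
    have cl : ∀ a : ℝ, Continuous fun s => φ (s, a) := fun a => hφ.continuous.comp (by fun_prop)
    have ip := integrable_test (cl δ) (compact_test_line hc δ) mp
    have im := integrable_test (cl (-δ)) (compact_test_line hc (-δ)) mm
    rw [eq_sub_iff_add_eq, ← integral_add i1 i2, ← integral_sub ip im]
    have i3 : Integrable (fun p => fderiv ℝ φ p (0, 1) • u p + φ p • ut p) (stripMeasure δ) :=
      i1.add i2
    rw [stripMeasure_eq_prod] at i3 ⊢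
    rw [integral_prod _ i3]
    refine integral_congr_ae (Eventually.of_forall fun s => ?_)
    have e := hφ.continuous
    have l1 : Continuous fun t : ℝ => (s, t) := by fun_prop
    have key := intervalIntegral.integral_eq_sub_of_hasDerivAt_of_le hle
      (f := fun t => φ (s, t) • u (s, t))
      (f' := fun t => fderiv ℝ φ (s, t) (0, 1) • u (s, t) + φ (s, t) • ut (s, t))
      ((e.comp l1).smul (cu.comp l1)).continuousOn
      (fun t ht => by
        rw [add_comm]
        exact (hasDerivAt_test_snd hφ s t).smul (dt s t ht))
      (Continuous.intervalIntegrable (((c1.comp l1).smul (cu.comp l1)).add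
        ((e.comp l1).smul (ct.comp l1)) :) _ _)
    rw [intervalIntegral.integral_of_le hle, integral_Ioc_eq_integral_Ioo] at key
    exact key
  refine ⟨⟨mu, ms, mt, fun φ hφ hc _ => ?_, weak_t_of_green hT⟩, hT⟩
  have c1 := continuous_test_deriv hφ (1, 0)
  have i1 := integrable_test c1 (hc.fderiv_apply ℝ (1, 0)) mu
  have i2 := integrable_test hφ.continuous hc ms
  rw [eq_neg_iff_add_eq_zero, ← integral_add i1 i2]
  have i3 : Integrable (fun p => fderiv ℝ φ p (1, 0) • u p + φ p • us p) (stripMeasure δ) :=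
    i1.add i2
  rw [stripMeasure_eq_prod] at i3 ⊢
  rw [integral_prod_symm _ i3]
  refine integral_eq_zero_of_ae (Eventually.of_forall fun t => ?_)
  have l1 : Continuous fun s : ℝ => (s, t) := by fun_prop
  have cl : Continuous fun s => φ (s, t) := hφ.continuous.comp l1
  have k0 : HasCompactSupport fun s => φ (s, t) • u (s, t) :=
    (compact_test_line hc t).smul_right
  have k1 : HasCompactSupport fun s =>
      fderiv ℝ φ (s, t) (1, 0) • u (s, t) + φ (s, t) • us (s, t) :=
    ((compact_test_line (hc.fderiv_apply ℝ (1, 0)) t).smul_right).add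
      ((compact_test_line hc t).smul_right)
  refine integral_eq_zero_of_hasDerivAt_of_integrable (f := fun s => φ (s, t) • u (s, t))
    (fun s => ?_) (Continuous.integrable_of_hasCompactSupport ?_ k1)
    (Continuous.integrable_of_hasCompactSupport ?_ k0)
  · rw [add_comm]
    exact (hasDerivAt_test_fst hφ s t).smul (ds s t)
  · exact ((c1.comp l1).smul (cu.comp l1)).add (cl.smul (cs.comp l1))
  · exact cl.smul (cu.comp l1)

/-- A family of functions in the graph of the operator. -/
theorem mem_stripGraph {δ h : ℝ} {u us ut f : ℝ × ℝ → Spinor} {gp gm : ℝ → Spinor}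
    (H : IsH1Strip δ u us ut) (T : HasTraces δ u ut gp gm) (B : StripBC gp gm)
    (hf : MemLp f 2 (stripMeasure δ)) (e : f =ᵐ[stripMeasure δ] stripExpr h u us ut) :
    (H.memLp.toLp u, hf.toLp f) ∈ (stripDirac δ h).graph := by
  rw [stripDirac_graph]
  exact ⟨u, us, ut, gp, gm, H, T, B, H.memLp.coeFn_toLp, hf.coeFn_toLp.trans e⟩

/-! ### Points of the spectrum -/

/-- The dispersion curve takes all values above its infimum, and the infimum itself. -/
theorem exists_defect_eq_zero {δ h l : ℝ} (hδ : 0 < δ) (hh : 0 < h)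
    (hl : lambdaEss δ h ≤ l) : ∃ ξ, defect δ h ξ l = 0 := by
  have hl0 : 0 < l := (lambdaEss_pos hδ hh).trans_le hl
  have hbd : BddBelow (range fun ξ => mu1 δ ξ h) :=
    ⟨0, by rintro _ ⟨ξ, rfl⟩; exact (mu1_pos hδ hh ξ).le⟩
  rsuffices ⟨ξ, hξ⟩ : ∃ ξ, angle δ h ξ l δ = -(Real.pi / 4)
  · exact ⟨ξ, defect_eq_zero_of_angle hδ hξ⟩
  have hca : Continuous fun ξ => angle δ h ξ l δ :=
    (continuous_angle_right hδ hh).comp (by fun_prop : Continuous fun ξ : ℝ => (ξ, l))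
  rcases hl.eq_or_lt with rfl | hlt
  · -- minimizing sequence
    have hA : ∀ n : ℕ, ∃ ξ, mu1 δ ξ h < lambdaEss δ h + 1 / ((n : ℝ) + 1) := fun n => by
      refine exists_lt_of_ciInf_lt (f := fun ξ => mu1 δ ξ h) ?_
      have : (0 : ℝ) < 1 / ((n : ℝ) + 1) := by positivity
      change lambdaEss δ h < _
      linarith
    choose x hx using hA
    -- The coercivity `|ξ| - δ ≤ μ₁⁺` confines the minimizing sequence to a compact set. Joint
    -- continuity of the angle then passes the boundary condition to the limit, without continuity
    -- of `μ₁⁺` itself.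
    have hxb : ∀ n, x n ∈ Icc (-(lambdaEss δ h + 1 + δ)) (lambdaEss δ h + 1 + δ) := fun n => by
      have h1 := abs_sub_le_mu1 hδ hh (x n)
      have h2 := hx n
      have h3 : 1 / ((n : ℝ) + 1) ≤ 1 := by
        rw [div_le_one (by positivity)]
        linarith [(Nat.cast_nonneg n : (0 : ℝ) ≤ n)]
      exact abs_le.1 (by linarith)
    obtain ⟨ξ, -, φ, hφ, hlim⟩ := isCompact_Icc.tendsto_subseq hxb
    refine ⟨ξ, ?_⟩
    have hmu : Tendsto (fun n => mu1 δ (x (φ n)) h) atTop (𝓝 (lambdaEss δ h)) := by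
      refine tendsto_of_tendsto_of_tendsto_of_le_of_le tendsto_const_nhds
        (?_ : Tendsto (fun n : ℕ => lambdaEss δ h + 1 / ((φ n : ℝ) + 1)) atTop _)
        (fun n => ciInf_le hbd (x (φ n))) (fun n => (hx (φ n)).le)
      have := (tendsto_one_div_add_atTop_nhds_zero_nat (𝕜 := ℝ)).comp hφ.tendsto_atTop
      simpa using this.const_add (lambdaEss δ h)
    have := ((continuous_angle_right hδ hh).tendsto (ξ, lambdaEss δ h)).comp
      (hlim.prodMk_nhds hmu)
    refine tendsto_nhds_unique this (tendsto_const_nhds.congr fun n => ?_)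
    exact ((mu1_spec hδ hh (x (φ n))).2.1).symm
  · obtain ⟨ξ1, h1⟩ := exists_lt_of_ciInf_lt (f := fun ξ => mu1 δ ξ h) hlt
    have h2 := abs_sub_le_mu1 hδ hh (l + 1 + δ)
    rw [abs_of_nonneg (by linarith)] at h2
    -- Intermediate values in `ξ` at fixed `l`: at `ξ1` the final angle has already reached `-π/4`,
    -- while at `l + 1 + δ` coercivity gives `μ₁⁺ > l`, so it has not.
    have e1 : angle δ h ξ1 l δ ≤ -(Real.pi / 4) := by
      rw [← (mu1_spec hδ hh ξ1).2.1]
      exact angle_antitone hδ hh ξ1 h1.le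
    have e2 := (mu1_spec hδ hh (l + 1 + δ)).2.2 l hl0.le (by linarith)
    obtain ⟨ξ, -, hξ⟩ := intermediate_value_uIcc hca.continuousOn
      (mem_uIcc_of_le e1 e2.le)
    exact ⟨ξ, hξ⟩

/-- The profile `(1 + ε²s²)⁻¹` of an approximate eigenfunction. -/
def profile (ε s : ℝ) : ℝ := (1 + ε ^ 2 * s ^ 2)⁻¹

theorem profile_pos (ε s : ℝ) : 0 < profile ε s := by unfold profile; positivity

theorem continuous_profile (ε : ℝ) : Continuous (profile ε) := by
  unfold profile
  exact Continuous.inv₀ (by fun_prop) fun s => by positivity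

theorem hasDerivAt_profile (ε s : ℝ) :
    HasDerivAt (profile ε) (-(2 * ε ^ 2 * s * profile ε s ^ 2)) s := by
  have h0 : (1 + ε ^ 2 * s ^ 2) ≠ 0 := by positivity
  have := ((((hasDerivAt_id s).pow 2).const_mul (ε ^ 2)).const_add 1).inv (by simpa using h0)
  refine this.congr_deriv ?_
  simp only [profile, id]
  field_simp
  simp only [Pi.pow_apply, id]
  field_simp
  simp only [Nat.add_one_sub_one, pow_one, Nat.cast_ofNat]
  ring

/-- This is `2x ≤ 1 + x²` with `x = ε|s|`. The derivative is dominated pointwise by `ε` times the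
profile itself, so the error of the approximate eigenfunction needs no computation of norms. -/
theorem abs_deriv_profile_le {ε : ℝ} (hε : 0 < ε) (s : ℝ) :
    |-(2 * ε ^ 2 * s * profile ε s ^ 2)| ≤ ε * profile ε s := by
  have h0 : 0 < 1 + ε ^ 2 * s ^ 2 := by positivity
  have h1 : 2 * ε * |s| * profile ε s ≤ 1 := by
    rw [profile, ← div_eq_mul_inv, div_le_one h0]
    nlinarith [sq_nonneg (ε * |s| - 1), sq_abs s]
  have h2 := profile_pos ε s
  have h3 : |-(2 * ε ^ 2 * s * profile ε s ^ 2)| =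
      ε * profile ε s * (2 * ε * |s| * profile ε s) := by
    rw [abs_neg, abs_mul, abs_mul, abs_of_pos (by positivity : 0 < 2 * ε ^ 2),
      abs_of_pos (by positivity : 0 < profile ε s ^ 2)]
    ring
  rw [h3]
  exact mul_le_of_le_one_right (by positivity) h1

/-- The first Pauli matrix. -/
def spinorFlip (w : Spinor) : Spinor := !₂[w 1, w 0]

@[simp] theorem spinorFlip_zero (w : Spinor) : spinorFlip w 0 = w 1 := rfl

@[simp] theorem spinorFlip_one (w : Spinor) : spinorFlip w 1 = w 0 := rfl

theorem norm_spinorFlip (w : Spinor) : ‖spinorFlip w‖ = ‖w‖ := by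
  rw [← sq_eq_sq₀ (norm_nonneg _) (norm_nonneg _), spinor_norm_sq, spinor_norm_sq]
  simp [add_comm]

theorem continuous_spinorFlip : Continuous spinorFlip :=
  continuous_spinor (continuous_spinor_apply continuous_id 1)
    (continuous_spinor_apply continuous_id 0)

theorem memLp_tensor {𝕜 E : Type*} [NormedField 𝕜] [NormedAddCommGroup E] [NormedSpace 𝕜 E]
    {δ : ℝ} {g : ℝ → 𝕜} {w : ℝ → E} (hg : MemLp g 2) (hw : MemLp w 2 (intervalMeasure δ)) :
    MemLp (fun p : ℝ × ℝ => g p.1 • w p.2) 2 (stripMeasure δ) := by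
  rw [stripMeasure_eq_prod]
  have hm : AEStronglyMeasurable (fun p : ℝ × ℝ => g p.1 • w p.2)
      ((volume : Measure ℝ).prod (intervalMeasure δ)) :=
    hg.1.comp_fst.smul hw.1.comp_snd
  rw [memLp_two_iff_integrable_sq_norm hm]
  refine (((memLp_two_iff_integrable_sq_norm hg.1).1 hg).mul_prod
    ((memLp_two_iff_integrable_sq_norm hw.1).1 hw)).congr (Eventually.of_forall fun p => ?_)
  simp only [norm_smul, mul_pow]

theorem memLp_interval_of_continuous (δ : ℝ) {E : Type*} [NormedAddCommGroup E] {w : ℝ → E}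
    (hw : Continuous w) : MemLp w 2 (intervalMeasure δ) := by
  obtain ⟨B, hB⟩ := isCompact_Icc.exists_bound_of_continuousOn (s := Icc (-δ) δ) hw.continuousOn
  refine MemLp.of_bound hw.aestronglyMeasurable B ?_
  filter_upwards [ae_restrict_mem measurableSet_Ioo] with t ht
  exact hB t (Ioo_subset_Icc_self ht)

theorem memLp_of_norm_le_profile {ε C : ℝ} (hε : 0 < ε) {g : ℝ → ℂ} (hg : Continuous g)
    (hC : ∀ s, ‖g s‖ ≤ C * profile ε s) : MemLp g 2 := by
  have hp : Integrable (profile ε) := by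
    have := integrable_inv_one_add_sq.comp_mul_left' hε.ne'
    simpa only [mul_pow] using! this
  rw [memLp_two_iff_integrable_sq_norm hg.aestronglyMeasurable]
  refine (hp.const_mul (C ^ 2)).mono' (hg.norm.pow 2).aestronglyMeasurable
    (Eventually.of_forall fun s => ?_)
  have h1 : profile ε s ≤ 1 := inv_le_one_of_one_le₀ (by nlinarith [sq_nonneg (ε * s)])
  have h2 := (profile_pos ε s).le
  have h3 := hC s
  rw [Real.norm_of_nonneg (by positivity)]
  calc ‖g s‖ ^ 2 ≤ (C * profile ε s) ^ 2 := by gcongr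
    _ = C ^ 2 * (profile ε s * profile ε s) := by ring
    _ ≤ C ^ 2 * (1 * profile ε s) := by gcongr
    _ = C ^ 2 * profile ε s := by ring

theorem inhomDeriv_zero_eq (h ξ l : ℝ) (u : ℝ → Spinor) :
    inhomDeriv h ξ l 0 u = solDeriv h ξ l u := by
  ext1 t
  refine spinor_ext ?_ ?_ <;> simp [inhomDeriv, solDeriv]

/-- Approximate eigenfunctions on the strip, built from an eigenfunction on a fiber. -/
theorem exists_approx_eigenvector {δ h l ξ : ℝ} (hδ : 0 < δ) (hh : 0 < h)
    (hd : defect δ h ξ l = 0) {ε : ℝ} (hε : 0 < ε) :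
    ∃ x : (stripDirac δ h).domain, (x : L2Strip δ) ≠ 0 ∧
      ‖stripDirac δ h x - (l : ℂ) • (x : L2Strip δ)‖ ≤ h * ε * ‖(x : L2Strip δ)‖ := by
  -- The frequency is chosen such that `-ih∂ₛ` acts on the plane wave as multiplication by `ξ`.
  set k : ℝ := ξ / (2 * Real.pi * h) with hk
  have hkξ : 2 * Real.pi * k * h = ξ := by
    rw [hk]; field_simp
  set w := leftSpinor δ h ξ l
  have hw : Continuous w := continuous_leftSpinor hδ hh ξ l
  set w' := inhomDeriv h ξ l 0 w
  have hw' : Continuous w' := continuous_inhomDeriv_right continuous_const hw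
  have dw : ∀ t ∈ Ioo (-δ) δ, HasDerivAt w (w' t) t := fun t ht => by
    rw [show w' = _ from inhomDeriv_zero_eq h ξ l w]
    exact hasDerivAt_leftSpinor hδ hh ξ l ht
  have hwb : FiberBC δ w := fiberBC_leftSpinor hδ hh hd
  have hwe : ∀ t, fiberExpr h ξ w w' t = (l : ℂ) • w t := fun t => by
    rw [fiberExpr_inhomDeriv hh]; simp
  set dp : ℝ → ℝ := fun s => -(2 * ε ^ 2 * s * profile ε s ^ 2) with hdp
  have cp := continuous_profile ε
  have cdp : Continuous dp := by fun_prop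
  have cw : Continuous (wave k) :=
    continuous_wave.comp (by fun_prop : Continuous fun s : ℝ => (k, s))
  set g : ℝ → ℂ := fun s => (profile ε s : ℂ) * wave k s with hg
  set g₁ : ℝ → ℂ := fun s => (dp s : ℂ) * wave k s with hg₁
  set g' : ℝ → ℂ := fun s => g₁ s + g s * (2 * Real.pi * k * Complex.I) with hg'
  have cg : Continuous g := by fun_prop
  have cg₁ : Continuous g₁ := by fun_prop
  have cg' : Continuous g' := by fun_prop
  have dg : ∀ s, HasDerivAt g (g' s) s := fun s => by
    refine ((hasDerivAt_profile ε s).ofReal_comp.mul (hasDerivAt_wave k s)).congr_deriv ?_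
    simp only [hg', hg₁, hg, hdp]
    ring
  have ng : ∀ s, ‖g s‖ = profile ε s := fun s => by
    rw [norm_mul, norm_wave, mul_one, Complex.norm_real, Real.norm_of_nonneg (profile_pos ε s).le]
  have ng₁ : ∀ s, ‖g₁ s‖ ≤ ε * profile ε s := fun s => by
    rw [norm_mul, norm_wave, mul_one, Complex.norm_real]
    exact abs_deriv_profile_le hε s
  have mg : MemLp g 2 := memLp_of_norm_le_profile (C := 1) hε cg fun s => by rw [ng, one_mul]
  have mg₁ : MemLp g₁ 2 := memLp_of_norm_le_profile hε cg₁ ng₁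
  have mg' : MemLp g' 2 := mg₁.add (mg.mul_const _)
  set u : ℝ × ℝ → Spinor := fun p => g p.1 • w p.2 with hu
  have cu : Continuous u := (cg.comp continuous_fst).smul (hw.comp continuous_snd)
  have mu : MemLp u 2 (stripMeasure δ) := memLp_tensor mg (memLp_interval_of_continuous δ hw)
  have line : ∀ a, MemLp (fun s => u (s, a)) 2 := fun a => by
    refine MemLp.of_le_mul (c := ‖w a‖) mg (by fun_prop) (Eventually.of_forall fun s => ?_)
    rw [hu, norm_smul, mul_comm]
  obtain ⟨H, T⟩ := isH1Strip_hasTraces_of_hasDerivAt hδ cu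
    (us := fun p => g' p.1 • w p.2) (ut := fun p => g p.1 • w' p.2)
    ((cg'.comp continuous_fst).smul (hw.comp continuous_snd))
    ((cg.comp continuous_fst).smul (hw'.comp continuous_snd)) mu
    (memLp_tensor mg' (memLp_interval_of_continuous δ hw))
    (memLp_tensor mg (memLp_interval_of_continuous δ hw')) (line δ) (line (-δ))
    (fun s t => (dg s).smul_const (w t)) (fun s t ht => (dw t ht).const_smul (g s))
  have B : StripBC (fun s => u (s, δ)) fun s => u (s, -δ) := by
    refine ⟨Eventually.of_forall fun s => ?_, Eventually.of_forall fun s => ?_⟩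
    · simp only [hu, PiLp.smul_apply, hwb.1, smul_neg]
    · simp only [hu, PiLp.smul_apply, hwb.2]
  -- The only error is the term in which `-ih∂ₛ` hits the profile, and the operator exchanges the
  -- two components there.
  set r : ℝ × ℝ → Spinor := fun p => (-Complex.I * h * g₁ p.1) • spinorFlip (w p.2) with hr
  have cr : Continuous r := by
    have c0 : Continuous fun p : ℝ × ℝ => -Complex.I * h * g₁ p.1 := by fun_prop
    exact c0.smul (continuous_spinorFlip.comp (hw.comp continuous_snd))
  have hrle : ∀ p, ‖r p‖ ≤ h * ε * ‖u p‖ := fun p => by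
    rw [hr, hu, norm_smul, norm_smul, norm_mul, norm_mul, norm_neg, Complex.norm_I, one_mul, ng,
      Complex.norm_real, Real.norm_of_nonneg hh.le, norm_spinorFlip]
    have := ng₁ p.1
    calc h * ‖g₁ p.1‖ * ‖w p.2‖ ≤ h * (ε * profile ε p.1) * ‖w p.2‖ := by gcongr
      _ = _ := by ring
  have mr : MemLp r 2 (stripMeasure δ) :=
    MemLp.of_le_mul mu cr.aestronglyMeasurable (Eventually.of_forall hrle)
  have hG := mem_stripGraph (h := h) H T B ((mu.const_smul (l : ℂ)).add mr)
    (Eventually.of_forall fun p => by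
      have e := hwe p.2
      have e0 := congrArg (fun x : Spinor => x 0) e
      have e1 := congrArg (fun x : Spinor => x 1) e
      simp only [fiberExpr, spinor_zero, spinor_one, PiLp.smul_apply, smul_eq_mul] at e0 e1
      rw [← hkξ] at e0 e1
      push_cast at e0 e1
      refine spinor_ext ?_ ?_
      · simp only [stripExpr, hr, hu, hg', Pi.add_apply, Pi.smul_apply, PiLp.add_apply,
          PiLp.smul_apply, smul_eq_mul, spinor_zero, spinorFlip_zero]
        linear_combination (-g p.1) * e0 +
          (2 * Real.pi * k * h * g p.1 * w p.2 1) * Complex.I_sq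
      · simp only [stripExpr, hr, hu, hg', Pi.add_apply, Pi.smul_apply, PiLp.add_apply,
          PiLp.smul_apply, smul_eq_mul, spinor_one, spinorFlip_one]
        linear_combination (-g p.1) * e1 +
          (2 * Real.pi * k * h * g p.1 * w p.2 0) * Complex.I_sq)
  obtain ⟨x, hx1, hx2⟩ := (LinearPMap.mem_graph_iff _).1 hG
  simp only at hx1 hx2
  refine ⟨x, ?_, ?_⟩
  · rw [hx1]
    intro h0
    have h1 : u =ᵐ[volume.restrict (strip δ)] fun _ => 0 := by
      filter_upwards [mu.coeFn_toLp, Lp.coeFn_zero Spinor 2 (stripMeasure δ)] with p e1 e2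
      rw [← e1, h0, e2]
      rfl
    have h2 := Measure.eqOn_open_of_ae_eq h1 (isOpen_strip δ) cu.continuousOn continuousOn_const
    have h3 : EqOn w (fun _ => 0) (Ioo (-δ) δ) := fun t ht => by
      have := h2 (show ((0 : ℝ), t) ∈ strip δ from ⟨mem_univ _, ht⟩)
      have hg0 : g 0 ≠ 0 := by
        rw [← norm_pos_iff, ng]; exact profile_pos ε 0
      exact (smul_eq_zero.1 this).resolve_left hg0
    have h4 := h3.closure hw continuous_const
    rw [closure_Ioo (by linarith)] at h4
    exact leftSpinor_ne_zero hδ hh ξ l (h4 (left_mem_Icc.2 (by linarith)))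
  · rw [hx2, hx1]
    have e : MemLp.toLp _ ((mu.const_smul (l : ℂ)).add mr) - (l : ℂ) • mu.toLp u = mr.toLp r := by
      rw [MemLp.toLp_add (mu.const_smul (l : ℂ)) mr, MemLp.toLp_const_smul (l : ℂ) mu,
        add_sub_cancel_left]
    rw [e, Lp.norm_toLp, Lp.norm_toLp]
    have hb : 0 ≤ h * ε := by positivity
    have := eLpNorm_le_mul_eLpNorm_of_ae_le_mul (p := 2) (μ := stripMeasure δ)
      (Eventually.of_forall hrle)
    calc _ ≤ (ENNReal.ofReal (h * ε) * eLpNorm u 2 (stripMeasure δ)).toReal :=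
          ENNReal.toReal_mono (ENNReal.mul_ne_top ENNReal.ofReal_ne_top mu.2.ne) this
      _ = _ := by rw [ENNReal.toReal_mul, ENNReal.toReal_ofReal hb]

/-- A bounded inverse `R` would give `‖x‖ ≤ ‖R‖ h ε ‖x‖` for the approximate eigenvectors. The
choice of `ε` makes the factor less than one. -/
theorem mem_spectrum_of_defect_eq_zero {δ h l ξ : ℝ} (hδ : 0 < δ) (hh : 0 < h)
    (hd : defect δ h ξ l = 0) : (l : ℂ) ∈ spectrum (stripDirac δ h) := by
  rintro ⟨R, -, hR⟩
  set ε := 1 / (2 * h * (‖R‖ + 1))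
  have hR0 := norm_nonneg R
  have hε : 0 < ε := by positivity
  obtain ⟨x, hx0, hx⟩ := exists_approx_eigenvector hδ hh hd hε
  have h1 := R.le_opNorm (stripDirac δ h x - (l : ℂ) • (x : L2Strip δ))
  rw [hR x] at h1
  have h2 : 0 < ‖(x : L2Strip δ)‖ := norm_pos_iff.2 hx0
  have h3 : ‖R‖ * (h * ε) < 1 := by
    have : ‖R‖ * (h * ε) = ‖R‖ / (2 * (‖R‖ + 1)) := by
      simp only [ε]; field_simp
    rw [this, div_lt_one (by positivity)]
    linarith
  have h4 := mul_le_mul_of_nonneg_left hx hR0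
  nlinarith

/-! ### Totality of tensor products -/

/-- By linearity all polynomial pairings vanish. The Weierstrass theorem extends this to continuous
test functions, the error being controlled by the `L¹` norm of `v`. -/
theorem ae_eq_zero_of_moments {δ : ℝ} {v : ℝ → Spinor}
    (hv : Integrable v (intervalMeasure δ))
    (h : ∀ n : ℕ, ∫ t, t ^ n • v t ∂(intervalMeasure δ) = 0) : v =ᵐ[intervalMeasure δ] 0 := by
  have hb : ∀ f : ℝ → ℝ, Continuous f → Integrable (fun t => f t • v t) (intervalMeasure δ) := by
    intro f hf
    obtain ⟨C, hC⟩ := isCompact_Icc.exists_bound_of_continuousOn (s := Icc (-δ) δ) hf.continuousOn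
    refine hv.bdd_smul C hf.aestronglyMeasurable ?_
    filter_upwards [ae_restrict_mem measurableSet_Ioo] with t ht
    exact hC t (Ioo_subset_Icc_self ht)
  have hp : ∀ p : Polynomial ℝ, ∫ t, p.eval t • v t ∂(intervalMeasure δ) = 0 := by
    intro p
    induction p using Polynomial.induction_on' with
    | add p q hp hq =>
      simp only [Polynomial.eval_add, add_smul]
      rw [integral_add (hb _ p.continuous) (hb _ q.continuous), hp, hq, add_zero]
    | monomial n a =>
      simp only [Polynomial.eval_monomial, mul_smul]
      rw [integral_smul, h n, smul_zero]
  refine (ae_restrict_iff' measurableSet_Ioo).2 ?_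
  refine isOpen_Ioo.ae_eq_zero_of_integral_contDiff_smul_eq_zero
    (locallyIntegrableOn_of_locallyIntegrable_restrict hv.locallyIntegrable) fun g hg hc hs => ?_
  have e1 : ∫ t, g t • v t = ∫ t, g t • v t ∂(intervalMeasure δ) := by
    refine (setIntegral_eq_integral_of_forall_compl_eq_zero fun t ht => ?_).symm
    rw [image_eq_zero_of_notMem_tsupport fun h' => ht (hs h'), zero_smul]
  rw [e1, ← norm_le_zero_iff]
  have hv0 : 0 ≤ ∫ t, ‖v t‖ ∂(intervalMeasure δ) := integral_nonneg fun _ => norm_nonneg _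
  refine le_of_forall_pos_le_add fun ε hε => ?_
  set J := ∫ t, ‖v t‖ ∂(intervalMeasure δ)
  obtain ⟨p, hpg⟩ := exists_polynomial_near_of_continuousOn (-δ) δ g hg.continuous.continuousOn
    (ε / (J + 1)) (by positivity)
  have e2 : ∫ t, g t • v t ∂(intervalMeasure δ) =
      ∫ t, (g t - p.eval t) • v t ∂(intervalMeasure δ) := by
    simp only [sub_smul]
    rw [integral_sub (hb _ hg.continuous) (hb _ p.continuous), hp, sub_zero]
  rw [e2, zero_add]
  calc _ ≤ ∫ t, ε / (J + 1) * ‖v t‖ ∂(intervalMeasure δ) := by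
        refine norm_integral_le_of_norm_le (hv.norm.const_mul _) ?_
        filter_upwards [ae_restrict_mem measurableSet_Ioo] with t ht
        rw [norm_smul, Real.norm_eq_abs, abs_sub_comm]
        gcongr
        exact (hpg t (Ioo_subset_Icc_self ht)).le
    _ = ε * (J / (J + 1)) := by rw [integral_const_mul]; ring
    _ ≤ ε * 1 := by
        gcongr
        exact (div_le_one (by positivity)).2 (by linarith)
    _ = ε := mul_one ε

/-- For each `n` the transversal moment vanishes for almost every `s`. Using monomials in `t` keeps
the family countable, so one null set of `s` serves all moments, and almost every slice vanishes. -/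
theorem ae_eq_zero_of_tensor {δ : ℝ} {u : ℝ × ℝ → Spinor} (hm : StronglyMeasurable u)
    (hu : MemLp u 2 (stripMeasure δ))
    (h : ∀ φ : ℝ → ℝ, ContDiff ℝ ∞ φ → HasCompactSupport φ → ∀ n : ℕ,
      ∫ p, (φ p.1 * p.2 ^ n) • u p ∂(stripMeasure δ) = 0) :
    u =ᵐ[stripMeasure δ] 0 := by
  have h2 : Integrable (fun p => ‖u p‖ ^ 2) ((volume : Measure ℝ).prod (intervalMeasure δ)) := by
    rw [← stripMeasure_eq_prod]
    exact (memLp_two_iff_integrable_sq_norm hu.1).1 hu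
  have hslice : ∀ᵐ s, Integrable (fun t => u (s, t)) (intervalMeasure δ) := by
    filter_upwards [h2.prod_right_ae] with s hs
    have : MemLp (fun t => u (s, t)) 2 (intervalMeasure δ) :=
      (memLp_two_iff_integrable_sq_norm
        (hm.comp_measurable measurable_prodMk_left).aestronglyMeasurable).2 hs
    exact this.integrable (by norm_num)
  have htest : ∀ φ : ℝ → ℝ, Continuous φ → HasCompactSupport φ → ∀ n : ℕ,
      Integrable (fun p : ℝ × ℝ => (φ p.1 * p.2 ^ n) • u p)
        ((volume : Measure ℝ).prod (intervalMeasure δ)) := by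
    intro φ hφ hc n
    have ht : MemLp (fun p : ℝ × ℝ => φ p.1 * p.2 ^ n) 2 (stripMeasure δ) :=
      memLp_tensor (hφ.memLp_of_hasCompactSupport hc)
        (memLp_interval_of_continuous δ (continuous_pow n))
    rw [← stripMeasure_eq_prod]
    exact memLp_one_iff_integrable.1 (hu.smul ht)
  have hzero : ∀ n : ℕ, ∀ᵐ s, ∫ t, t ^ n • u (s, t) ∂(intervalMeasure δ) = 0 := by
    intro n
    refine ae_eq_zero_of_integral_contDiff_smul_eq_zero ?_ fun φ hφ hc => ?_
    · rw [locallyIntegrable_iff]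
      intro K hK
      obtain ⟨R, hR⟩ := hK.isBounded.subset_closedBall 0
      -- The moment is known to be integrable only after multiplication by a compactly supported
      -- function. This bump equals `1` on `K`.
      let φ : ContDiffBump (0 : ℝ) := ⟨|R| + 1, |R| + 2, by positivity, by linarith⟩
      have hi := (htest φ φ.continuous φ.hasCompactSupport n).integral_prod_left
      refine (hi.integrableOn (s := K)).congr_fun (fun s hs => ?_) hK.measurableSet
      have h1 : φ s = 1 := by
        refine φ.one_of_mem_closedBall ?_
        have := hR hs
        rw [mem_closedBall_zero_iff] at this ⊢
        exact this.trans ((le_abs_self R).trans (by simp [φ]))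
      simp only [h1, one_mul]
    · have := h φ hφ hc n
      rw [stripMeasure_eq_prod, integral_prod _ (htest φ hφ.continuous hc n)] at this
      rw [← this]
      refine integral_congr_ae (Eventually.of_forall fun s => ?_)
      simp only [mul_smul]
      rw [integral_smul]
  have hall : ∀ᵐ s, ∀ᵐ t ∂(intervalMeasure δ), u (s, t) = 0 := by
    filter_upwards [hslice, ae_all_iff.2 hzero] with s h1 h3
    exact ae_eq_zero_of_moments h1 h3
  rw [stripMeasure_eq_prod]
  exact (Measure.ae_prod_iff_ae_ae
    (measurableSet_eq_fun hm.measurable measurable_const)).2 hall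

theorem eq_zero_of_tensor {δ : ℝ} (u : L2Strip δ)
    (h : ∀ φ : ℝ → ℝ, ContDiff ℝ ∞ φ → HasCompactSupport φ → ∀ n : ℕ,
      ∫ p, (φ p.1 * p.2 ^ n) • u p ∂(stripMeasure δ) = 0) : u = 0 :=
  (Lp.eq_zero_iff_ae_eq_zero).2
    (ae_eq_zero_of_tensor (Lp.stronglyMeasurable u) (Lp.memLp u) h)

/-! ### The resolvent on the level of symbols -/

theorem pairLeft_add {δ h ξ l : ℝ} (hδ : 0 < δ) (hh : 0 < h) {F G : ℝ → Spinor}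
    (hF : Continuous F) (hG : Continuous G) (t : ℝ) :
    pairLeft δ h ξ l (F + G) t = pairLeft δ h ξ l F t + pairLeft δ h ξ l G t := by
  have hq : Continuous fun t : ℝ => (ξ, l, t) := by fun_prop
  have l1 := Complex.continuous_ofReal.comp ((continuous_left1 hδ hh).comp hq)
  have l2 := Complex.continuous_ofReal.comp ((continuous_left2 hδ hh).comp hq)
  have hc : ∀ F : ℝ → Spinor, Continuous F → Continuous fun τ =>
      (left1 δ h ξ l τ : ℂ) * F τ 0 + (left2 δ h ξ l τ : ℂ) * F τ 1 := fun F hF =>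
    (l1.mul (continuous_spinor_apply hF 0)).add (l2.mul (continuous_spinor_apply hF 1))
  rw [pairLeft, pairLeft, pairLeft, ← intervalIntegral.integral_add
    ((hc F hF).intervalIntegrable _ _) ((hc G hG).intervalIntegrable _ _)]
  congr 1
  ext1 τ
  simp only [Pi.add_apply, PiLp.add_apply]
  ring

theorem pairRight_add {δ h ξ l : ℝ} (hδ : 0 < δ) (hh : 0 < h) {F G : ℝ → Spinor}
    (hF : Continuous F) (hG : Continuous G) (t : ℝ) :
    pairRight δ h ξ l (F + G) t = pairRight δ h ξ l F t + pairRight δ h ξ l G t := by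
  have hq : Continuous fun t : ℝ => (ξ, l, t) := by fun_prop
  have r1 := Complex.continuous_ofReal.comp ((continuous_right1 hδ hh).comp hq)
  have r2 := Complex.continuous_ofReal.comp ((continuous_right2 hδ hh).comp hq)
  have hc : ∀ F : ℝ → Spinor, Continuous F → Continuous fun τ =>
      (right1 δ h ξ l τ : ℂ) * F τ 0 + (right2 δ h ξ l τ : ℂ) * F τ 1 := fun F hF =>
    (r1.mul (continuous_spinor_apply hF 0)).add (r2.mul (continuous_spinor_apply hF 1))
  rw [pairRight, pairRight, pairRight, ← intervalIntegral.integral_add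
    ((hc F hF).intervalIntegrable _ _) ((hc G hG).intervalIntegrable _ _)]
  congr 1
  ext1 τ
  simp only [Pi.add_apply, PiLp.add_apply]
  ring

theorem res_add {δ h ξ l : ℝ} (hδ : 0 < δ) (hh : 0 < h) {F G : ℝ → Spinor}
    (hF : Continuous F) (hG : Continuous G) :
    res δ h ξ l (F + G) = res δ h ξ l F + res δ h ξ l G := by
  ext1 t
  refine spinor_ext ?_ ?_
  all_goals
    simp only [res, Pi.add_apply, PiLp.add_apply, spinor_zero, spinor_one, Matrix.cons_val_zero,
      Matrix.cons_val_one, pairLeft_add hδ hh hF hG, pairRight_add hδ hh hF hG]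
    ring

theorem res_smul (δ h ξ l : ℝ) (c : ℂ) (F : ℝ → Spinor) :
    res δ h ξ l (c • F) = c • res δ h ξ l F := by
  have e1 : ∀ t, pairLeft δ h ξ l (c • F) t = c * pairLeft δ h ξ l F t := fun t => by
    rw [pairLeft, pairLeft, ← intervalIntegral.integral_const_mul]
    congr 1
    ext1 τ
    simp only [Pi.smul_apply, PiLp.smul_apply, smul_eq_mul]
    ring
  have e2 : ∀ t, pairRight δ h ξ l (c • F) t = c * pairRight δ h ξ l F t := fun t => by
    rw [pairRight, pairRight, ← intervalIntegral.integral_const_mul]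
    congr 1
    ext1 τ
    simp only [Pi.smul_apply, PiLp.smul_apply, smul_eq_mul]
    ring
  ext1 t
  refine spinor_ext ?_ ?_
  all_goals
    simp only [res, Pi.smul_apply, PiLp.smul_apply, smul_eq_mul, spinor_zero, spinor_one,
      Matrix.cons_val_zero, Matrix.cons_val_one, e1, e2]
    ring

/-- Continuous symbols that decay like `(1 + k²)⁻²`, uniformly in the transversal variable. -/
def rapidSymbol (δ : ℝ) : Submodule ℂ (ℝ × ℝ → Spinor) where
  carrier := {a | Continuous a ∧ ∃ C, ∀ k, ∀ t ∈ Icc (-δ) δ, ‖a (k, t)‖ ≤ C * decay k ^ 2}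
  zero_mem' := ⟨continuous_const, 0, by simp⟩
  add_mem' := by
    rintro a b ⟨ha, C, hC⟩ ⟨hb, C', hC'⟩
    refine ⟨ha.add hb, C + C', fun k t ht => ?_⟩
    rw [add_mul]
    exact (norm_add_le _ _).trans (add_le_add (hC k t ht) (hC' k t ht))
  smul_mem' := by
    rintro c a ⟨ha, C, hC⟩
    refine ⟨ha.const_smul c, ‖c‖ * C, fun k t ht => ?_⟩
    rw [Pi.smul_apply, norm_smul, mul_assoc]
    exact mul_le_mul_of_nonneg_left (hC k t ht) (norm_nonneg _)

theorem const_nonneg_of_bound {δ : ℝ} (hδ : 0 < δ) {a : ℝ × ℝ → Spinor} {C : ℝ}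
    (hC : ∀ k, ∀ t ∈ Icc (-δ) δ, ‖a (k, t)‖ ≤ C * decay k ^ 2) : 0 ≤ C := by
  have := (norm_nonneg _).trans (hC 0 0 ⟨by linarith, hδ.le⟩)
  have h1 := decay_pos 0
  exact nonneg_of_mul_nonneg_left this (by positivity)

theorem isSymbol_of_mem_rapidSymbol {δ : ℝ} (hδ : 0 < δ) {a : ℝ × ℝ → Spinor}
    (ha : a ∈ rapidSymbol δ) : IsSymbol δ a := by
  obtain ⟨hc, C, hC⟩ := ha
  refine ⟨hc, C, fun k t ht => (hC k t ht).trans ?_⟩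
  have h1 := decay_le_one k
  have h2 := decay_pos k
  refine mul_le_mul_of_nonneg_left ?_ (const_nonneg_of_bound hδ hC)
  nlinarith

theorem abs_mul_decay_le (k : ℝ) : |k| * decay k ≤ 1 := by
  rw [decay, ← div_eq_mul_inv, div_le_one (by positivity)]
  nlinarith [sq_nonneg (|k| - 1), sq_abs k, abs_nonneg k]

/-- Application of the fibered resolvents to a symbol. -/
def symbolRes (δ h l : ℝ) (a : ℝ × ℝ → Spinor) (q : ℝ × ℝ) : Spinor :=
  res δ h (2 * Real.pi * h * q.1) l (fun τ => a (q.1, τ)) q.2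

/-- The transversal derivative of `symbolRes`. -/
def symbolResDeriv (δ h l : ℝ) (a : ℝ × ℝ → Spinor) (q : ℝ × ℝ) : Spinor :=
  inhomDeriv h (2 * Real.pi * h * q.1) l (fun τ => a (q.1, τ))
    (fun τ => symbolRes δ h l a (q.1, τ)) q.2

/-- Multiplication of a symbol by the frequency. -/
def symbolFreq (a : ℝ × ℝ → Spinor) (q : ℝ × ℝ) : Spinor :=
  (2 * Real.pi * q.1 * Complex.I) • a q

section SymbolRes

variable {δ h l : ℝ}

/-- The uniform pointwise bound of the fibre resolvents by the transversal `L²` norm preserves the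
decay in `k`, with the factor `√(2δC)`. -/
theorem symbolRes_mem (hδ : 0 < δ) (hh : 0 < h) (hd : ∀ ξ, defect δ h ξ l ≠ 0)
    {a : ℝ × ℝ → Spinor} (ha : a ∈ rapidSymbol δ) : symbolRes δ h l a ∈ rapidSymbol δ := by
  obtain ⟨hc, A, hA⟩ := ha
  obtain ⟨C, hC0, hC⟩ := exists_res_bound hδ hh hd
  have hA0 := const_nonneg_of_bound hδ hA
  refine ⟨continuous_res hδ hh hd _ hc, √(2 * δ * C) * A, fun k t ht => ?_⟩
  have hs : Continuous fun τ => a (k, τ) := hc.comp (by fun_prop)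
  have h1 := (hC (2 * Real.pi * h * k) _ hs).2.2.2 t ht
  have h2 : ∫ t in (-δ)..δ, ‖a (k, t)‖ ^ 2 ≤ 2 * δ * (A * decay k ^ 2) ^ 2 := by
    calc ∫ t in (-δ)..δ, ‖a (k, t)‖ ^ 2 ≤ ∫ _ in (-δ)..δ, (A * decay k ^ 2) ^ 2 := by
          refine intervalIntegral.integral_mono_on (by linarith)
            ((hs.norm.pow 2).intervalIntegrable _ _) intervalIntegrable_const fun t ht => ?_
          have := hA k t ht
          gcongr
      _ = _ := by
        rw [intervalIntegral.integral_const, smul_eq_mul]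
        ring
  have h3 := decay_pos k
  refine le_of_sq_le_sq ?_ (by positivity)
  refine h1.trans ?_
  calc C * ∫ t in (-δ)..δ, ‖a (k, t)‖ ^ 2 ≤ C * (2 * δ * (A * decay k ^ 2) ^ 2) := by gcongr
    _ = (√(2 * δ * C) * A * decay k ^ 2) ^ 2 := by
      rw [mul_assoc (√_), mul_pow (√_), Real.sq_sqrt (by positivity)]
      ring

/-- One factor of `decay` absorbs the frequency, and one remains for integrability. This is why the
dense class is taken with two factors. -/
theorem isSymbol_symbolFreq (hδ : 0 < δ) {a : ℝ × ℝ → Spinor} (ha : a ∈ rapidSymbol δ) :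
    IsSymbol δ (symbolFreq a) := by
  obtain ⟨hc, A, hA⟩ := ha
  have hA0 := const_nonneg_of_bound hδ hA
  have hk : Continuous fun q : ℝ × ℝ => 2 * Real.pi * (q.1 : ℂ) * Complex.I := by fun_prop
  refine ⟨hk.smul hc, 2 * Real.pi * A, fun k t ht => ?_⟩
  have h1 := hA k t ht
  have h2 := abs_mul_decay_le k
  have h3 := decay_pos k
  have h4 := Real.pi_pos
  rw [symbolFreq, norm_smul]
  simp only [norm_mul, Complex.norm_I, Complex.norm_real, Complex.norm_ofNat, mul_one,
    Real.norm_eq_abs, abs_of_pos h4]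
  calc 2 * Real.pi * |k| * ‖a (k, t)‖ ≤ 2 * Real.pi * |k| * (A * decay k ^ 2) := by gcongr
    _ = 2 * Real.pi * A * decay k * (|k| * decay k) := by ring
    _ ≤ 2 * Real.pi * A * decay k * 1 := by gcongr
    _ = _ := mul_one _

theorem norm_spinor_apply_le (w : Spinor) (i : Fin 2) : ‖w i‖ ≤ ‖w‖ := PiLp.norm_apply_le w i

theorem norm_inhomDeriv_le (hh : 0 < h) (ξ : ℝ) (F u : ℝ → Spinor) (t : ℝ) :
    ‖inhomDeriv h ξ l F u t‖ ≤ 2 * ((|l| + |ξ + t|) * ‖u t‖ + ‖F t‖) / h := by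
  have u0 := norm_spinor_apply_le (u t) 0
  have u1 := norm_spinor_apply_le (u t) 1
  have f0 := norm_spinor_apply_le (F t) 0
  have f1 := norm_spinor_apply_le (F t) 1
  have e1 : ‖(l * u t 1 - ((ξ + t : ℝ) : ℂ) * u t 0 + F t 1) / h‖ ≤
      ((|l| + |ξ + t|) * ‖u t‖ + ‖F t‖) / h := by
    rw [norm_div, Complex.norm_real, Real.norm_of_nonneg hh.le]
    gcongr
    refine (norm_add_le _ _).trans (add_le_add ((norm_sub_le _ _).trans ?_) f1)
    rw [norm_mul, norm_mul, Complex.norm_real, Complex.norm_real, Real.norm_eq_abs,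
      Real.norm_eq_abs, add_mul]
    gcongr
  have e2 : ‖(((ξ + t : ℝ) : ℂ) * u t 1 - l * u t 0 - F t 0) / h‖ ≤
      ((|l| + |ξ + t|) * ‖u t‖ + ‖F t‖) / h := by
    rw [norm_div, Complex.norm_real, Real.norm_of_nonneg hh.le]
    gcongr
    refine (norm_sub_le _ _).trans (add_le_add ((norm_sub_le _ _).trans ?_) f0)
    rw [norm_mul, norm_mul, Complex.norm_real, Complex.norm_real, Real.norm_eq_abs,
      Real.norm_eq_abs, add_comm, add_mul]
    gcongr
  refine (norm_spinor_le _ _).trans ((add_le_add e1 e2).trans_eq ?_)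
  ring

/-- The fibre equation expresses the transversal derivative through `ξ + t` with `ξ = 2πhk`. This
linear growth in `k` costs one factor of `decay`. -/
theorem isSymbol_symbolResDeriv (hδ : 0 < δ) (hh : 0 < h) (hd : ∀ ξ, defect δ h ξ l ≠ 0)
    {a : ℝ × ℝ → Spinor} (ha : a ∈ rapidSymbol δ) : IsSymbol δ (symbolResDeriv δ h l a) := by
  obtain ⟨hcb, B, hB⟩ := symbolRes_mem hδ hh hd ha
  obtain ⟨hc, A, hA⟩ := ha
  have hA0 := const_nonneg_of_bound hδ hA
  have hB0 := const_nonneg_of_bound hδ hB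
  refine ⟨continuous_inhomDeriv hc hcb,
    2 * ((|l| + 2 * Real.pi * h + δ) * B + A) / h, fun k t ht => ?_⟩
  refine (norm_inhomDeriv_le hh _ _ _ _).trans ?_
  rw [div_mul_eq_mul_div]
  refine div_le_div_of_nonneg_right ?_ hh.le
  have h1 := hA k t ht
  have h2 := hB k t ht
  have h3 := decay_pos k
  have h4 := abs_mul_decay_le k
  have h5 := decay_le_one k
  have hp := Real.pi_pos
  have h6 : |2 * Real.pi * h * k + t| ≤ 2 * Real.pi * h * |k| + δ := by
    refine (abs_add_le _ _).trans (add_le_add ?_ (abs_le.2 ht))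
    rw [abs_mul, abs_of_pos (by positivity)]
  have h7 : (|l| + (2 * Real.pi * h * |k| + δ)) * decay k ≤ |l| + 2 * Real.pi * h + δ := by
    calc (|l| + (2 * Real.pi * h * |k| + δ)) * decay k
        = (|l| + δ) * decay k + 2 * Real.pi * h * (|k| * decay k) := by ring
      _ ≤ (|l| + δ) * 1 + 2 * Real.pi * h * 1 := by gcongr
      _ = _ := by ring
  calc 2 * ((|l| + |2 * Real.pi * h * k + t|) * ‖symbolRes δ h l a (k, t)‖ + ‖a (k, t)‖)
      ≤ 2 * ((|l| + (2 * Real.pi * h * |k| + δ)) * (B * decay k ^ 2) + A * decay k ^ 2) := by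
        gcongr
    _ = 2 * ((|l| + (2 * Real.pi * h * |k| + δ)) * decay k * B + A * decay k) * decay k := by ring
    _ ≤ 2 * ((|l| + 2 * Real.pi * h + δ) * B + A * 1) * decay k := by gcongr
    _ = _ := by ring

theorem symbolRes_add (hδ : 0 < δ) (hh : 0 < h) {a b : ℝ × ℝ → Spinor} (ha : Continuous a)
    (hb : Continuous b) : symbolRes δ h l (a + b) = symbolRes δ h l a + symbolRes δ h l b := by
  ext1 q
  have := res_add (ξ := 2 * Real.pi * h * q.1) (l := l) hδ hh
    (F := fun τ => a (q.1, τ)) (G := fun τ => b (q.1, τ)) (ha.comp (by fun_prop))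
    (hb.comp (by fun_prop))
  exact congrFun this q.2

theorem symbolRes_smul (c : ℂ) (a : ℝ × ℝ → Spinor) :
    symbolRes δ h l (c • a) = c • symbolRes δ h l a := by
  ext1 q
  exact congrFun (res_smul δ h (2 * Real.pi * h * q.1) l c fun τ => a (q.1, τ)) q.2

/-- `symbolRes` as a linear map. -/
def symbolResₗ (hδ : 0 < δ) (hh : 0 < h) (l : ℝ) : rapidSymbol δ →ₗ[ℂ] (ℝ × ℝ → Spinor) where
  toFun a := symbolRes δ h l a
  map_add' a b := symbolRes_add hδ hh a.2.1 b.2.1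
  map_smul' c a := symbolRes_smul c a

/-- `symbolFreq` after `symbolRes` as a linear map. -/
def symbolFreqₗ (hδ : 0 < δ) (hh : 0 < h) (l : ℝ) : rapidSymbol δ →ₗ[ℂ] (ℝ × ℝ → Spinor) where
  toFun a := symbolFreq (symbolRes δ h l a)
  map_add' a b := by
    rw [Submodule.coe_add, symbolRes_add hδ hh a.2.1 b.2.1]
    ext1 q
    simp only [symbolFreq, Pi.add_apply, smul_add]
  map_smul' c a := by
    rw [Submodule.coe_smul, symbolRes_smul]
    ext1 q
    simp only [symbolFreq, Pi.smul_apply, RingHom.id_apply]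
    exact smul_comm _ c _

/-- `symbolResDeriv` as a linear map. -/
def symbolResDerivₗ (hδ : 0 < δ) (hh : 0 < h) (l : ℝ) :
    rapidSymbol δ →ₗ[ℂ] (ℝ × ℝ → Spinor) where
  toFun a := symbolResDeriv δ h l a
  map_add' a b := by
    ext1 q
    simp only [symbolResDeriv, Submodule.coe_add, symbolRes_add hδ hh a.2.1 b.2.1]
    refine spinor_ext ?_ ?_
    all_goals
      simp only [symbolResDeriv, inhomDeriv, Pi.add_apply, PiLp.add_apply, spinor_zero, spinor_one,
        Matrix.cons_val_zero, Matrix.cons_val_one]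
      ring
  map_smul' c a := by
    ext1 q
    simp only [symbolResDeriv, Submodule.coe_smul, symbolRes_smul, RingHom.id_apply,
      Pi.smul_apply]
    refine spinor_ext ?_ ?_
    all_goals
      simp only [inhomDeriv, PiLp.smul_apply, smul_eq_mul,
        spinor_zero, spinor_one, Matrix.cons_val_zero, Matrix.cons_val_one]
      ring

/-- Synthesis as a map into `L²` of the strip. -/
def synthₗ (hδ : 0 < δ) (J : rapidSymbol δ →ₗ[ℂ] (ℝ × ℝ → Spinor))
    (hJ : ∀ a, IsSymbol δ (J a)) : rapidSymbol δ →ₗ[ℂ] L2Strip δ where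
  toFun a := ((hJ a).memLp_synth hδ).toLp _
  map_add' a b := by
    rw [← MemLp.toLp_add]
    refine MemLp.toLp_congr _ _ (Eventually.of_forall fun p => ?_)
    rw [map_add, (hJ a).synth_add hδ (hJ b)]
  map_smul' c a := by
    rw [RingHom.id_apply, ← MemLp.toLp_const_smul]
    refine MemLp.toLp_congr _ _ (Eventually.of_forall fun p => ?_)
    rw [map_smul, synth_smul]

/-- Synthesis on a horizontal line. -/
def lineₗ (hδ : 0 < δ) (t : ℝ) (J : rapidSymbol δ →ₗ[ℂ] (ℝ × ℝ → Spinor))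
    (hJ : ∀ a, IsSymbol δ (J a)) : rapidSymbol δ →ₗ[ℂ] Lp (α := ℝ) Spinor 2 volume where
  toFun a := ((hJ a).memLp_line hδ t).toLp _
  map_add' a b := by
    rw [← MemLp.toLp_add]
    refine MemLp.toLp_congr _ _ (Eventually.of_forall fun p => ?_)
    rw [map_add, (hJ a).synth_add hδ (hJ b)]
    rfl
  map_smul' c a := by
    rw [RingHom.id_apply, ← MemLp.toLp_const_smul]
    refine MemLp.toLp_congr _ _ (Eventually.of_forall fun p => ?_)
    rw [map_smul, synth_smul]
    rfl

end SymbolRes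

/-! ### Density of syntheses of rapidly decaying symbols -/

section Density

open FourierTransform
open scoped SchwartzMap

theorem exists_schwartz_decay (f : 𝓢(ℝ, ℂ)) : ∃ C, 0 ≤ C ∧ ∀ k, ‖f k‖ ≤ C * decay k ^ 2 := by
  obtain ⟨C0, h0, H0⟩ := f.decay 0 0
  obtain ⟨C4, h4, H4⟩ := f.decay 4 0
  -- Schwartz seminorms of orders 0 and 4 suffice, because `(1 + k²)² ≤ 2(1 + k⁴)`.
  refine ⟨2 * (C0 + C4), by positivity, fun k => ?_⟩
  have e0 := H0 k
  have e4 := H4 k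
  simp only [norm_iteratedFDeriv_zero, pow_zero, one_mul] at e0 e4
  rw [Real.norm_eq_abs, show |k| ^ 4 = (k ^ 2) ^ 2 by rw [← sq_abs k]; ring] at e4
  rw [decay, inv_pow, ← div_eq_mul_inv, le_div_iff₀ (by positivity)]
  nlinarith [norm_nonneg (f k), mul_nonneg (norm_nonneg (f k)) (sq_nonneg (k ^ 2 - 1))]

/-- Tensor products `φ(s) F(t)` are syntheses of rapidly decaying symbols. -/
theorem exists_symbol_tensor {φ : ℝ → ℝ} (hφ : ContDiff ℝ ∞ φ)
    (hc : HasCompactSupport φ) :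
    ∃ α : ℝ → ℂ, Continuous α ∧ (∃ C, 0 ≤ C ∧ ∀ k, ‖α k‖ ≤ C * decay k ^ 2) ∧
      ∀ s, ∫ k, wave k s * α k = φ s := by
  have hφ' : ContDiff ℝ ∞ fun x => (φ x : ℂ) := Complex.ofRealCLM.contDiff.comp hφ
  have hc' : HasCompactSupport fun x => (φ x : ℂ) := hc.comp_left Complex.ofReal_zero
  set G : 𝓢(ℝ, ℂ) := hc'.toSchwartzMap hφ'
  set A : 𝓢(ℝ, ℂ) := 𝓕 G with hA
  refine ⟨A, A.continuous, exists_schwartz_decay _, fun s => ?_⟩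
  have h1 : (𝓕⁻ A) s = (φ s : ℂ) := by
    rw [hA, FourierTransform.fourierInv_fourier_eq]
    rfl
  rw [SchwartzMap.fourierInv_coe, Real.fourierInv_eq'] at h1
  rw [← h1]
  refine integral_congr_ae (Eventually.of_forall fun k => ?_)
  simp [wave, mul_comm s k]

end Density

theorem synth_tensor (δ : ℝ) (α : ℝ → ℂ) (F : ℝ → Spinor) (s t : ℝ) :
    synth δ (fun q => α q.1 • F q.2) (s, t) = (∫ k, wave k s * α k) • F (clamp δ t) := by
  rw [synth, ← integral_smul_const]
  simp only [smul_smul]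

theorem tensor_mem_rapidSymbol {δ : ℝ} {α : ℝ → ℂ} {F : ℝ → Spinor} (hα : Continuous α)
    (hC : ∃ C, 0 ≤ C ∧ ∀ k, ‖α k‖ ≤ C * decay k ^ 2) (hF : Continuous F) :
    (fun q : ℝ × ℝ => α q.1 • F q.2) ∈ rapidSymbol δ := by
  obtain ⟨C, hC0, hC⟩ := hC
  obtain ⟨B, hB⟩ := isCompact_Icc.exists_bound_of_continuousOn (s := Icc (-δ) δ) hF.continuousOn
  refine ⟨(hα.comp continuous_fst).smul (hF.comp continuous_snd), C * B, fun k t ht => ?_⟩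
  have := decay_pos k
  calc ‖α k • F t‖ = ‖α k‖ * ‖F t‖ := norm_smul _ _
    _ ≤ (C * decay k ^ 2) * B := mul_le_mul (hC k) (hB t ht) (norm_nonneg _) (by positivity)
    _ = _ := by ring

/-- Synthesis of rapidly decaying symbols. -/
def synthBase {δ : ℝ} (hδ : 0 < δ) : rapidSymbol δ →ₗ[ℂ] L2Strip δ :=
  synthₗ hδ (rapidSymbol δ).subtype fun a => isSymbol_of_mem_rapidSymbol hδ a.2

theorem coeFn_synthBase {δ : ℝ} (hδ : 0 < δ) (a : rapidSymbol δ) :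
    synthBase hδ a =ᵐ[stripMeasure δ] synth δ a :=
  ((isSymbol_of_mem_rapidSymbol hδ a.2).memLp_synth hδ).coeFn_toLp

/-- The range contains `φ(s) tⁿ` times each basis vector, and these products are total by
`eq_zero_of_tensor`, so the orthogonal complement is trivial. -/
theorem denseRange_synthBase {δ : ℝ} (hδ : 0 < δ) : DenseRange (synthBase hδ) := by
  have key : (LinearMap.range (synthBase hδ))ᗮ = ⊥ := by
    rw [Submodule.eq_bot_iff]
    intro x hx
    refine eq_zero_of_tensor x fun φ hφ hc n => ?_
    obtain ⟨α, hα, hC, hs⟩ := exists_symbol_tensor hφ hc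
    have hm : MemLp (fun p : ℝ × ℝ => φ p.1 * p.2 ^ n) 2 (stripMeasure δ) :=
      memLp_tensor (hφ.continuous.memLp_of_hasCompactSupport hc)
        (memLp_interval_of_continuous δ (continuous_pow n))
    have hi : Integrable (fun p : ℝ × ℝ => (φ p.1 * p.2 ^ n) • x p) (stripMeasure δ) :=
      memLp_one_iff_integrable.1 ((Lp.memLp x).smul hm)
    ext i
    have e1 := (EuclideanSpace.proj (𝕜 := ℂ) i : Spinor →L[ℂ] ℂ).integral_comp_comm hi
    simp only [PiLp.proj_apply] at e1
    rw [← e1]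
    have hF : Continuous fun t : ℝ => ((t ^ n : ℝ) : ℂ) • (EuclideanSpace.single i 1 : Spinor) := by
      fun_prop
    set a : rapidSymbol δ := ⟨_, tensor_mem_rapidSymbol (δ := δ) hα hC hF⟩
    have h1 := hx (synthBase hδ a) (LinearMap.mem_range_self _ a)
    rw [L2.inner_def] at h1
    rw [PiLp.zero_apply, ← h1]
    refine integral_congr_ae ?_
    filter_upwards [coeFn_synthBase hδ a,
      ae_restrict_mem (isOpen_strip δ).measurableSet] with p hp hps
    have e3 : synth δ a p = (φ p.1 : ℂ) • ((p.2 ^ n : ℝ) : ℂ) • (EuclideanSpace.single i 1) := by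
      have := synth_tensor δ α
        (fun t => ((t ^ n : ℝ) : ℂ) • (EuclideanSpace.single i 1 : Spinor)) p.1 p.2
      rwa [hs, clamp_of_mem (Ioo_subset_Icc_self hps.2)] at this
    rw [hp, e3]
    -- The inner product conjugates its first argument, which is harmless because `φ(s) tⁿ` is real.
    simp only [smul_smul, inner_smul_left, EuclideanSpace.inner_single_left, PiLp.smul_apply]
    simp
  have h2 := Submodule.topologicalClosure_eq_top_iff.2 key
  have h3 := Submodule.dense_iff_topologicalClosure_eq_top.2 h2
  exact h3

/-- Each integral identity against a fixed test function is thereby a closed condition in `L²`. -/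
theorem continuous_integral_smul {X : Type*} [MeasurableSpace X] {μ : Measure X} {g : X → ℝ}
    (hg : MemLp g 2 μ) : Continuous fun u : Lp Spinor 2 μ => ∫ x, g x • u x ∂μ := by
  have := ((ContinuousLinearMap.lsmul ℝ ℝ : ℝ →L[ℝ] Spinor →L[ℝ] Spinor).lpPairing μ 2 2
    (hg.toLp g)).continuous
  refine this.congr fun u => ?_
  rw [ContinuousLinearMap.lpPairing_eq_integral]
  refine integral_congr_ae ?_
  filter_upwards [hg.coeFn_toLp] with x hx
  rw [hx]
  rfl

/-! ### The right inverse on the strip -/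

theorem HasWeakDeriv.congr {δ : ℝ} {e : ℝ × ℝ} {u v u' v' : ℝ × ℝ → Spinor}
    (H : HasWeakDeriv δ e u v) (hu : u' =ᵐ[stripMeasure δ] u) (hv : v' =ᵐ[stripMeasure δ] v) :
    HasWeakDeriv δ e u' v' := by
  intro φ hφ hc hs
  have e1 : ∫ p, fderiv ℝ φ p e • u' p ∂(stripMeasure δ) =
      ∫ p, fderiv ℝ φ p e • u p ∂(stripMeasure δ) :=
    integral_congr_ae (by filter_upwards [hu] with p hp; rw [hp])
  have e2 : ∫ p, φ p • v' p ∂(stripMeasure δ) = ∫ p, φ p • v p ∂(stripMeasure δ) :=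
    integral_congr_ae (by filter_upwards [hv] with p hp; rw [hp])
  rw [e1, e2, H φ hφ hc hs]

/-- `spinorFlip` as a continuous linear map. -/
def flipL : Spinor →L[ℂ] Spinor :=
  LinearMap.toContinuousLinearMap
    { toFun := spinorFlip
      map_add' := fun x y => by ext i; fin_cases i <;> rfl
      map_smul' := fun c x => by ext i; fin_cases i <;> rfl }

theorem flipL_apply (w : Spinor) : flipL w = spinorFlip w := rfl

/-- The coefficient of the transversal derivative in the Dirac operator. -/
def transL (h : ℝ) : Spinor →L[ℂ] Spinor :=
  LinearMap.toContinuousLinearMap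
    { toFun := fun w => !₂[-h * w 1, h * w 0]
      map_add' := fun x y => by ext i; fin_cases i <;> simp <;> ring
      map_smul' := fun c x => by ext i; fin_cases i <;> simp <;> ring }

theorem transL_apply (h : ℝ) (w : Spinor) : transL h w = !₂[-h * w 1, h * w 0] := rfl

theorem stripExpr_eq (h : ℝ) (u us ut : ℝ × ℝ → Spinor) (p : ℝ × ℝ) :
    stripExpr h u us ut p =
      (-Complex.I * h) • flipL (us p) + transL h (ut p) + p.2 • flipL (u p) := by
  refine spinor_ext ?_ ?_
  all_goals
    simp only [stripExpr, flipL_apply, transL_apply, PiLp.add_apply, PiLp.smul_apply, smul_eq_mul,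
      spinor_zero, spinor_one, spinorFlip_zero, spinorFlip_one, Complex.real_smul,
      Matrix.cons_val_zero, Matrix.cons_val_one]
    try ring

theorem memLp_coord_two (δ : ℝ) : MemLp (fun p : ℝ × ℝ => p.2) ⊤ (stripMeasure δ) := by
  refine memLp_top_of_bound (by fun_prop) δ ?_
  filter_upwards [ae_restrict_mem (isOpen_strip δ).measurableSet] with p hp
  exact (abs_lt.2 hp.2).le

/-- The differential expression on the level of `L²`. -/
theorem exists_continuous_expr (δ h : ℝ) :
    ∃ E : L2Strip δ × L2Strip δ × L2Strip δ → L2Strip δ, Continuous E ∧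
      ∀ u us ut, E (u, us, ut) =ᵐ[stripMeasure δ] stripExpr h u us ut := by
  set μ := stripMeasure δ
  set M := (ContinuousLinearMap.lsmul ℝ ℝ : ℝ →L[ℝ] Spinor →L[ℝ] Spinor).holderL μ ⊤ 2 2
    ((memLp_coord_two δ).toLp _)
  refine ⟨fun q => (-Complex.I * h) • flipL.compLpL 2 μ q.2.1 + (transL h).compLpL 2 μ q.2.2 +
    M (flipL.compLpL 2 μ q.1), by fun_prop, fun u us ut => ?_⟩
  filter_upwards [Lp.coeFn_add ((-Complex.I * h) • flipL.compLpL 2 μ us +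
      (transL h).compLpL 2 μ ut) (M (flipL.compLpL 2 μ u)),
    Lp.coeFn_add ((-Complex.I * h) • flipL.compLpL 2 μ us) ((transL h).compLpL 2 μ ut),
    Lp.coeFn_smul (-Complex.I * h) (flipL.compLpL 2 μ us), flipL.coeFn_compLpL (p := 2) us,
    (transL h).coeFn_compLpL (p := 2) ut, flipL.coeFn_compLpL (p := 2) u,
    (memLp_coord_two δ).coeFn_toLp,
    (ContinuousLinearMap.lsmul ℝ ℝ : ℝ →L[ℝ] Spinor →L[ℝ] Spinor).coeFn_holder (r := 2)
      ((memLp_coord_two δ).toLp _) (flipL.compLpL 2 μ u)] with p e1 e2 e3 e4 e5 e6 e7 e8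
  rw [stripExpr_eq, e1, Pi.add_apply, e2, Pi.add_apply, e3, Pi.smul_apply, e4, e5]
  congr 1
  refine e8.trans ?_
  rw [e6, e7]
  rfl

/-! ### Intertwining relation and norm bounds for syntheses -/

section Extension

variable {δ h l : ℝ}

theorem synth_apply (hδ : 0 < δ) {b : ℝ × ℝ → Spinor} (H : IsSymbol δ b) (p : ℝ × ℝ) (i : Fin 2) :
    synth δ b p i = ∫ k, wave k p.1 * b (k, clamp δ p.2) i := by
  have := (EuclideanSpace.proj (𝕜 := ℂ) i : Spinor →L[ℂ] ℂ).integral_comp_comm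
    (H.integrable_wave hδ p.1 p.2)
  simp only [PiLp.proj_apply, PiLp.smul_apply, smul_eq_mul] at this
  exact this.symm

/-- Synthesis intertwines the strip operator with its fibers. -/
theorem stripExpr_synth (hδ : 0 < δ) (hh : 0 < h) (hd : ∀ ξ, defect δ h ξ l ≠ 0)
    {a : ℝ × ℝ → Spinor} (ha : a ∈ rapidSymbol δ) {p : ℝ × ℝ} (hp : p ∈ strip δ) :
    stripExpr h (synth δ (symbolRes δ h l a)) (synth δ (symbolFreq (symbolRes δ h l a)))
      (synth δ (symbolResDeriv δ h l a)) p =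
      (l : ℂ) • synth δ (symbolRes δ h l a) p + synth δ a p := by
  have hR := symbolRes_mem hδ hh hd ha
  have S0 := (isSymbol_of_mem_rapidSymbol hδ hR).integrable_wave hδ p.1 p.2
  have S1 := (isSymbol_symbolFreq hδ hR).integrable_wave hδ p.1 p.2
  have S2 := (isSymbol_symbolResDeriv hδ hh hd ha).integrable_wave hδ p.1 p.2
  have Sa := (isSymbol_of_mem_rapidSymbol hδ ha).integrable_wave hδ p.1 p.2
  have i0 : Integrable fun k => p.2 • flipL (wave k p.1 • symbolRes δ h l a (k, clamp δ p.2)) :=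
    (flipL.integrable_comp S0).smul p.2
  have i1 : Integrable fun k => (-Complex.I * h) • flipL (wave k p.1 •
      symbolFreq (symbolRes δ h l a) (k, clamp δ p.2)) :=
    (flipL.integrable_comp S1).smul (-Complex.I * (h : ℂ))
  have i2 := (transL h).integrable_comp S2
  have i4 : Integrable fun k => (-Complex.I * h) • flipL (wave k p.1 •
      symbolFreq (symbolRes δ h l a) (k, clamp δ p.2)) +
      transL h (wave k p.1 • symbolResDeriv δ h l a (k, clamp δ p.2)) := i1.add i2
  have i3 : Integrable fun k => (l : ℂ) • wave k p.1 • symbolRes δ h l a (k, clamp δ p.2) :=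
    S0.smul (l : ℂ)
  rw [stripExpr_eq]
  unfold synth
  rw [← ContinuousLinearMap.integral_comp_comm _ S1, ← ContinuousLinearMap.integral_comp_comm _ S2,
    ← ContinuousLinearMap.integral_comp_comm _ S0, ← integral_smul, ← integral_smul,
    ← integral_smul, ← integral_add i1 i2, ← integral_add i4 i0, ← integral_add i3 Sa]
  · refine integral_congr_ae (Eventually.of_forall fun k => ?_)
    -- For `ξ = 2πhk` the integrand of the claim is the fibre equation multiplied by the plane wave,
    -- since `-ih · 2πik = 2πhk`.
    have e := fiberExpr_inhomDeriv (ξ := 2 * Real.pi * h * k) (l := l) hh (fun τ => a (k, τ))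
      (fun τ => symbolRes δ h l a (k, τ)) p.2
    have e0 := congrArg (fun x : Spinor => x 0) e
    have e1 := congrArg (fun x : Spinor => x 1) e
    simp only [fiberExpr, spinor_zero, spinor_one, PiLp.smul_apply, smul_eq_mul,
      PiLp.add_apply] at e0 e1
    push_cast at e0 e1
    rw [clamp_of_mem (Ioo_subset_Icc_self hp.2)]
    refine spinor_ext ?_ ?_
    · simp only [symbolFreq, symbolResDeriv, flipL_apply, transL_apply, PiLp.add_apply,
        PiLp.smul_apply, smul_eq_mul, spinorFlip_zero, Complex.real_smul, Matrix.cons_val_zero]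
      linear_combination (wave k p.1) * e0 -
        (2 * Real.pi * h * k * wave k p.1 * symbolRes δ h l a (k, p.2) 1) * Complex.I_sq
    · simp only [symbolFreq, symbolResDeriv, flipL_apply, transL_apply, PiLp.add_apply,
        PiLp.smul_apply, smul_eq_mul, spinorFlip_one, Complex.real_smul, Matrix.cons_val_one,
        Matrix.cons_val_zero]
      linear_combination (wave k p.1) * e1 -
        (2 * Real.pi * h * k * wave k p.1 * symbolRes δ h l a (k, p.2) 0) * Complex.I_sq

theorem norm_synthₗ_le (hδ : 0 < δ) (J : rapidSymbol δ →ₗ[ℂ] (ℝ × ℝ → Spinor))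
    (hJ : ∀ a, IsSymbol δ (J a)) {C : ℝ} (hC : 0 ≤ C)
    (h : ∀ (a : rapidSymbol δ) (k : ℝ), ∫ t in (-δ)..δ, ‖J a (k, t)‖ ^ 2 ≤
      C ^ 2 * ∫ t in (-δ)..δ, ‖(a : ℝ × ℝ → Spinor) (k, t)‖ ^ 2) (a : rapidSymbol δ) :
    ‖synthₗ hδ J hJ a‖ ≤ C * ‖synthBase hδ a‖ := by
  have ha := isSymbol_of_mem_rapidSymbol hδ a.2
  have := ha.eLpNorm_synth_le hδ (hJ a) hC (h a)
  have e1 : ‖synthₗ hδ J hJ a‖ = (eLpNorm (synth δ (J a)) 2 (stripMeasure δ)).toReal :=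
    Lp.norm_toLp _ ((hJ a).memLp_synth hδ)
  have e2 : ‖synthBase hδ a‖ = (eLpNorm (synth δ a) 2 (stripMeasure δ)).toReal :=
    Lp.norm_toLp _ (ha.memLp_synth hδ)
  rw [e1, e2]
  calc _ ≤ (ENNReal.ofReal C * eLpNorm (synth δ a) 2 (stripMeasure δ)).toReal :=
        ENNReal.toReal_mono (ENNReal.mul_ne_top ENNReal.ofReal_ne_top (ha.memLp_synth hδ).2.ne) this
    _ = _ := by rw [ENNReal.toReal_mul, ENNReal.toReal_ofReal hC]

theorem norm_lineₗ_le (hδ : 0 < δ) {τ : ℝ} (hτ : τ ∈ Icc (-δ) δ)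
    (J : rapidSymbol δ →ₗ[ℂ] (ℝ × ℝ → Spinor)) (hJ : ∀ a, IsSymbol δ (J a)) {C : ℝ} (hC : 0 ≤ C)
    (h : ∀ (a : rapidSymbol δ) (k : ℝ), ‖J a (k, τ)‖ ^ 2 ≤
      C ^ 2 * ∫ t in (-δ)..δ, ‖(a : ℝ × ℝ → Spinor) (k, t)‖ ^ 2) (a : rapidSymbol δ) :
    ‖lineₗ hδ τ J hJ a‖ ≤ C * ‖synthBase hδ a‖ := by
  have ha := isSymbol_of_mem_rapidSymbol hδ a.2
  have := ha.eLpNorm_line_le hδ (hJ a) hC hτ (h a)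
  have e1 : ‖lineₗ hδ τ J hJ a‖ = (eLpNorm (fun s => synth δ (J a) (s, τ)) 2 volume).toReal :=
    Lp.norm_toLp _ ((hJ a).memLp_line hδ τ)
  have e2 : ‖synthBase hδ a‖ = (eLpNorm (synth δ a) 2 (stripMeasure δ)).toReal :=
    Lp.norm_toLp _ (ha.memLp_synth hδ)
  rw [e1, e2]
  calc _ ≤ (ENNReal.ofReal C * eLpNorm (synth δ a) 2 (stripMeasure δ)).toReal :=
        ENNReal.toReal_mono (ENNReal.mul_ne_top ENNReal.ofReal_ne_top (ha.memLp_synth hδ).2.ne) this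
    _ = _ := by rw [ENNReal.toReal_mul, ENNReal.toReal_ofReal hC]

end Extension

/-- The set is the kernel of the continuous map that `B` induces on `L²`. -/
theorem isClosed_ae_eq_zero {X : Type*} [MeasurableSpace X] (μ : Measure X)
    (B : Spinor →L[ℂ] ℂ) : IsClosed {g : Lp Spinor 2 μ | ∀ᵐ x ∂μ, B (g x) = 0} := by
  have : {g : Lp Spinor 2 μ | ∀ᵐ x ∂μ, B (g x) = 0} = {g | B.compLpL 2 μ g = 0} := by
    ext g
    rw [mem_ofPred_eq, mem_ofPred_eq, Lp.eq_zero_iff_ae_eq_zero]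
    exact ⟨fun H => (B.coeFn_compLpL g).trans H, fun H => (B.coeFn_compLpL g).symm.trans H⟩
  rw [this]
  exact isClosed_eq (B.compLpL 2 μ).continuous continuous_const

theorem HasTraces.congr {δ : ℝ} {u ut u' ut' : ℝ × ℝ → Spinor} {gp gm gp' gm' : ℝ → Spinor}
    (H : HasTraces δ u ut gp gm) (hu : u' =ᵐ[stripMeasure δ] u) (ht : ut' =ᵐ[stripMeasure δ] ut)
    (hp : gp' =ᵐ[volume] gp) (hm : gm' =ᵐ[volume] gm) : HasTraces δ u' ut' gp' gm' := by
  refine ⟨(memLp_congr_ae hp).2 H.memLp_p, (memLp_congr_ae hm).2 H.memLp_m, fun φ hφ hc => ?_⟩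
  have e1 : ∫ p, fderiv ℝ φ p (0, 1) • u' p ∂(stripMeasure δ) =
      ∫ p, fderiv ℝ φ p (0, 1) • u p ∂(stripMeasure δ) :=
    integral_congr_ae (by filter_upwards [hu] with p e; rw [e])
  have e2 : ∫ p, φ p • ut' p ∂(stripMeasure δ) = ∫ p, φ p • ut p ∂(stripMeasure δ) :=
    integral_congr_ae (by filter_upwards [ht] with p e; rw [e])
  have e3 : ∫ s, φ (s, δ) • gp' s = ∫ s, φ (s, δ) • gp s :=
    integral_congr_ae (by filter_upwards [hp] with p e; rw [e])
  have e4 : ∫ s, φ (s, -δ) • gm' s = ∫ s, φ (s, -δ) • gm s :=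
    integral_congr_ae (by filter_upwards [hm] with p e; rw [e])
  rw [e1, e2, e3, e4, H.green φ hφ hc]

theorem StripBC.congr {gp gm gp' gm' : ℝ → Spinor} (H : StripBC gp gm)
    (hp : gp' =ᵐ[volume] gp) (hm : gm' =ᵐ[volume] gm) : StripBC gp' gm' := by
  refine ⟨?_, ?_⟩
  · filter_upwards [H.1, hp] with s e1 e2
    rw [e2, e1]
  · filter_upwards [H.2, hm] with s e1 e2
    rw [e2, e1]

/-! ### Passage of the domain conditions from a dense set to all of `L²` -/

section Closed

variable {δ h l : ℝ} {D : Set (L2Strip δ)}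
  (R0 Rs Rt : L2Strip δ →L[ℂ] L2Strip δ) (Rp Rm : L2Strip δ →L[ℂ] Lp (α := ℝ) Spinor 2 volume)

/-- For a fixed test function both sides depend continuously on `f`, so the identity extends from
the dense set to its closure. -/
theorem weakDeriv_of_dense (hD : Dense D) (e : ℝ × ℝ) (H : ∀ f ∈ D, HasWeakDeriv δ e (R0 f) (Rs f))
    (f : L2Strip δ) : HasWeakDeriv δ e (R0 f) (Rs f) := by
  intro φ hφ hc hs
  have c1 := (continuous_test_deriv hφ e).memLp_of_hasCompactSupport
    (hc.fderiv_apply ℝ e) (p := 2) (μ := stripMeasure δ)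
  have c2 := hφ.continuous.memLp_of_hasCompactSupport hc (p := 2) (μ := stripMeasure δ)
  have hcl := isClosed_eq ((continuous_integral_smul c1).comp R0.continuous)
    ((continuous_integral_smul c2).comp Rs.continuous).neg
  exact hcl.closure_subset_iff.2 (fun g hg => H g hg φ hφ hc hs) (hD f)

theorem hasTraces_of_dense (hD : Dense D) (H : ∀ f ∈ D, HasTraces δ (R0 f) (Rt f) (Rp f) (Rm f))
    (f : L2Strip δ) : HasTraces δ (R0 f) (Rt f) (Rp f) (Rm f) := by
  refine ⟨Lp.memLp _, Lp.memLp _, fun φ hφ hc => ?_⟩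
  have c1 := (continuous_test_deriv hφ (0, 1)).memLp_of_hasCompactSupport
    (hc.fderiv_apply ℝ (0, 1)) (p := 2) (μ := stripMeasure δ)
  have c2 := hφ.continuous.memLp_of_hasCompactSupport hc (p := 2) (μ := stripMeasure δ)
  have cl : ∀ a : ℝ, Continuous fun s => φ (s, a) := fun a => hφ.continuous.comp (by fun_prop)
  have c3 : ∀ a : ℝ, MemLp (fun s => φ (s, a)) 2 volume := fun a =>
    (cl a).memLp_of_hasCompactSupport (compact_test_line hc a)
  have hcl := isClosed_eq ((continuous_integral_smul c1).comp R0.continuous)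
    ((((continuous_integral_smul (c3 δ)).comp Rp.continuous).sub
      ((continuous_integral_smul (c3 (-δ))).comp Rm.continuous)).sub
      ((continuous_integral_smul c2).comp Rt.continuous))
  exact hcl.closure_subset_iff.2 (fun g hg => (H g hg).green φ hφ hc) (hD f)

/-- The boundary conditions say that the sum, respectively the difference, of the two components of
the trace vanishes. Both are closed conditions in `L²(ℝ)`. -/
theorem stripBC_of_dense (hD : Dense D) (H : ∀ f ∈ D, StripBC (Rp f) (Rm f)) (f : L2Strip δ) :
    StripBC (Rp f) (Rm f) := by
  have c1 := (isClosed_ae_eq_zero volume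
    (EuclideanSpace.proj 0 + EuclideanSpace.proj 1 : Spinor →L[ℂ] ℂ)).preimage Rp.continuous
  have c2 := (isClosed_ae_eq_zero volume
    (EuclideanSpace.proj 0 - EuclideanSpace.proj 1 : Spinor →L[ℂ] ℂ)).preimage Rm.continuous
  have e1 := c1.closure_subset_iff.2 (fun g hg => (H g hg).1.mono fun s hs => by simp [hs]) (hD f)
  have e2 := c2.closure_subset_iff.2 (fun g hg => (H g hg).2.mono fun s hs => by simp [hs]) (hD f)
  exact ⟨Eventually.mono e1 fun s hs => eq_neg_of_add_eq_zero_left hs,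
    Eventually.mono e2 fun s hs => sub_eq_zero.1 hs⟩

theorem stripExpr_of_dense (hD : Dense D)
    (H : ∀ f ∈ D, ((l : ℂ) • R0 f + f : L2Strip δ) =ᵐ[stripMeasure δ]
      stripExpr h (R0 f) (Rs f) (Rt f)) (f : L2Strip δ) :
    ((l : ℂ) • R0 f + f : L2Strip δ) =ᵐ[stripMeasure δ] stripExpr h (R0 f) (Rs f) (Rt f) := by
  obtain ⟨E, hE, hEe⟩ := exists_continuous_expr δ h
  have hcl : IsClosed {f | (l : ℂ) • R0 f + f = E (R0 f, Rs f, Rt f)} :=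
    isClosed_eq (by fun_prop) (hE.comp (by fun_prop))
  have := hcl.closure_subset_iff.2
    (fun g hg => Lp.ext ((H g hg).trans (hEe (R0 g) (Rs g) (Rt g)).symm)) (hD f)
  have e : (l : ℂ) • R0 f + f = E (R0 f, Rs f, Rt f) := this
  rw [e]
  exact hEe _ _ _

end Closed

/-- The slicewise bound and Plancherel control the synthesis of `J a` by the norm of the synthesis
of `a`. As the latter has dense range, the assignment extends to a bounded operator. -/
theorem exists_synth_extension {δ : ℝ} (hδ : 0 < δ) (J : rapidSymbol δ →ₗ[ℂ] (ℝ × ℝ → Spinor))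
    (hJ : ∀ a, IsSymbol δ (J a)) {C : ℝ} (hC : 0 ≤ C)
    (h : ∀ (a : rapidSymbol δ) (k : ℝ), ∫ t in (-δ)..δ, ‖J a (k, t)‖ ^ 2 ≤
      C ^ 2 * ∫ t in (-δ)..δ, ‖(a : ℝ × ℝ → Spinor) (k, t)‖ ^ 2) :
    ∃ R : L2Strip δ →L[ℂ] L2Strip δ, ∀ a, R (synthBase hδ a) =ᵐ[stripMeasure δ] synth δ (J a) := by
  refine ⟨(synthₗ hδ J hJ).extendOfNorm (synthBase hδ), fun a => ?_⟩
  rw [LinearMap.extendOfNorm_eq (denseRange_synthBase hδ) ⟨_, norm_synthₗ_le hδ J hJ hC h⟩ a]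
  exact ((hJ a).memLp_synth hδ).coeFn_toLp

theorem exists_line_extension {δ : ℝ} (hδ : 0 < δ) {τ : ℝ} (hτ : τ ∈ Icc (-δ) δ)
    (J : rapidSymbol δ →ₗ[ℂ] (ℝ × ℝ → Spinor)) (hJ : ∀ a, IsSymbol δ (J a)) {C : ℝ} (hC : 0 ≤ C)
    (h : ∀ (a : rapidSymbol δ) (k : ℝ), ‖J a (k, τ)‖ ^ 2 ≤
      C ^ 2 * ∫ t in (-δ)..δ, ‖(a : ℝ × ℝ → Spinor) (k, t)‖ ^ 2) :
    ∃ R : L2Strip δ →L[ℂ] Lp (α := ℝ) Spinor 2 volume,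
      ∀ a, R (synthBase hδ a) =ᵐ[volume] fun s => synth δ (J a) (s, τ) := by
  refine ⟨(lineₗ hδ τ J hJ).extendOfNorm (synthBase hδ), fun a => ?_⟩
  rw [LinearMap.extendOfNorm_eq (denseRange_synthBase hδ) ⟨_, norm_lineₗ_le hδ hτ J hJ hC h⟩ a]
  exact ((hJ a).memLp_line hδ τ).coeFn_toLp

section RightInverse

variable {δ h l : ℝ}

theorem fiberBC_synth (hδ : 0 < δ) (hh : 0 < h) (hd : ∀ ξ, defect δ h ξ l ≠ 0)
    {a : ℝ × ℝ → Spinor} (ha : a ∈ rapidSymbol δ) (s : ℝ) :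
    FiberBC δ fun t => synth δ (symbolRes δ h l a) (s, t) := by
  have s0 := isSymbol_of_mem_rapidSymbol hδ (symbolRes_mem hδ hh hd ha)
  have hb := fun k => fiberBC_res hδ hh (2 * Real.pi * h * k) l fun τ => a (k, τ)
  constructor
  · simp only
    rw [synth_apply hδ s0, synth_apply hδ s0, ← integral_neg]
    refine integral_congr_ae (Eventually.of_forall fun k => ?_)
    change wave k s * symbolRes δ h l a (k, clamp δ δ) 0 =
      -(wave k s * symbolRes δ h l a (k, clamp δ δ) 1)
    rw [clamp_of_mem (right_mem_Icc.2 (by linarith)), ← mul_neg]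
    exact congrArg _ (hb k).1
  · simp only
    rw [synth_apply hδ s0, synth_apply hδ s0]
    refine integral_congr_ae (Eventually.of_forall fun k => ?_)
    change wave k s * symbolRes δ h l a (k, clamp δ (-δ)) 0 =
      wave k s * symbolRes δ h l a (k, clamp δ (-δ)) 1
    rw [clamp_of_mem (left_mem_Icc.2 (by linarith))]
    exact congrArg _ (hb k).2

theorem isH1Strip_hasTraces_synth (hδ : 0 < δ) (hh : 0 < h) (hd : ∀ ξ, defect δ h ξ l ≠ 0)
    {a : ℝ × ℝ → Spinor} (ha : a ∈ rapidSymbol δ) :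
    IsH1Strip δ (synth δ (symbolRes δ h l a)) (synth δ (symbolFreq (symbolRes δ h l a)))
      (synth δ (symbolResDeriv δ h l a)) ∧
    HasTraces δ (synth δ (symbolRes δ h l a)) (synth δ (symbolResDeriv δ h l a))
      (fun s => synth δ (symbolRes δ h l a) (s, δ))
      fun s => synth δ (symbolRes δ h l a) (s, -δ) := by
  have hm := symbolRes_mem hδ hh hd ha
  have s0 := isSymbol_of_mem_rapidSymbol hδ hm
  have ss := isSymbol_symbolFreq hδ hm
  have st := isSymbol_symbolResDeriv hδ hh hd ha
  have hslice : ∀ k : ℝ, Continuous fun t => a (k, t) := fun k => ha.1.comp (by fun_prop)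
  have dres : ∀ k, ∀ t ∈ Ioo (-δ) δ, HasDerivAt (fun t => symbolRes δ h l a (k, t))
      (symbolResDeriv δ h l a (k, t)) t := fun k t ht =>
    hasDerivAt_res hδ hh (hd (2 * Real.pi * h * k)) (hslice k) ht
  have ds : ∀ s t, HasDerivAt (fun s => synth δ (symbolRes δ h l a) (s, t))
      (synth δ (symbolFreq (symbolRes δ h l a)) (s, t)) s := fun s t =>
    s0.hasDerivAt_synth_fst hδ ss s t
  have dt : ∀ s, ∀ t ∈ Ioo (-δ) δ, HasDerivAt (fun t => synth δ (symbolRes δ h l a) (s, t))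
      (synth δ (symbolResDeriv δ h l a) (s, t)) t := fun s t ht =>
    s0.hasDerivAt_synth_snd hδ st dres s ht
  exact isH1Strip_hasTraces_of_hasDerivAt hδ (s0.continuous_synth hδ) (ss.continuous_synth hδ)
    (st.continuous_synth hδ) (s0.memLp_synth hδ) (ss.memLp_synth hδ) (st.memLp_synth hδ)
    (s0.memLp_line hδ δ) (s0.memLp_line hδ (-δ)) ds dt

theorem norm_symbolFreq_sq (b : ℝ × ℝ → Spinor) (q : ℝ × ℝ) :
    ‖symbolFreq b q‖ ^ 2 = (2 * Real.pi * q.1) ^ 2 * ‖b q‖ ^ 2 := by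
  rw [symbolFreq, norm_smul, mul_pow]
  congr 1
  rw [norm_mul, Complex.norm_I, mul_one, ← Complex.ofReal_ofNat, ← Complex.ofReal_mul,
    ← Complex.ofReal_mul, Complex.norm_real, Real.norm_eq_abs, sq_abs]

/-- Off the zeros of the defect, the strip operator has a bounded right inverse. -/
theorem exists_right_inverse (hδ : 0 < δ) (hh : 0 < h) (hd : ∀ ξ, defect δ h ξ l ≠ 0) :
    ∃ R : L2Strip δ →L[ℂ] L2Strip δ, ∀ f, (R f, (l : ℂ) • R f + f) ∈ (stripDirac δ h).graph := by
  obtain ⟨C, hC0, hC⟩ := exists_res_bound hδ hh hd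
  have hlmem : -δ ∈ Icc (-δ) δ := left_mem_Icc.2 (by linarith)
  have hrmem : δ ∈ Icc (-δ) δ := right_mem_Icc.2 (by linarith)
  have hmem : ∀ a : rapidSymbol δ, symbolRes δ h l a ∈ rapidSymbol δ := fun a =>
    symbolRes_mem hδ hh hd a.2
  have hb := fun (a : rapidSymbol δ) (k : ℝ) => hC (2 * Real.pi * h * k)
    (fun t => (a : ℝ × ℝ → Spinor) (k, t)) (a.2.1.comp (by fun_prop))
  have hCs : √C ^ 2 = C := Real.sq_sqrt hC0
  have s0 : ∀ a, IsSymbol δ (symbolResₗ hδ hh l a) := fun a =>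
    isSymbol_of_mem_rapidSymbol hδ (hmem a)
  obtain ⟨R0, q0⟩ := exists_synth_extension hδ (symbolResₗ hδ hh l) s0 (Real.sqrt_nonneg C)
    fun a k => by rw [hCs]; exact (hb a k).1
  -- The bound on the resolvent is for `ξ = 2πhk`, whereas the symbol of `∂ₛ` has modulus `2π|k|`.
  -- This explains the division by `h`.
  obtain ⟨Rs, qs⟩ := exists_synth_extension hδ (symbolFreqₗ hδ hh l)
    (fun a => isSymbol_symbolFreq hδ (hmem a)) (C := √C / h) (by positivity) fun a k => by
      have e1 : ∀ t, ‖symbolFreqₗ hδ hh l a (k, t)‖ ^ 2 =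
          (2 * Real.pi * k) ^ 2 * ‖symbolRes δ h l a (k, t)‖ ^ 2 := fun t =>
        norm_symbolFreq_sq _ _
      simp only [e1]
      rw [intervalIntegral.integral_const_mul, div_pow, hCs, div_mul_eq_mul_div,
        le_div_iff₀ (by positivity)]
      refine le_trans (le_of_eq ?_) (hb a k).2.1
      simp only [symbolRes]
      ring
  obtain ⟨Rt, qt⟩ := exists_synth_extension hδ (symbolResDerivₗ hδ hh l)
    (fun a => isSymbol_symbolResDeriv hδ hh hd a.2) (Real.sqrt_nonneg C)
    fun a k => by rw [hCs]; exact (hb a k).2.2.1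
  obtain ⟨Rp, qp⟩ := exists_line_extension hδ hrmem (symbolResₗ hδ hh l) s0 (Real.sqrt_nonneg C)
    fun a k => by rw [hCs]; exact (hb a k).2.2.2 δ hrmem
  obtain ⟨Rm, qm⟩ := exists_line_extension hδ hlmem (symbolResₗ hδ hh l) s0 (Real.sqrt_nonneg C)
    fun a k => by rw [hCs]; exact (hb a k).2.2.2 (-δ) hlmem
  have hD : Dense (range (synthBase hδ)) := denseRange_synthBase hδ
  -- On the dense set the operators return classical syntheses, for which the derivatives, traces,
  -- boundary conditions and the equation are known. Each is carried over to all of `L²`.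
  have weak := weakDeriv_of_dense R0 Rs hD (1, 0) (by
    rintro _ ⟨a, rfl⟩
    exact (isH1Strip_hasTraces_synth hδ hh hd a.2).1.weak_s.congr (q0 a) (qs a))
  have traces := hasTraces_of_dense R0 Rt Rp Rm hD (by
    rintro _ ⟨a, rfl⟩
    exact (isH1Strip_hasTraces_synth hδ hh hd a.2).2.congr (q0 a) (qt a) (qp a) (qm a))
  have bc := stripBC_of_dense Rp Rm hD (by
    rintro _ ⟨a, rfl⟩
    exact StripBC.congr ⟨Eventually.of_forall fun s => (fiberBC_synth hδ hh hd a.2 s).1,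
      Eventually.of_forall fun s => (fiberBC_synth hδ hh hd a.2 s).2⟩ (qp a) (qm a))
  have expr := stripExpr_of_dense (h := h) (l := l) R0 Rs Rt hD (by
    rintro _ ⟨a, rfl⟩
    filter_upwards [q0 a, qs a, qt a, coeFn_synthBase hδ a,
      Lp.coeFn_add ((l : ℂ) • R0 (synthBase hδ a)) (synthBase hδ a),
      Lp.coeFn_smul (l : ℂ) (R0 (synthBase hδ a)),
      ae_restrict_mem (isOpen_strip δ).measurableSet] with p e2 e3 e4 e5 e6 e7 hp
    have e := stripExpr_synth hδ hh hd a.2 hp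
    rw [e6, Pi.add_apply, e7, Pi.smul_apply, e5, e2]
    refine (e.symm.trans ?_)
    simp only [stripExpr, e2, e3, e4]
    rfl)
  refine ⟨R0, fun f => ?_⟩
  rw [stripDirac_graph]
  exact ⟨R0 f, Rs f, Rt f, Rp f, Rm f, ⟨Lp.memLp _, Lp.memLp _, Lp.memLp _, weak f,
    weak_t_of_green (traces f)⟩, traces f, bc f, EventuallyEq.rfl, expr f⟩

end RightInverse

/-! ### Integration by parts against tensor products -/

/-- The weak formulation of the derivatives and traces of `u`, for a complex test function `φ` with
derivatives `φs, φt`. -/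
structure IsTested (δ : ℝ) (u us ut : ℝ × ℝ → Spinor) (gp gm : ℝ → Spinor)
    (φ φs φt : ℝ × ℝ → ℂ) : Prop where
  memLp : MemLp φ 2 (stripMeasure δ)
  memLp_s : MemLp φs 2 (stripMeasure δ)
  memLp_t : MemLp φt 2 (stripMeasure δ)
  memLp_p : MemLp (fun s => φ (s, δ)) 2
  memLp_m : MemLp (fun s => φ (s, -δ)) 2
  eq_s : ∫ p, φs p • u p ∂(stripMeasure δ) = -∫ p, φ p • us p ∂(stripMeasure δ)
  eq_t : ∫ p, φt p • u p ∂(stripMeasure δ) = (∫ s, φ (s, δ) • gp s) - (∫ s, φ (s, -δ) • gm s) -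
    ∫ p, φ p • ut p ∂(stripMeasure δ)

theorem integrable_smul_of_memLp {X : Type*} [MeasurableSpace X] {μ : Measure X} {φ : X → ℂ}
    {u : X → Spinor} (hφ : MemLp φ 2 μ) (hu : MemLp u 2 μ) : Integrable (fun x => φ x • u x) μ :=
  memLp_one_iff_integrable.1 (hu.smul hφ)

section Tested

variable {δ : ℝ} {u us ut : ℝ × ℝ → Spinor} {gp gm : ℝ → Spinor} {φ φs φt ψ ψs ψt : ℝ × ℝ → ℂ}

theorem IsTested.add (H : IsH1Strip δ u us ut) (T : HasTraces δ u ut gp gm)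
    (h : IsTested δ u us ut gp gm φ φs φt) (h' : IsTested δ u us ut gp gm ψ ψs ψt) :
    IsTested δ u us ut gp gm (φ + ψ) (φs + ψs) (φt + ψt) := by
  refine ⟨h.memLp.add h'.memLp, h.memLp_s.add h'.memLp_s, h.memLp_t.add h'.memLp_t,
    h.memLp_p.add h'.memLp_p, h.memLp_m.add h'.memLp_m, ?_, ?_⟩
  · simp only [Pi.add_apply, add_smul]
    rw [integral_add (integrable_smul_of_memLp h.memLp_s H.memLp)
      (integrable_smul_of_memLp h'.memLp_s H.memLp),
      integral_add (integrable_smul_of_memLp h.memLp H.memLp_s)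
      (integrable_smul_of_memLp h'.memLp H.memLp_s), h.eq_s, h'.eq_s]
    abel
  · simp only [Pi.add_apply, add_smul]
    rw [integral_add (integrable_smul_of_memLp h.memLp_t H.memLp)
      (integrable_smul_of_memLp h'.memLp_t H.memLp),
      integral_add (integrable_smul_of_memLp h.memLp H.memLp_t)
      (integrable_smul_of_memLp h'.memLp H.memLp_t),
      integral_add (integrable_smul_of_memLp h.memLp_p T.memLp_p)
      (integrable_smul_of_memLp h'.memLp_p T.memLp_p),
      integral_add (integrable_smul_of_memLp h.memLp_m T.memLp_m)
      (integrable_smul_of_memLp h'.memLp_m T.memLp_m), h.eq_t, h'.eq_t]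
    abel

theorem IsTested.const_smul (h : IsTested δ u us ut gp gm φ φs φt) (c : ℂ) :
    IsTested δ u us ut gp gm (c • φ) (c • φs) (c • φt) := by
  refine ⟨h.memLp.const_smul c, h.memLp_s.const_smul c, h.memLp_t.const_smul c,
    h.memLp_p.const_smul c, h.memLp_m.const_smul c, ?_, ?_⟩
  · simp only [Pi.smul_apply, smul_assoc]
    rw [integral_smul, integral_smul, h.eq_s, smul_neg]
  · simp only [Pi.smul_apply, smul_assoc]
    rw [integral_smul, integral_smul, integral_smul, integral_smul, h.eq_t, smul_sub, smul_sub]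

theorem hasCompactSupport_tensor {c g : ℝ → ℝ} (hc : HasCompactSupport c)
    (hg : HasCompactSupport g) : HasCompactSupport fun p : ℝ × ℝ => c p.1 * g p.2 := by
  refine HasCompactSupport.intro (hc.prod hg) fun p hp => ?_
  rcases Classical.em (p.1 ∈ tsupport c) with h1 | h1
  · have h2 : p.2 ∉ tsupport g := fun h2 => hp ⟨h1, h2⟩
    rw [image_eq_zero_of_notMem_tsupport h2, mul_zero]
  · rw [image_eq_zero_of_notMem_tsupport h1, zero_mul]

theorem contDiff_tensor {c g : ℝ → ℝ} (hc : ContDiff ℝ ∞ c) (hg : ContDiff ℝ ∞ g) :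
    ContDiff ℝ ∞ fun p : ℝ × ℝ => c p.1 * g p.2 :=
  (hc.comp contDiff_fst).mul (hg.comp contDiff_snd)

theorem fderiv_tensor_fst {c g : ℝ → ℝ} (hc : ContDiff ℝ ∞ c) (hg : ContDiff ℝ ∞ g) (p : ℝ × ℝ) :
    fderiv ℝ (fun p : ℝ × ℝ => c p.1 * g p.2) p (1, 0) = deriv c p.1 * g p.2 :=
  (hasDerivAt_test_fst (contDiff_tensor hc hg) p.1 p.2).unique
    (((hc.differentiable (by simp)) p.1).hasDerivAt.mul_const (g p.2))

theorem fderiv_tensor_snd {c g : ℝ → ℝ} (hc : ContDiff ℝ ∞ c) (hg : ContDiff ℝ ∞ g) (p : ℝ × ℝ) :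
    fderiv ℝ (fun p : ℝ × ℝ => c p.1 * g p.2) p (0, 1) = c p.1 * deriv g p.2 :=
  (hasDerivAt_test_snd (contDiff_tensor hc hg) p.1 p.2).unique
    (((hg.differentiable (by simp)) p.2).hasDerivAt.const_mul (c p.1))

theorem integrable_tensor_smul {c w : ℝ → ℝ} (hc : Continuous c) (hcc : HasCompactSupport c)
    (hw : Continuous w) {v : ℝ × ℝ → Spinor} (hv : MemLp v 2 (stripMeasure δ)) :
    Integrable (fun p => (c p.1 * w p.2) • v p) (stripMeasure δ) :=
  memLp_one_iff_integrable.1 (hv.smul (memLp_tensor (hc.memLp_of_hasCompactSupport hcc)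
    (memLp_interval_of_continuous δ hw)))

/-- Integration by parts in the longitudinal direction; no condition on the transversal factor. -/
theorem integral_tensor_fst (H : IsH1Strip δ u us ut) {c w : ℝ → ℝ} (hc : ContDiff ℝ ∞ c)
    (hcc : HasCompactSupport c) (hw : Continuous w) :
    ∫ p, (deriv c p.1 * w p.2) • u p ∂(stripMeasure δ) =
      -∫ p, (c p.1 * w p.2) • us p ∂(stripMeasure δ) := by
  have hc' : Continuous (deriv c) := hc.continuous_deriv (by simp)
  have hint : ∀ g : ℝ → ℝ, Continuous g → Integrable
      (fun p => g p.2 • (deriv c p.1 • u p + c p.1 • us p))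
      ((volume : Measure ℝ).prod (intervalMeasure δ)) := fun g hg => by
    rw [← stripMeasure_eq_prod]
    refine ((integrable_tensor_smul hc' hcc.deriv hg H.memLp).add
      (integrable_tensor_smul hc.continuous hcc hg H.memLp_s)).congr
      (Eventually.of_forall fun p => ?_)
    simp only [Pi.add_apply, smul_add, smul_smul, mul_comm]
  have hsplit : ∀ g : ℝ → ℝ, Continuous g →
      ∫ p, (deriv c p.1 * g p.2) • u p ∂(stripMeasure δ) +
        ∫ p, (c p.1 * g p.2) • us p ∂(stripMeasure δ) =
      ∫ t, g t • (∫ s, (deriv c s • u (s, t) + c s • us (s, t))) ∂(intervalMeasure δ) := by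
    intro g hg
    rw [← integral_add (integrable_tensor_smul hc' hcc.deriv hg H.memLp)
      (integrable_tensor_smul hc.continuous hcc hg H.memLp_s)]
    have e : ∀ p : ℝ × ℝ, (deriv c p.1 * g p.2) • u p + (c p.1 * g p.2) • us p =
        g p.2 • (deriv c p.1 • u p + c p.1 • us p) := fun p => by
      simp only [smul_add, smul_smul, mul_comm]
    simp only [e]
    rw [stripMeasure_eq_prod, integral_prod_symm _ (hint g hg)]
    simp only [integral_smul]
  -- Transversal factors supported inside `(-δ, δ)` show that the longitudinal integral vanishes on
  -- almost every line. After that, any continuous transversal factor is admissible.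
  have hzero : ∀ᵐ t ∂(intervalMeasure δ),
      ∫ s, (deriv c s • u (s, t) + c s • us (s, t)) = 0 := by
    refine (ae_restrict_iff' measurableSet_Ioo).2 ?_
    have hi : Integrable (fun t => ∫ s, (deriv c s • u (s, t) + c s • us (s, t)))
        (intervalMeasure δ) := by
      have := (hint (fun _ => 1) continuous_const).integral_prod_right
      simpa only [one_smul] using this
    refine isOpen_Ioo.ae_eq_zero_of_integral_contDiff_smul_eq_zero
      (locallyIntegrableOn_of_locallyIntegrable_restrict hi.locallyIntegrable) fun g hg hgc hs => ?_
    have e1 := setIntegral_eq_integral_of_forall_compl_eq_zero (μ := volume) (s := Ioo (-δ) δ)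
      (f := fun t => g t • ∫ s, (deriv c s • u (s, t) + c s • us (s, t))) fun t ht => by
        rw [image_eq_zero_of_notMem_tsupport fun h' => ht (hs h'), zero_smul]
    rw [← e1, ← hsplit g hg.continuous]
    have hsub : tsupport (fun p : ℝ × ℝ => c p.1 * g p.2) ⊆ strip δ := by
      have h1 : tsupport (fun p : ℝ × ℝ => c p.1 * g p.2) ⊆ Prod.snd ⁻¹' tsupport g := by
        refine closure_minimal (fun p hp => subset_tsupport _ fun h0 => hp ?_)
          ((isClosed_tsupport g).preimage continuous_snd)
        simp only [h0, mul_zero]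
      exact fun p hp => ⟨mem_univ _, hs (h1 hp)⟩
    have := H.weak_s _ (contDiff_tensor hc hg) (hasCompactSupport_tensor hcc hgc) hsub
    simp only [fderiv_tensor_fst hc hg] at this
    rw [this, neg_add_cancel]
  rw [eq_neg_iff_add_eq_zero, hsplit w hw]
  refine integral_eq_zero_of_ae ?_
  filter_upwards [hzero] with t ht
  rw [ht, smul_zero, Pi.zero_apply]

/-- Green's formula with a smooth transversal factor, not cut off. -/
theorem integral_tensor_snd_of_contDiff (T : HasTraces δ u ut gp gm) (hδ : 0 < δ)
    {c Q : ℝ → ℝ} (hc : ContDiff ℝ ∞ c) (hcc : HasCompactSupport c) (hQ : ContDiff ℝ ∞ Q) :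
    ∫ p, (c p.1 * deriv Q p.2) • u p ∂(stripMeasure δ) =
      (∫ s, (c s * Q δ) • gp s) - (∫ s, (c s * Q (-δ)) • gm s) -
        ∫ p, (c p.1 * Q p.2) • ut p ∂(stripMeasure δ) := by
  -- The bump equals `1` on a neighbourhood of `[-δ, δ]`, so it makes the transversal factor
  -- compactly supported without changing values or derivatives there.
  let η : ContDiffBump (0 : ℝ) := ⟨2 * δ, 3 * δ, by linarith, by linarith⟩
  have hη : ∀ t ∈ Ioo (-(2 * δ)) (2 * δ), η t = 1 := fun t ht =>
    η.one_of_mem_closedBall (by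
      rw [mem_closedBall_zero_iff]
      exact (abs_lt.2 ht).le)
  have hg : ContDiff ℝ ∞ fun t => η t * Q t := η.contDiff.mul hQ
  have hgc : HasCompactSupport fun t => η t * Q t := η.hasCompactSupport.mul_right
  have hgQ : ∀ t ∈ Ioo (-(2 * δ)) (2 * δ), η t * Q t = Q t := fun t ht => by
    rw [hη t ht, one_mul]
  have hd : ∀ t ∈ Ioo (-δ) δ, deriv (fun t => η t * Q t) t = deriv Q t := fun t ht => by
    refine Filter.EventuallyEq.deriv_eq ?_
    filter_upwards [isOpen_Ioo.mem_nhds (show t ∈ Ioo (-(2 * δ)) (2 * δ) from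
      ⟨by linarith [ht.1], by linarith [ht.2]⟩)] with x hx using hgQ x hx
  have key := T.green _ (contDiff_tensor hc hg) (hasCompactSupport_tensor hcc hgc)
  simp only [fderiv_tensor_snd hc hg] at key
  rw [hgQ δ ⟨by linarith, by linarith⟩, hgQ (-δ) ⟨by linarith, by linarith⟩] at key
  have e1 : ∫ p, (c p.1 * deriv (fun t => η t * Q t) p.2) • u p ∂(stripMeasure δ) =
      ∫ p, (c p.1 * deriv Q p.2) • u p ∂(stripMeasure δ) := by
    refine setIntegral_congr_fun (isOpen_strip δ).measurableSet fun p hp => ?_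
    simp only [hd p.2 hp.2]
  have e2 : ∫ p, (c p.1 * (η p.2 * Q p.2)) • ut p ∂(stripMeasure δ) =
      ∫ p, (c p.1 * Q p.2) • ut p ∂(stripMeasure δ) := by
    refine setIntegral_congr_fun (isOpen_strip δ).measurableSet fun p hp => ?_
    simp only [hgQ p.2 ⟨by linarith [hp.2.1], by linarith [hp.2.2]⟩]
  rw [← e1, ← e2, key]

theorem tendsto_integral_tensor {c : ℝ → ℝ} (hc : Continuous c) (hcc : HasCompactSupport c)
    {v : ℝ × ℝ → Spinor} (hv : MemLp v 2 (stripMeasure δ)) {f : ℕ → ℝ → ℝ} {g : ℝ → ℝ} {M : ℝ}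
    (hf : ∀ n, Continuous (f n)) (hM : ∀ n, ∀ t ∈ Ioo (-δ) δ, |f n t| ≤ M)
    (hlim : ∀ t ∈ Ioo (-δ) δ, Tendsto (fun n => f n t) atTop (𝓝 (g t))) :
    Tendsto (fun n => ∫ p, (c p.1 * f n p.2) • v p ∂(stripMeasure δ)) atTop
      (𝓝 (∫ p, (c p.1 * g p.2) • v p ∂(stripMeasure δ))) := by
  refine tendsto_integral_of_dominated_convergence (fun p => ‖(c p.1 * M) • v p‖)
    (fun n => (integrable_tensor_smul hc hcc (hf n) hv).1)
    (integrable_tensor_smul hc hcc (w := fun _ => M) continuous_const hv).norm (fun n => ?_) ?_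
  · filter_upwards [ae_restrict_mem (isOpen_strip δ).measurableSet] with p hp
    rw [norm_smul, norm_smul, norm_mul, norm_mul]
    gcongr
    exact (hM n p.2 hp.2).trans (le_abs_self M)
  · filter_upwards [ae_restrict_mem (isOpen_strip δ).measurableSet] with p hp
    exact ((hlim p.2 hp.2).const_mul _).smul_const _

/-- Functions with continuous derivative are limits of smooth functions, with their derivatives. -/
theorem exists_contDiff_approx {w w' : ℝ → ℝ} (hw : Continuous w)
    (hw' : Continuous w') (hd : ∀ t ∈ Ioo (-δ) δ, HasDerivAt w (w' t) t) {ε : ℝ} (hε : 0 < ε) :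
    ∃ Q : ℝ → ℝ, ContDiff ℝ ∞ Q ∧ (∀ t ∈ Icc (-δ) δ, |deriv Q t - w' t| ≤ ε) ∧
      ∀ t ∈ Icc (-δ) δ, |Q t - w t| ≤ ε * (2 * δ) := by
  -- The derivative is approximated by a polynomial, which is then integrated from `-δ` with the
  -- right initial value. Both the function and its derivative converge.
  obtain ⟨q, hq⟩ := exists_polynomial_near_of_continuousOn (-δ) δ w' hw'.continuousOn ε hε
  have hqc : Continuous fun t => q.eval t := q.continuous
  have hQ : ∀ t, HasDerivAt (fun t => w (-δ) + ∫ x in (-δ)..t, q.eval x) (q.eval t) t := fun t =>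
    (intervalIntegral.integral_hasDerivAt_right (hqc.intervalIntegrable _ _)
      hqc.aestronglyMeasurable.stronglyMeasurableAtFilter hqc.continuousAt).const_add _
  have hQd : deriv (fun t => w (-δ) + ∫ x in (-δ)..t, q.eval x) = fun t => q.eval t :=
    funext fun t => (hQ t).deriv
  refine ⟨fun t => w (-δ) + ∫ x in (-δ)..t, q.eval x, ?_, fun t ht => ?_, fun t ht => ?_⟩
  · rw [contDiff_infty_iff_deriv, hQd]
    exact ⟨fun t => (hQ t).differentiableAt, by
      simpa only [Polynomial.coe_aeval_eq_eval] using q.contDiff_aeval (𝕜 := ℝ) ∞⟩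
  · rw [hQd]
    exact (hq t ht).le
  · have e : w t = w (-δ) + ∫ x in (-δ)..t, w' x := by
      rw [intervalIntegral.integral_eq_sub_of_hasDerivAt_of_le ht.1 hw.continuousOn
        (fun x hx => hd x ⟨hx.1, hx.2.trans_le ht.2⟩) (hw'.intervalIntegrable _ _)]
      ring
    rw [e, add_sub_add_left_eq_sub, ← intervalIntegral.integral_sub (hqc.intervalIntegrable _ _)
      (hw'.intervalIntegrable _ _)]
    rw [← Real.norm_eq_abs]
    refine (intervalIntegral.norm_integral_le_of_norm_le_const (C := ε) fun x hx => ?_).trans ?_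
    · rw [uIoc_of_le ht.1] at hx
      exact (hq x ⟨hx.1.le, hx.2.trans ht.2⟩).le
    · rw [abs_of_nonneg (by linarith [ht.1])]
      gcongr
      linarith [ht.2]

/-- The fibre resolvent of a continuous function supplies only one continuous transversal
derivative. Green's formula is therefore extended from smooth factors by approximation with
dominated convergence. -/
theorem integral_tensor_snd (H : IsH1Strip δ u us ut) (T : HasTraces δ u ut gp gm) (hδ : 0 < δ)
    {c : ℝ → ℝ} (hc : ContDiff ℝ ∞ c) (hcc : HasCompactSupport c) {w w' : ℝ → ℝ}
    (hw : Continuous w) (hw' : Continuous w') (hd : ∀ t ∈ Ioo (-δ) δ, HasDerivAt w (w' t) t) :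
    ∫ p, (c p.1 * w' p.2) • u p ∂(stripMeasure δ) =
      (∫ s, (c s * w δ) • gp s) - (∫ s, (c s * w (-δ)) • gm s) -
        ∫ p, (c p.1 * w p.2) • ut p ∂(stripMeasure δ) := by
  choose Q hQ hQd hQw using fun n : ℕ =>
    exists_contDiff_approx hw hw' hd (Nat.one_div_pos_of_nat (α := ℝ) (n := n))
  have h0 : Tendsto (fun n : ℕ => 1 / ((n : ℝ) + 1)) atTop (𝓝 0) :=
    tendsto_one_div_add_atTop_nhds_zero_nat
  have h1 : ∀ n : ℕ, 1 / ((n : ℝ) + 1) ≤ 1 := fun n => by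
    rw [div_le_one (by positivity)]
    linarith [(Nat.cast_nonneg n : (0 : ℝ) ≤ n)]
  obtain ⟨B, hB⟩ := isCompact_Icc.exists_bound_of_continuousOn (s := Icc (-δ) δ) hw.continuousOn
  obtain ⟨B', hB'⟩ := isCompact_Icc.exists_bound_of_continuousOn (s := Icc (-δ) δ) hw'.continuousOn
  have hlim : ∀ t ∈ Icc (-δ) δ, Tendsto (fun n => Q n t) atTop (𝓝 (w t)) := fun t ht => by
    rw [tendsto_iff_norm_sub_tendsto_zero]
    refine squeeze_zero (fun _ => norm_nonneg _) (fun n => hQw n t ht) ?_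
    simpa using h0.mul_const (2 * δ)
  have hlim' : ∀ t ∈ Icc (-δ) δ, Tendsto (fun n => deriv (Q n) t) atTop (𝓝 (w' t)) :=
    fun t ht => by
      rw [tendsto_iff_norm_sub_tendsto_zero]
      exact squeeze_zero (fun _ => norm_nonneg _) (fun n => hQd n t ht) h0
  have hbd : ∀ n, ∀ t ∈ Ioo (-δ) δ, |Q n t| ≤ B + 2 * δ := fun n t ht => by
    have a := hQw n t (Ioo_subset_Icc_self ht)
    have b := hB t (Ioo_subset_Icc_self ht)
    have e := abs_add_le (Q n t - w t) (w t)
    rw [sub_add_cancel] at e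
    have := mul_le_mul_of_nonneg_right (h1 n) (by linarith : 0 ≤ 2 * δ)
    rw [Real.norm_eq_abs] at b
    linarith
  have hbd' : ∀ n, ∀ t ∈ Ioo (-δ) δ, |deriv (Q n) t| ≤ B' + 1 := fun n t ht => by
    have a := hQd n t (Ioo_subset_Icc_self ht)
    have b := hB' t (Ioo_subset_Icc_self ht)
    have e := abs_add_le (deriv (Q n) t - w' t) (w' t)
    rw [sub_add_cancel] at e
    rw [Real.norm_eq_abs] at b
    linarith [h1 n]
  have hbdry : ∀ (g : ℝ → Spinor), ∀ t ∈ Icc (-δ) δ, Tendsto (fun n => ∫ s, (c s * Q n t) • g s)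
      atTop (𝓝 (∫ s, (c s * w t) • g s)) := fun g t ht => by
    simp only [mul_comm (c _), mul_smul]
    simp only [integral_smul]
    exact (hlim t ht).smul_const _
  have hle : -δ ≤ δ := by linarith
  refine tendsto_nhds_unique (tendsto_integral_tensor hc.continuous hcc H.memLp
    (fun n => (hQ n).continuous_deriv (by simp)) hbd' fun t ht =>
      hlim' t (Ioo_subset_Icc_self ht)) ?_
  simp only [fun n => integral_tensor_snd_of_contDiff T hδ hc hcc (hQ n)]
  exact ((hbdry gp δ (right_mem_Icc.2 hle)).sub (hbdry gm (-δ) (left_mem_Icc.2 hle))).sub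
    (tendsto_integral_tensor hc.continuous hcc H.memLp_t (fun n => (hQ n).continuous) hbd
      fun t ht => hlim t (Ioo_subset_Icc_self ht))

theorem isTested_tensor_real (H : IsH1Strip δ u us ut) (T : HasTraces δ u ut gp gm) (hδ : 0 < δ)
    {c : ℝ → ℝ} (hc : ContDiff ℝ ∞ c) (hcc : HasCompactSupport c) {w w' : ℝ → ℝ}
    (hw : Continuous w) (hw' : Continuous w') (hd : ∀ t ∈ Ioo (-δ) δ, HasDerivAt w (w' t) t) :
    IsTested δ u us ut gp gm (fun p => (c p.1 * w p.2 : ℝ)) (fun p => (deriv c p.1 * w p.2 : ℝ))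
      (fun p => (c p.1 * w' p.2 : ℝ)) := by
  have hc' : Continuous (deriv c) := hc.continuous_deriv (by simp)
  have m1 := hc.continuous.memLp_of_hasCompactSupport (μ := volume) (p := 2) hcc
  have m2 := hc'.memLp_of_hasCompactSupport (μ := volume) (p := 2) hcc.deriv
  refine ⟨(memLp_tensor m1 (memLp_interval_of_continuous δ hw)).ofReal,
    (memLp_tensor m2 (memLp_interval_of_continuous δ hw)).ofReal,
    (memLp_tensor m1 (memLp_interval_of_continuous δ hw')).ofReal,
    (m1.mul_const (w δ)).ofReal, (m1.mul_const (w (-δ))).ofReal, ?_, ?_⟩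
  · simpa only [Complex.coe_smul] using integral_tensor_fst H hc hcc hw
  · simpa only [Complex.coe_smul] using integral_tensor_snd H T hδ hc hcc hw hw' hd

/-- Complex tensor products are admissible test functions. -/
theorem isTested_tensor (H : IsH1Strip δ u us ut) (T : HasTraces δ u ut gp gm) (hδ : 0 < δ)
    {c c' : ℝ → ℂ} (hc : ContDiff ℝ ∞ c) (hcc : HasCompactSupport c)
    (hc' : ∀ s, HasDerivAt c (c' s) s) {w w' : ℝ → ℂ}
    (hw : Continuous w) (hw' : Continuous w') (hd : ∀ t ∈ Ioo (-δ) δ, HasDerivAt w (w' t) t) :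
    IsTested δ u us ut gp gm (fun p => c p.1 * w p.2) (fun p => c' p.1 * w p.2)
      (fun p => c p.1 * w' p.2) := by
  have key : ∀ {c : ℝ → ℝ}, ContDiff ℝ ∞ c → HasCompactSupport c → IsTested δ u us ut gp gm
      (fun p => (c p.1 : ℂ) * w p.2) (fun p => ((deriv c p.1 : ℝ) : ℂ) * w p.2)
      (fun p => (c p.1 : ℂ) * w' p.2) := by
    intro c hc hcc
    -- Admissibility is linear in the test function, so the complex case follows from the real one
    -- by splitting each factor into real and imaginary parts.
    have hre := isTested_tensor_real H T hδ hc hcc (Complex.continuous_re.comp hw)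
      (Complex.continuous_re.comp hw') fun t ht =>
        Complex.reCLM.hasFDerivAt.comp_hasDerivAt t (hd t ht)
    have him := isTested_tensor_real H T hδ hc hcc (Complex.continuous_im.comp hw)
      (Complex.continuous_im.comp hw') fun t ht =>
        Complex.imCLM.hasFDerivAt.comp_hasDerivAt t (hd t ht)
    convert hre.add H T (him.const_smul Complex.I) using 1 <;>
    · funext p
      apply Complex.ext <;> simp
  have hre := key (c := fun s => (c s).re) (Complex.reCLM.contDiff.comp hc)
    (hcc.comp_left Complex.zero_re)
  have him := key (c := fun s => (c s).im) (Complex.imCLM.contDiff.comp hc)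
    (hcc.comp_left Complex.zero_im)
  have dre : ∀ s, deriv (fun s => (c s).re) s = (c' s).re := fun s =>
    (Complex.reCLM.hasFDerivAt.comp_hasDerivAt s (hc' s)).deriv
  have dim : ∀ s, deriv (fun s => (c s).im) s = (c' s).im := fun s =>
    (Complex.imCLM.hasFDerivAt.comp_hasDerivAt s (hc' s)).deriv
  convert hre.add H T (him.const_smul Complex.I) using 1 <;>
  · funext p
    apply Complex.ext <;> simp [dre, dim, sub_eq_add_neg]

end Tested

/-! ### Injectivity -/

section Injectivity

variable {δ h l : ℝ} {u us ut : ℝ × ℝ → Spinor} {gp gm : ℝ → Spinor}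

theorem integral_mul_apply {X : Type*} [MeasurableSpace X] {μ : Measure X} {φ : X → ℂ}
    {v : X → Spinor} (hφ : MemLp φ 2 μ) (hv : MemLp v 2 μ) (i : Fin 2) :
    (∫ x, φ x • v x ∂μ) i = ∫ x, φ x * v x i ∂μ :=
  ((EuclideanSpace.proj (𝕜 := ℂ) i).integral_comp_comm (integrable_smul_of_memLp hφ hv)).symm

theorem integrable_mul_apply {X : Type*} [MeasurableSpace X] {μ : Measure X} {φ : X → ℂ}
    {v : X → Spinor} (hφ : MemLp φ 2 μ) (hv : MemLp v 2 μ) (i : Fin 2) :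
    Integrable (fun x => φ x * v x i) μ :=
  (EuclideanSpace.proj (𝕜 := ℂ) i).integrable_comp (integrable_smul_of_memLp hφ hv)

theorem integrable_snd_mul {f : ℝ × ℝ → ℂ} (hf : Integrable f (stripMeasure δ)) :
    Integrable (fun p => (p.2 : ℂ) * f p) (stripMeasure δ) := by
  refine hf.bdd_mul (c := |δ|) (by fun_prop) ?_
  filter_upwards [ae_restrict_mem (isOpen_strip δ).measurableSet] with p hp
  rw [Complex.norm_real, Real.norm_eq_abs]
  exact abs_le_abs (by linarith [hp.2.2]) (by linarith [hp.2.1])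

theorem integrable_tensor_mul_apply {c w : ℝ → ℂ} (hc : Continuous c) (hcc : HasCompactSupport c)
    (hw : Continuous w) {v : ℝ × ℝ → Spinor} (hv : MemLp v 2 (stripMeasure δ)) (i : Fin 2) :
    Integrable (fun p => c p.1 * w p.2 * v p i) (stripMeasure δ) :=
  integrable_mul_apply (memLp_tensor (hc.memLp_of_hasCompactSupport hcc)
    (memLp_interval_of_continuous δ hw)) hv i

/-- The weak form of the eigenvalue equation, tested with `(φ₀, φ₁)` satisfying the boundary
condition. -/
theorem integral_eigen_tested (H : IsH1Strip δ u us ut) (T : HasTraces δ u ut gp gm)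
    (B : StripBC gp gm) (e : stripExpr h u us ut =ᵐ[stripMeasure δ] fun p => (l : ℂ) • u p)
    {φ φs φt ψ ψs ψt : ℝ × ℝ → ℂ} (hφ : IsTested δ u us ut gp gm φ φs φt)
    (hψ : IsTested δ u us ut gp gm ψ ψs ψt) (bp : ∀ s, φ (s, δ) = -ψ (s, δ))
    (bm : ∀ s, φ (s, -δ) = ψ (s, -δ)) :
    ∫ p, (Complex.I * h * (φs p * u p 1) + Complex.I * h * (ψs p * u p 0) + h * (φt p * u p 1) -
      h * (ψt p * u p 0) + p.2 * (φ p * u p 1) + p.2 * (ψ p * u p 0) - l * (φ p * u p 0) -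
      l * (ψ p * u p 1)) ∂(stripMeasure δ) = 0 := by
  have i1 := integrable_mul_apply hφ.memLp_s H.memLp 1
  have i2 := integrable_mul_apply hψ.memLp_s H.memLp 0
  have i3 := integrable_mul_apply hφ.memLp_t H.memLp 1
  have i4 := integrable_mul_apply hψ.memLp_t H.memLp 0
  have i5 := integrable_mul_apply hφ.memLp H.memLp 1
  have i6 := integrable_mul_apply hψ.memLp H.memLp 0
  have i7 := integrable_mul_apply hφ.memLp H.memLp 0
  have i8 := integrable_mul_apply hψ.memLp H.memLp 1
  have j1 := integrable_mul_apply hφ.memLp H.memLp_s 1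
  have j2 := integrable_mul_apply hψ.memLp H.memLp_s 0
  have j3 := integrable_mul_apply hφ.memLp H.memLp_t 1
  have j4 := integrable_mul_apply hψ.memLp H.memLp_t 0
  have t5 := integrable_snd_mul i5
  have t6 := integrable_snd_mul i6
  have a1 := congrArg (fun x : Spinor => x 1) hφ.eq_s
  have a2 := congrArg (fun x : Spinor => x 0) hψ.eq_s
  have b1 := congrArg (fun x : Spinor => x 1) hφ.eq_t
  have b2 := congrArg (fun x : Spinor => x 0) hψ.eq_t
  simp only [PiLp.neg_apply, PiLp.sub_apply, integral_mul_apply hφ.memLp_s H.memLp,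
    integral_mul_apply hφ.memLp H.memLp_s, integral_mul_apply hψ.memLp_s H.memLp,
    integral_mul_apply hψ.memLp H.memLp_s, integral_mul_apply hφ.memLp_t H.memLp,
    integral_mul_apply hφ.memLp H.memLp_t, integral_mul_apply hψ.memLp_t H.memLp,
    integral_mul_apply hψ.memLp H.memLp_t, integral_mul_apply hφ.memLp_p T.memLp_p,
    integral_mul_apply hψ.memLp_p T.memLp_p, integral_mul_apply hφ.memLp_m T.memLp_m,
    integral_mul_apply hψ.memLp_m T.memLp_m] at a1 a2 b1 b2
  -- The boundary condition of the test pair is matched to that of the traces, so that the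
  -- contributions of both components cancel on each boundary line.
  have cp : ∫ s, φ (s, δ) * gp s 1 = ∫ s, ψ (s, δ) * gp s 0 := by
    refine integral_congr_ae ?_
    filter_upwards [B.1] with s hs
    rw [bp, hs]
    ring
  have cm : ∫ s, φ (s, -δ) * gm s 1 = ∫ s, ψ (s, -δ) * gm s 0 := by
    refine integral_congr_ae ?_
    filter_upwards [B.2] with s hs
    rw [bm, hs]
  have e1 : ∫ p, (-(Complex.I * h) * (φ p * us p 1) - h * (φ p * ut p 1) + p.2 * (φ p * u p 1) -
      l * (φ p * u p 0)) ∂(stripMeasure δ) = 0 := by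
    refine integral_eq_zero_of_ae ?_
    filter_upwards [e] with p hp
    have := congrArg (fun x : Spinor => x 0) hp
    simp only [stripExpr, spinor_zero, PiLp.smul_apply, smul_eq_mul] at this
    rw [Pi.zero_apply]
    linear_combination φ p * this
  have e2 : ∫ p, (-(Complex.I * h) * (ψ p * us p 0) + h * (ψ p * ut p 0) + p.2 * (ψ p * u p 0) -
      l * (ψ p * u p 1)) ∂(stripMeasure δ) = 0 := by
    refine integral_eq_zero_of_ae ?_
    filter_upwards [e] with p hp
    have := congrArg (fun x : Spinor => x 1) hp
    simp only [stripExpr, spinor_one, PiLp.smul_apply, smul_eq_mul] at this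
    rw [Pi.zero_apply]
    linear_combination ψ p * this
  rw [integral_sub (by fun_prop) (by fun_prop), integral_add (by fun_prop) (by fun_prop),
    integral_sub (by fun_prop) (by fun_prop)] at e1
  rw [integral_sub (by fun_prop) (by fun_prop), integral_add (by fun_prop) (by fun_prop),
    integral_add (by fun_prop) (by fun_prop)] at e2
  rw [integral_sub (by fun_prop) (by fun_prop), integral_sub (by fun_prop) (by fun_prop),
    integral_add (by fun_prop) (by fun_prop), integral_add (by fun_prop) (by fun_prop),
    integral_sub (by fun_prop) (by fun_prop), integral_add (by fun_prop) (by fun_prop),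
    integral_add (by fun_prop) (by fun_prop)]
  simp only [integral_const_mul] at e1 e2 ⊢
  linear_combination e1 + e2 + Complex.I * h * a1 + Complex.I * h * a2 + h * b1 - h * b2 +
    h * cp - h * cm

/-- The `k`-th Fourier mode of an eigenfunction, localized by `χ`, is controlled by `χ'`. -/
theorem integral_cutoff_wave (hδ : 0 < δ) (hh : 0 < h) (hd : ∀ ξ, defect δ h ξ l ≠ 0)
    (H : IsH1Strip δ u us ut) (T : HasTraces δ u ut gp gm)
    (B : StripBC gp gm) (e : stripExpr h u us ut =ᵐ[stripMeasure δ] fun p => (l : ℂ) • u p)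
    {χ : ℝ → ℝ} (hχ : ContDiff ℝ ∞ χ) (hχc : HasCompactSupport χ) {F : ℝ → Spinor}
    (hF : Continuous F) (k : ℝ) :
    ∫ p, wave k p.1 * (χ p.1 * (F p.2 0 * u p 0 + F p.2 1 * u p 1)) ∂(stripMeasure δ) =
      -(Complex.I * h) * ∫ p, ((deriv χ p.1 : ℝ) * wave k p.1) *
        (res δ h (-(2 * Real.pi * h * k)) l F p.2 0 * u p 1 +
          res δ h (-(2 * Real.pi * h * k)) l F p.2 1 * u p 0) ∂(stripMeasure δ) := by
  -- The pairing is bilinear, without conjugation. Integration by parts changes the sign of the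
  -- longitudinal derivative, so the transposed operator acts on `e^{2πiks} w(t)` as the fibre at
  -- the opposite frequency.
  set ξ := -(2 * Real.pi * h * k) with hξ
  set w := res δ h ξ l F with hw
  have hwc : Continuous w := continuous_res_right hδ hh hd ξ hF
  have hvc : Continuous (inhomDeriv h ξ l F w) := continuous_inhomDeriv_right hF hwc
  have hder : ∀ i : Fin 2, ∀ t ∈ Ioo (-δ) δ,
      HasDerivAt (fun t => w t i) (inhomDeriv h ξ l F w t i) t := fun i t ht =>
    hasDerivAt_spinor_apply (hasDerivAt_res hδ hh (hd ξ) hF ht) i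
  have hwave : ContDiff ℝ ∞ (wave k) := by
    unfold wave
    exact Complex.contDiff_exp.comp ((Complex.ofRealCLM.contDiff.comp
      (by fun_prop : ContDiff ℝ ∞ fun s : ℝ => 2 * Real.pi * (k * s))).mul contDiff_const)
  have hc : ContDiff ℝ ∞ fun s => (χ s : ℂ) * wave k s :=
    (Complex.ofRealCLM.contDiff.comp hχ).mul hwave
  have hcc : HasCompactSupport fun s => (χ s : ℂ) * wave k s :=
    (hχc.comp_left Complex.ofReal_zero).mul_right
  have hcd : ∀ s, HasDerivAt (fun s => (χ s : ℂ) * wave k s)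
      ((deriv χ s : ℝ) * wave k s + χ s * (wave k s * (2 * Real.pi * k * Complex.I))) s := fun s =>
    ((hχ.differentiable (by simp)) s).hasDerivAt.ofReal_comp.mul (hasDerivAt_wave k s)
  have t0 := isTested_tensor H T hδ hc hcc hcd (continuous_spinor_apply hwc 0)
    (continuous_spinor_apply hvc 0) (hder 0)
  have t1 := isTested_tensor H T hδ hc hcc hcd (continuous_spinor_apply hwc 1)
    (continuous_spinor_apply hvc 1) (hder 1)
  obtain ⟨bp, bm⟩ := fiberBC_res hδ hh ξ l F
  have key := integral_eigen_tested H T B e t0 t1 (fun s => by simp only [hw, bp]; ring)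
    (fun s => by simp only [hw, bm])
  have hχ1 : Continuous fun s => ((deriv χ s : ℝ) : ℂ) * wave k s :=
    (Complex.continuous_ofReal.comp (hχ.continuous_deriv (by simp))).mul hwave.continuous
  have hχ1c : HasCompactSupport fun s => ((deriv χ s : ℝ) : ℂ) * wave k s :=
    (hχc.deriv.comp_left Complex.ofReal_zero).mul_right
  have iF := fun i => integrable_tensor_mul_apply hc.continuous hcc (continuous_spinor_apply hF i)
    H.memLp i
  have iw := fun i j => integrable_tensor_mul_apply hχ1 hχ1c (continuous_spinor_apply hwc i)
    H.memLp j
  have heq := fun t => fiberExpr_inhomDeriv (ξ := ξ) (l := l) hh F w t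
  -- In the tested equation the fibre resolvent turns the terms with `χ` into the pairing with `F`.
  -- Only the terms with `χ'` are left on the other side.
  rw [← integral_const_mul, eq_comm, ← sub_eq_zero, ← neg_eq_zero, ← key, ← integral_sub]
  rotate_left
  · refine (((iw 0 1).add (iw 1 0)).const_mul (-(Complex.I * h))).congr
      (Eventually.of_forall fun p => ?_)
    simp only [Pi.add_apply]
    ring
  · refine ((iF 0).add (iF 1)).congr (Eventually.of_forall fun p => ?_)
    simp only [Pi.add_apply]
    ring
  rw [← integral_neg]
  refine integral_congr_ae (Eventually.of_forall fun p => ?_)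
  have q0 := congrArg (fun x : Spinor => x 0) (heq p.2)
  have q1 := congrArg (fun x : Spinor => x 1) (heq p.2)
  simp only [fiberExpr, spinor_zero, spinor_one, PiLp.add_apply, PiLp.smul_apply, smul_eq_mul]
    at q0 q1
  have hξ' : (ξ : ℂ) = -(2 * Real.pi * h * k) := by rw [hξ]; push_cast; ring
  push_cast at q0 q1
  rw [hξ'] at q0 q1
  simp only
  linear_combination (-(χ p.1 : ℂ) * wave k p.1 * u p 0) * q0 -
    ((χ p.1 : ℂ) * wave k p.1 * u p 1) * q1 -
    (χ p.1 * wave k p.1 * 2 * Real.pi * k * h * (w p.2 0 * u p 1 + w p.2 1 * u p 0)) * Complex.I_sq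

end Injectivity

/-- Cutoff functions whose derivatives tend to zero in `L²`. -/
theorem exists_cutoff : ∃ (χ : ℕ → ℝ → ℝ) (K : ℝ), 0 ≤ K ∧ (∀ n, ContDiff ℝ ∞ (χ n)) ∧
    (∀ n, HasCompactSupport (χ n)) ∧ (∀ M, ∀ᶠ n in atTop, ∀ s, |s| ≤ M → χ n s = 1) ∧
    ∀ n, ∫ s, deriv (χ n) s ^ 2 ≤ K / (n + 1) ^ 2 := by
  let η : ContDiffBump (0 : ℝ) := ⟨1, 2, by norm_num, by norm_num⟩
  have hL : ∀ n : ℕ, (0 : ℝ) < ((n : ℝ) + 1) ^ 2 := fun n => by positivity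
  -- Stretching a bump by the factor `L = (n + 1)²` divides the squared `L²` norm of its derivative
  -- by `L`.
  refine ⟨fun n s => η (s / ((n : ℝ) + 1) ^ 2), ∫ s, deriv η s ^ 2,
    integral_nonneg fun s => sq_nonneg _, fun n => η.contDiff.comp (by fun_prop), fun n => ?_,
    fun M => ?_, fun n => ?_⟩
  · have := η.hasCompactSupport.comp_homeomorph (Homeomorph.mulRight₀ (((n : ℝ) + 1) ^ 2)⁻¹
      (inv_ne_zero (hL n).ne'))
    simpa only [Function.comp_def, Homeomorph.coe_mulRight₀, div_eq_mul_inv] using this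
  · filter_upwards [eventually_ge_atTop ⌈M⌉₊] with n hn s hs
    refine η.one_of_mem_closedBall ?_
    rw [mem_closedBall_zero_iff, Real.norm_eq_abs, abs_div, abs_of_pos (hL n), div_le_one (hL n)]
    have h1 : M ≤ n := (Nat.le_ceil M).trans (by exact_mod_cast hn)
    nlinarith [(Nat.cast_nonneg n : (0 : ℝ) ≤ n)]
  · have hd : ∀ s, deriv (fun s => η (s / ((n : ℝ) + 1) ^ 2)) s =
        deriv η (s / ((n : ℝ) + 1) ^ 2) / ((n : ℝ) + 1) ^ 2 := fun s => by
      have h1 : DifferentiableAt ℝ (fun x => η x) (s / ((n : ℝ) + 1) ^ 2) :=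
        ((η.contDiff (n := ⊤)).differentiable (by simp)) (s / ((n : ℝ) + 1) ^ 2)
      have h2 := h1.hasDerivAt.scomp s ((hasDerivAt_id s).div_const (((n : ℝ) + 1) ^ 2))
      refine h2.deriv.trans ?_
      rw [smul_eq_mul]
      ring
    simp only [hd, div_pow _ _ 2]
    rw [integral_div, Measure.integral_comp_div (fun s => deriv η s ^ 2), abs_of_pos (hL n),
      smul_eq_mul]
    refine le_of_eq ?_
    field_simp

/-! ### Vanishing of eigenfunctions by cutoffs and Fourier inversion -/

section Injectivity

variable {δ h l : ℝ} {u us ut : ℝ × ℝ → Spinor} {gp gm : ℝ → Spinor}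

/-- Young's inequality `|c| ‖u‖ ≤ ε ‖u‖² + ε⁻¹ c²`, integrated over the strip. The free parameter
`ε` is chosen later to balance the two terms. -/
theorem norm_integral_cutoff_le (hδ : 0 < δ) (hu : MemLp u 2 (stripMeasure δ)) {c : ℝ → ℝ}
    (hc : Continuous c) (hcc : HasCompactSupport c) {g : ℝ × ℝ → ℂ} {W : ℝ}
    (hg : ∀ p ∈ strip δ, ‖g p‖ ≤ |c p.1| * (W * ‖u p‖)) (hW : 0 ≤ W) {ε : ℝ} (hε : 0 < ε) :
    ‖∫ p, g p ∂(stripMeasure δ)‖ ≤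
      W * (ε * ∫ p, ‖u p‖ ^ 2 ∂(stripMeasure δ) + ε⁻¹ * (2 * δ * ∫ s, c s ^ 2)) := by
  have iu : Integrable (fun p => ‖u p‖ ^ 2) (stripMeasure δ) :=
    (memLp_two_iff_integrable_sq_norm hu.1).1 hu
  have hc2 : Integrable fun s => c s ^ 2 :=
    (hc.memLp_of_hasCompactSupport (p := 2) hcc).integrable_sq
  have ic : Integrable (fun p : ℝ × ℝ => c p.1 ^ 2) (stripMeasure δ) := by
    rw [stripMeasure_eq_prod]
    have := hc2.mul_prod (integrable_const (1 : ℝ) (μ := intervalMeasure δ))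
    simpa only [mul_one] using this
  have ec : ∫ p : ℝ × ℝ, c p.1 ^ 2 ∂(stripMeasure δ) = 2 * δ * ∫ s, c s ^ 2 := by
    rw [stripMeasure_eq_prod]
    have := integral_prod_mul (μ := (volume : Measure ℝ)) (ν := intervalMeasure δ)
      (fun s => c s ^ 2) (fun _ => (1 : ℝ))
    simp only [mul_one] at this
    rw [this, setIntegral_const, Measure.real, Real.volume_Ioo, ENNReal.toReal_ofReal (by linarith),
      smul_eq_mul]
    ring
  rw [← ec, ← integral_const_mul, ← integral_const_mul,
    ← integral_add (iu.const_mul _) (ic.const_mul _), ← integral_const_mul]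
  refine norm_integral_le_of_norm_le (((iu.const_mul _).add (ic.const_mul _)).const_mul _) ?_
  filter_upwards [ae_restrict_mem (isOpen_strip δ).measurableSet] with p hp
  refine (hg p hp).trans ?_
  rw [mul_left_comm]
  refine mul_le_mul_of_nonneg_left ?_ hW
  have h1 : |c p.1| * ‖u p‖ = ε⁻¹ * (|c p.1| * (ε * ‖u p‖)) := by field_simp
  have h2 : ε * ‖u p‖ ^ 2 + ε⁻¹ * c p.1 ^ 2 = ε⁻¹ * ((ε * ‖u p‖) ^ 2 + |c p.1| ^ 2) := by
    rw [sq_abs]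
    field_simp
  rw [h1, h2]
  refine mul_le_mul_of_nonneg_left ?_ (by positivity)
  nlinarith [sq_nonneg (|c p.1| - ε * ‖u p‖), sq_nonneg (|c p.1|), sq_nonneg (ε * ‖u p‖)]

/-- Eigenfunctions have no Fourier modes, up to cutoffs. -/
theorem exists_norm_integral_wave_le (hδ : 0 < δ) (hh : 0 < h) (hd : ∀ ξ, defect δ h ξ l ≠ 0)
    (H : IsH1Strip δ u us ut) (T : HasTraces δ u ut gp gm)
    (B : StripBC gp gm) (e : stripExpr h u us ut =ᵐ[stripMeasure δ] fun p => (l : ℂ) • u p)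
    {χ : ℕ → ℝ → ℝ} {K : ℝ} (hχ : ∀ n, ContDiff ℝ ∞ (χ n)) (hχc : ∀ n, HasCompactSupport (χ n))
    (hK : ∀ n, ∫ s, deriv (χ n) s ^ 2 ≤ K / (n + 1) ^ 2) {F : ℝ → Spinor} (hF : Continuous F) :
    ∃ C, 0 ≤ C ∧ ∀ n k, ‖∫ p, wave k p.1 * (χ n p.1 * (F p.2 0 * u p 0 + F p.2 1 * u p 1))
      ∂(stripMeasure δ)‖ ≤ C / (n + 1) := by
  obtain ⟨C, hC0, hC⟩ := exists_res_bound hδ hh hd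
  have hK0 : 0 ≤ K := by
    have := (integral_nonneg fun s => sq_nonneg (deriv (χ 0) s)).trans (hK 0)
    simpa using this
  have hF0 : 0 ≤ ∫ t in (-δ)..δ, ‖F t‖ ^ 2 :=
    intervalIntegral.integral_nonneg (by linarith) fun _ _ => by positivity
  set W := 2 * √(C * ∫ t in (-δ)..δ, ‖F t‖ ^ 2)
  have hW : 0 ≤ W := by positivity
  have hw : ∀ ξ, ∀ t ∈ Icc (-δ) δ, 2 * ‖res δ h ξ l F t‖ ≤ W := fun ξ t ht =>
    mul_le_mul_of_nonneg_left (Real.le_sqrt_of_sq_le ((hC ξ F hF).2.2.2 t ht)) (by norm_num)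
  have hu0 : 0 ≤ ∫ p, ‖u p‖ ^ 2 ∂(stripMeasure δ) := integral_nonneg fun _ => by positivity
  refine ⟨h * (W * ((∫ p, ‖u p‖ ^ 2 ∂(stripMeasure δ)) + 2 * δ * K)), by positivity, fun n k => ?_⟩
  rw [integral_cutoff_wave hδ hh hd H T B e (hχ n) (hχc n) hF k, norm_mul, norm_neg, norm_mul,
    Complex.norm_I, one_mul, Complex.norm_real, Real.norm_eq_abs, abs_of_pos hh, mul_div_assoc]
  refine mul_le_mul_of_nonneg_left ?_ hh.le
  have hn : (0 : ℝ) < (n : ℝ) + 1 := by positivity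
  -- With `ε = 1/(n + 1)` and `∫ (χₙ')² ≤ K/(n + 1)²` both terms are of order `1/(n + 1)`, uniformly
  -- in the frequency.
  refine (norm_integral_cutoff_le hδ H.memLp ((hχ n).continuous_deriv (by simp)) (hχc n).deriv
    (fun p hp => ?_) hW (inv_pos.2 hn)).trans ?_
  · rw [norm_mul, norm_mul, norm_wave, mul_one, Complex.norm_real, Real.norm_eq_abs]
    refine mul_le_mul_of_nonneg_left ?_ (abs_nonneg _)
    refine (norm_add_le _ _).trans ?_
    rw [norm_mul, norm_mul]
    have h1 := hw (-(2 * Real.pi * h * k)) p.2 (Ioo_subset_Icc_self hp.2)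
    have h2 := mul_le_mul_of_nonneg_right h1 (norm_nonneg (u p))
    have a := mul_le_mul (norm_spinor_apply_le (res δ h (-(2 * Real.pi * h * k)) l F p.2) 0)
      (norm_spinor_apply_le (u p) 1) (norm_nonneg _) (norm_nonneg _)
    have b := mul_le_mul (norm_spinor_apply_le (res δ h (-(2 * Real.pi * h * k)) l F p.2) 1)
      (norm_spinor_apply_le (u p) 0) (norm_nonneg _) (norm_nonneg _)
    linarith
  · rw [mul_div_assoc, inv_inv]
    refine mul_le_mul_of_nonneg_left ?_ hW
    have h3 : ((n : ℝ) + 1) * (2 * δ * ∫ s, deriv (χ n) s ^ 2) ≤ 2 * δ * K / (n + 1) := by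
      calc ((n : ℝ) + 1) * (2 * δ * ∫ s, deriv (χ n) s ^ 2)
          ≤ ((n : ℝ) + 1) * (2 * δ * (K / (n + 1) ^ 2)) := by gcongr; exact hK n
        _ = _ := by field_simp
    rw [add_div, div_eq_inv_mul (∫ p, ‖u p‖ ^ 2 ∂(stripMeasure δ))]
    linarith

/-- As `u` is only square integrable, its Fourier modes in `s` need a cutoff. If `χₙ = 1` on the
support of `φ`, then `φ = χₙ φ`, and Fourier inversion of `φ` writes the pairing as an integral of
cut off modes against an integrable symbol. The uniform bound `C/(n + 1)` on the modes makes it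
vanish. -/
theorem integral_tensor_eq_zero (hδ : 0 < δ) (hh : 0 < h) (hd : ∀ ξ, defect δ h ξ l ≠ 0)
    (H : IsH1Strip δ u us ut) (T : HasTraces δ u ut gp gm)
    (B : StripBC gp gm) (e : stripExpr h u us ut =ᵐ[stripMeasure δ] fun p => (l : ℂ) • u p)
    {φ : ℝ → ℝ} (hφ : ContDiff ℝ ∞ φ) (hφc : HasCompactSupport φ) {F : ℝ → Spinor}
    (hF : Continuous F) :
    ∫ p, (φ p.1 : ℂ) * (F p.2 0 * u p 0 + F p.2 1 * u p 1) ∂(stripMeasure δ) = 0 := by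
  obtain ⟨χ, K, hK0, hχ, hχc, hχ1, hK⟩ := exists_cutoff
  obtain ⟨C, hC0, hC⟩ := exists_norm_integral_wave_le hδ hh hd H T B e hχ hχc hK hF
  obtain ⟨α, hα, ⟨A, hA0, hA⟩, hαφ⟩ := exists_symbol_tensor hφ hφc
  have iα : Integrable α := by
    refine (integrable_decay.const_mul A).mono' hα.aestronglyMeasurable
      (Eventually.of_forall fun k => (hA k).trans ?_)
    refine mul_le_mul_of_nonneg_left ?_ hA0
    nlinarith [decay_pos k, decay_le_one k]
  obtain ⟨M, hM⟩ := hφc.isCompact.isBounded.exists_norm_le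
  have hlim : Tendsto (fun n : ℕ => (∫ k, ‖α k‖) * (C / ((n : ℝ) + 1))) atTop (𝓝 0) := by
    have := (tendsto_one_div_add_atTop_nhds_zero_nat (𝕜 := ℝ)).const_mul ((∫ k, ‖α k‖) * C)
    rw [mul_zero] at this
    refine this.congr fun n => by ring
  rw [← norm_le_zero_iff]
  refine ge_of_tendsto hlim ?_
  filter_upwards [hχ1 M] with n hn
  have hcut : ∀ s, χ n s * φ s = φ s := fun s => by
    by_cases hs : s ∈ tsupport φ
    · rw [hn s (hM s hs), one_mul]
    · rw [image_eq_zero_of_notMem_tsupport hs, mul_zero]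
  set g : ℝ × ℝ → ℂ := fun p => χ n p.1 * (F p.2 0 * u p 0 + F p.2 1 * u p 1) with hg
  have ig : Integrable g (stripMeasure δ) := by
    have i := fun i => integrable_tensor_mul_apply
      (Complex.continuous_ofReal.comp (hχ n).continuous) ((hχc n).comp_left Complex.ofReal_zero)
      (continuous_spinor_apply hF i) H.memLp i
    refine ((i 0).add (i 1)).congr (Eventually.of_forall fun p => ?_)
    simp only [Pi.add_apply, Function.comp_apply, hg]
    ring
  have e1 : ∀ p : ℝ × ℝ, (φ p.1 : ℂ) * (F p.2 0 * u p 0 + F p.2 1 * u p 1) =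
      ∫ k, wave k p.1 * (g p * α k) := fun p => by
    have : ∀ k, wave k p.1 * (g p * α k) = g p * (wave k p.1 * α k) := fun k => by ring
    simp only [this]
    have h1 : (χ n p.1 : ℂ) * φ p.1 = φ p.1 := by exact_mod_cast hcut p.1
    rw [integral_const_mul, hαφ, hg]
    linear_combination -(F p.2 0 * u p 0 + F p.2 1 * u p 1) * h1
  simp only [e1]
  rw [integral_integral_swap]
  · have e2 : ∀ k, ∫ p, wave k p.1 * (g p * α k) ∂(stripMeasure δ) =
        α k * ∫ p, wave k p.1 * g p ∂(stripMeasure δ) := fun k => by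
      rw [← integral_const_mul]
      congr 1
      funext p
      ring
    simp only [e2]
    rw [← integral_mul_const]
    refine norm_integral_le_of_norm_le (iα.norm.mul_const _) (Eventually.of_forall fun k => ?_)
    rw [norm_mul]
    exact mul_le_mul_of_nonneg_left (hC n k) (norm_nonneg _)
  · refine (ig.mul_prod iα).bdd_mul (c := 1) ?_ (Eventually.of_forall fun q => ?_)
    · exact (continuous_wave.comp (by fun_prop : Continuous fun q : (ℝ × ℝ) × ℝ =>
        (q.2, q.1.1))).aestronglyMeasurable
    · rw [norm_wave]

/-- Away from the dispersion curves there are no eigenfunctions. -/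
theorem eq_zero_of_mem_graph (hδ : 0 < δ) (hh : 0 < h) (hd : ∀ ξ, defect δ h ξ l ≠ 0)
    {x : L2Strip δ} (hx : (x, (l : ℂ) • x) ∈ (stripDirac δ h).graph) : x = 0 := by
  rw [stripDirac_graph] at hx
  obtain ⟨u, us, ut, gp, gm, H, T, B, e1, e2⟩ := hx
  have e : stripExpr h u us ut =ᵐ[stripMeasure δ] fun p => (l : ℂ) • u p := by
    filter_upwards [e1, e2, Lp.coeFn_smul (l : ℂ) x] with p h1 h2 h3
    rw [← h2, h3, Pi.smul_apply, h1]
  refine eq_zero_of_tensor x fun φ hφ hφc n => ?_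
  have hm : MemLp (fun p : ℝ × ℝ => ((φ p.1 * p.2 ^ n : ℝ) : ℂ)) 2 (stripMeasure δ) :=
    (memLp_tensor (hφ.continuous.memLp_of_hasCompactSupport hφc)
      (memLp_interval_of_continuous δ (continuous_pow n))).ofReal
  have e3 : ∫ p, (φ p.1 * p.2 ^ n) • x p ∂(stripMeasure δ) =
      ∫ p, ((φ p.1 * p.2 ^ n : ℝ) : ℂ) • u p ∂(stripMeasure δ) := by
    refine integral_congr_ae ?_
    filter_upwards [e1] with p hp
    rw [Complex.coe_smul, hp]
  rw [e3]
  refine spinor_ext ?_ ?_ <;> rw [integral_mul_apply hm H.memLp]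
  · have := integral_tensor_eq_zero hδ hh hd H T B e hφ hφc
      (F := fun t => !₂[(t : ℂ) ^ n, 0]) (by fun_prop)
    rw [PiLp.zero_apply, ← this]
    congr 1
    funext p
    simp [mul_assoc]
  · have := integral_tensor_eq_zero hδ hh hd H T B e hφ hφc
      (F := fun t => !₂[0, (t : ℂ) ^ n]) (by fun_prop)
    rw [PiLp.zero_apply, ← this]
    congr 1
    funext p
    simp [mul_assoc]

/-- The right inverse solves the equation. It is also a left inverse, because `R (T x - l x) - x`
lies in the kernel of `T - l`, which is trivial. -/
theorem mem_resolventSet_of_defect_ne_zero (hδ : 0 < δ) (hh : 0 < h)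
    (hd : ∀ ξ, defect δ h ξ l ≠ 0) : (l : ℂ) ∈ resolventSet (stripDirac δ h) := by
  obtain ⟨R, hR⟩ := exists_right_inverse hδ hh hd
  refine ⟨R, fun f => ?_, fun x => ?_⟩
  · obtain ⟨y, hy, hTy⟩ := (LinearPMap.mem_graph_iff _).1 (hR f)
    have hdom : R f ∈ (stripDirac δ h).domain := by
      rw [← show (y : L2Strip δ) = R f from hy]
      exact y.2
    refine ⟨hdom, ?_⟩
    have : (⟨R f, hdom⟩ : (stripDirac δ h).domain) = y := Subtype.ext hy.symm
    rw [this, hTy]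
    exact add_sub_cancel_left _ _
  · have h1 := hR (stripDirac δ h x - (l : ℂ) • (x : L2Strip δ))
    have h2 := (stripDirac δ h).graph.sub_mem h1 ((stripDirac δ h).mem_graph x)
    rw [← sub_eq_zero]
    refine eq_zero_of_mem_graph hδ hh hd ?_
    convert h2 using 1
    refine Prod.ext rfl ?_
    simp only [Prod.snd_sub, smul_sub]
    abel

end Injectivity

/-- The non-negative spectrum of the Dirac operator on the strip. -/
theorem spectrum_stripDirac {δ h : ℝ} (hδ : 0 < δ) (hh : 0 < h) :
    {l : ℝ | (l : ℂ) ∈ spectrum (stripDirac δ h)} ∩ Ici 0 = Ici (lambdaEss δ h) := by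
  ext l
  constructor
  · rintro ⟨hl, hl0⟩
    by_contra hlt
    rw [mem_Ici, not_le] at hlt
    -- Below the infimum `l` lies below every `μ₁⁺(ξ, h)`, so the defect is positive on every fibre.
    -- The value `l = 0` is included.
    exact hl (mem_resolventSet_of_defect_ne_zero hδ hh fun ξ =>
      (defect_pos_of_lt_mu1 hδ hh hl0 (hlt.trans_le (lambdaEss_le hδ hh ξ))).ne')
  · intro hl
    obtain ⟨ξ, hξ⟩ := exists_defect_eq_zero hδ hh hl
    exact ⟨mem_spectrum_of_defect_eq_zero hδ hh hξ, (lambdaEss_pos hδ hh).le.trans hl⟩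

end DiracStrip

end

theorem mainTheorem7 (δ : ℝ) (hδ : 0 < δ) :
    -- `μ₁⁺(ξ, h)` is the smallest positive eigenvalue
    (∀ h : ℝ, 0 < h → ∀ ξ : ℝ,
      IsLeast (DiracStrip.positiveEigenvalues δ ξ h) (DiracStrip.mu1 δ ξ h)) ∧
    -- (a)
    (∀ h : ℝ, 0 < h → ∀ ξ : ℝ, DiracStrip.mu1 δ ξ h ≤ DiracStrip.nu1 δ ξ h) ∧
    -- (b)
    (∀ h : ℝ, 0 < h →
      IsLeast (range fun ξ : ℝ => DiracStrip.nu1 δ ξ h) (DiracStrip.nu1 δ 0 h)) ∧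
    ((fun h : ℝ => DiracStrip.nu1 δ 0 h) ~[𝓝[>] 0]
      fun h : ℝ => 2 * Real.sqrt (h / Real.pi) * Real.exp (-δ ^ 2 / h)) ∧
    -- (c)
    (∀ h : ℝ, 0 < h → ∀ ξ : ℝ, δ < |ξ| →
      |ξ| - δ - h / (|ξ| - δ) ≤ DiracStrip.mu1 δ ξ h) ∧
    -- (d)
    (∃ r : ℝ → ℝ, Tendsto r (𝓝[>] 0) (𝓝 0) ∧
      ∀ h : ℝ, 0 < h → ∀ ξ : ℝ,
        DiracStrip.mu1 δ ξ h ≤ 2 * Real.sqrt h * Real.exp (-δ ^ 2 / h) →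
        DiracStrip.nu1 δ ξ h * (1 + r h) ≤ DiracStrip.mu1 δ ξ h) ∧
    -- the nonnegative part of the spectrum on the strip
    (∀ h : ℝ, 0 < h →
      {l : ℝ | (l : ℂ) ∈ DiracStrip.spectrum (DiracStrip.stripDirac δ h)} ∩ Ici 0 =
        Ici (DiracStrip.lambdaEss δ h)) ∧
    ((fun h : ℝ => DiracStrip.lambdaEss δ h) ~[𝓝[>] 0]
      fun h : ℝ => 2 * Real.sqrt (h / Real.pi) * Real.exp (-δ ^ 2 / h)) := by
  refine ⟨fun h hh ξ => (DiracStrip.mu1_spec hδ hh ξ).1, fun h hh ξ =>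
    DiracStrip.mu1_le_nu1 hδ hh ξ, fun h hh => ⟨⟨0, rfl⟩, ?_⟩, DiracStrip.nu1_zero_equivalent hδ,
    fun h hh ξ hξ => ?_, DiracStrip.exists_lower_bound hδ, fun h hh =>
    DiracStrip.spectrum_stripDirac hδ hh, DiracStrip.lambdaEss_equivalent hδ⟩
  · rintro _ ⟨ξ, rfl⟩
    exact DiracStrip.nu1_zero_le hδ hh ξ
  -- The bound `|ξ| - δ ≤ μ₁⁺` already holds, and the subtracted term is nonnegative.
  · have h1 := DiracStrip.abs_sub_le_mu1 hδ hh ξ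
    have h2 : 0 ≤ h / (|ξ| - δ) := div_nonneg hh.le (by linarith)
    linarith
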